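/- Let $(\xi_i)_{i\in\mathbb Z}$ be a stationary Markov chain on a probability space $(\Omega,\mathcal F,P)$, with values in a measurable space $(S,\mathcal S)$, transition probabilities $Q(x,A)$ and invariant distribution $\pi$ (the law of every $\xi_i$), and assume that it is reversible: $(\xi_i,\xi_{i+1})$ and $(\xi_{i+1},\xi_i)$ have the same distribution. Write $E_\pi$ for the integral with respect to $\pi$, $Qf(x)=\int_S f(y)\,Q(x,dy)$, and also $Q$ for the resulting self-adjoint contraction of $L_2(S,\pi)$. Let $f:S\to\mathbb R$ satisfy $E_\pi f=0$ and $E_\pi f^2<\infty$, let $S_n=\sum_{j=1}^n f(\xi_j)$, let $\rho_f$ be the spectral measure of $f$ with respect to the self-adjoint operator $Q$, and let $L_2^0$ be the set of real functions that are square integrable with respect to $\pi$ and have mean $0$. Then the following five conditions are equivalent: (a) the real sequence $\sum_{k=1}^n E_\pi(fQ^kf)$, $n\ge1$, is bounded; (b) $\sup_{n\ge1}E(S_n^2)/n<\infty$; (c) $E(S_n^2)/n$ converges to a finite limit $\sigma^2$ as $n\to\infty$; (d) $\displaystyle\int_{[-1,1]}\frac{1}{1-t}\,d\rho_f(t)<\infty$,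 where the integrand is $+\infty$ at $t=1$; (e) $f\in\sqrt{1-Q}\,L_2^0$. If one of them (hence each of them) holds, then $$E_\pi\sup_{k\ge1}\Big|\sum_{j=1}^k j^{-1/2}Q^jf\Big|^2<\infty .$$ -/

import Mathlib

open MeasureTheory ProbabilityTheory Filter Topology
open scoped ENNReal CompactlySupported

noncomputable section

namespace ReversibleChain

variable {S Ω : Type*} [MeasurableSpace S] [MeasurableSpace Ω]

/-! ### The chain -/

/-- `(ξ_i)_{i ∈ ℤ}` is, under `P`, a stationary reversible Markov chain with state space `S`,
transition probabilities `Q(x, A)` and invariant distribution `π`. -/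
structure IsStationaryReversibleMarkovChain (Q : Kernel S S) (π : Measure S)
    (P : Measure Ω) (ξ : ℤ → Ω → S) : Prop where
  /-- every `ξ_i` is a random variable with values in `S` -/
  measurable : ∀ i, Measurable (ξ i)
  /-- every `ξ_i` has distribution `π` -/
  law : ∀ i, P.map (ξ i) = π
  /-- Markov property: `P(ξ_{i+1} ∈ A | ξ_j, j ≤ i) = Q(ξ_i, A)` almost surely -/
  markov : ∀ (i : ℤ) (A : Set S), MeasurableSet A →
    P[(ξ (i + 1) ⁻¹' A).indicator (fun _ => (1 : ℝ)) |
        ⨆ j : Set.Iic i, MeasurableSpace.comap (ξ j) inferInstance]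
      =ᵐ[P] fun ω => (Q (ξ i ω)).real A
  /-- reversibility: `(ξ_i, ξ_{i+1})` and `(ξ_{i+1}, ξ_i)` have the same distribution -/
  reversible : ∀ i : ℤ, P.map (fun ω => (ξ i ω, ξ (i + 1) ω)) =
    P.map (fun ω => (ξ (i + 1) ω, ξ i ω))

/-- The law of the chain is invariant under the transition kernel. -/
theorem IsStationaryReversibleMarkovChain.invariant {Q : Kernel S S} [IsMarkovKernel Q]
    {π : Measure S} {P : Measure Ω} [IsProbabilityMeasure P] {ξ : ℤ → Ω → S}
    (h : IsStationaryReversibleMarkovChain Q π P ξ) : Q.Invariant π := by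
  have hπ : IsProbabilityMeasure π := by
    rw [← h.law 0]; exact Measure.isProbabilityMeasure_map (h.measurable 0).aemeasurable
  refine Measure.ext fun A hA => ?_
  have hm : (⨆ j : Set.Iic (0 : ℤ), MeasurableSpace.comap (ξ j) inferInstance)
      ≤ (inferInstance : MeasurableSpace Ω) :=
    iSup_le fun j => (h.measurable j).comap_le
  have h1 := integral_congr_ae (h.markov 0 A hA)
  rw [integral_condExp hm, integral_indicator_const _ (h.measurable _ hA), smul_eq_mul, mul_one,
    ← integral_map (f := fun x => (Q x).real A) (h.measurable 0).aemeasurable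
      (Q.measurable_coe hA).ennreal_toReal.aestronglyMeasurable, h.law 0] at h1
  have h2 : P (ξ (0 + 1) ⁻¹' A) = π A := by
    rw [← h.law (0 + 1), Measure.map_apply (h.measurable _) hA]
  rw [Measure.real, h2] at h1
  simp only [Measure.real] at h1
  rw [integral_toReal (Q.measurable_coe hA).aemeasurable
    (ae_of_all _ fun x => measure_lt_top _ _)] at h1
  rw [Measure.bind_apply hA Q.aemeasurable]
  refine ((ENNReal.toReal_eq_toReal_iff' (measure_ne_top _ _) ?_).1 h1).symm
  refine ((lintegral_mono fun x => prob_le_one).trans_lt ?_).ne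
  simp

/-- `S_n = f(ξ_1) + ⋯ + f(ξ_n)`. -/
def partialSum (f : S → ℝ) (ξ : ℤ → Ω → S) (n : ℕ) (ω : Ω) : ℝ :=
  ∑ j ∈ Finset.Icc 1 n, f (ξ j ω)

/-! ### The transition operator, pointwise and on `L²(π)` -/

/-- `(Qf)(x) = ∫ f(y) Q(x, dy)`. -/
def transition {E : Type*} [NormedAddCommGroup E] [NormedSpace ℝ E] (Q : Kernel S S)
    (f : S → E) (x : S) : E :=
  ∫ y, f y ∂(Q x)

/-- `Q^j f`. -/
def transitionPow (Q : Kernel S S) (j : ℕ) (f : S → ℝ) : S → ℝ :=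
  (transition Q)^[j] f

section L2

variable {Q : Kernel S S} {π : Measure S}

theorem ae_ae_of_invariant (h : Q.Invariant π) {p : S → Prop} (hp : ∀ᵐ y ∂π, p y) :
    ∀ᵐ x ∂π, ∀ᵐ y ∂(Q x), p y := by
  rw [← h.def] at hp
  exact Measure.ae_ae_of_ae_bind Q.aemeasurable hp

theorem transition_congr (h : Q.Invariant π) {g g' : S → ℂ} (hg : g =ᵐ[π] g') :
    transition Q g =ᵐ[π] transition Q g' := by
  filter_upwards [ae_ae_of_invariant h hg] with x hx using integral_congr_ae hx

variable [IsMarkovKernel Q]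

theorem lintegral_sq_transition_le (h : Q.Invariant π) {g : S → ℂ} (hg : StronglyMeasurable g) :
    ∫⁻ x, ‖transition Q g x‖ₑ ^ (2 : ℝ) ∂π ≤ ∫⁻ x, ‖g x‖ₑ ^ (2 : ℝ) ∂π := by
  calc ∫⁻ x, ‖transition Q g x‖ₑ ^ (2 : ℝ) ∂π
      ≤ ∫⁻ x, ∫⁻ y, ‖g y‖ₑ ^ (2 : ℝ) ∂(Q x) ∂π := by
        refine lintegral_mono fun x => ?_
        have h1 : ‖transition Q g x‖ₑ ≤ eLpNorm g 2 (Q x) :=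
          (enorm_integral_le_lintegral_enorm _).trans
            (by
              rw [← eLpNorm_one_eq_lintegral_enorm]
              exact eLpNorm_le_eLpNorm_of_exponent_le (by norm_num) hg.aestronglyMeasurable)
        refine (ENNReal.rpow_le_rpow h1 (by norm_num)).trans ?_
        rw [eLpNorm_eq_lintegral_rpow_enorm_toReal (by norm_num) (by norm_num),
          ← ENNReal.rpow_mul]
        simp
    _ = ∫⁻ x, ‖g x‖ₑ ^ (2 : ℝ) ∂π := by
        rw [← Measure.lintegral_bind Q.aemeasurable (by fun_prop), h.def]

theorem eLpNorm_transition_le (h : Q.Invariant π) {g : S → ℂ} (hg : StronglyMeasurable g) :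
    eLpNorm (transition Q g) 2 π ≤ eLpNorm g 2 π := by
  simp only [eLpNorm_eq_lintegral_rpow_enorm_toReal (p := 2) (by norm_num) (by norm_num)]
  exact ENNReal.rpow_le_rpow (by simpa using lintegral_sq_transition_le h hg) (by norm_num)

theorem memLp_transition (h : Q.Invariant π) (g : Lp ℂ 2 π) : MemLp (transition Q g) 2 π :=
  ⟨((Lp.stronglyMeasurable g).integral_kernel).aestronglyMeasurable,
    (eLpNorm_transition_le h (Lp.stronglyMeasurable g)).trans_lt (Lp.memLp g).2⟩

theorem ae_integrable_of_memLp (h : Q.Invariant π) (g : Lp ℂ 2 π) :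
    ∀ᵐ x ∂π, Integrable g (Q x) := by
  have hm : Measurable fun y => ‖g y‖ₑ ^ (2 : ℝ) := by
    have := (Lp.stronglyMeasurable g).measurable
    fun_prop
  have h1 : ∫⁻ x, ∫⁻ y, ‖g y‖ₑ ^ (2 : ℝ) ∂(Q x) ∂π ≠ ∞ := by
    rw [← Measure.lintegral_bind Q.aemeasurable hm.aemeasurable, h.def]
    have := lintegral_rpow_enorm_lt_top_of_eLpNorm_lt_top (p := 2) (by norm_num) (by norm_num)
      (Lp.memLp g).2
    simpa using this.ne
  filter_upwards [ae_lt_top (hm.lintegral_kernel) h1] with x hx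
  have : MemLp g 2 (Q x) := by
    refine ⟨(Lp.stronglyMeasurable g).aestronglyMeasurable, ?_⟩
    rw [eLpNorm_eq_lintegral_rpow_enorm_toReal (by norm_num) (by norm_num)]
    exact ENNReal.rpow_lt_top_of_nonneg (by norm_num) (by simpa using hx.ne)
  exact this.integrable (by norm_num)

/-- The transition operator `Q` as a contraction of the Hilbert space `L²(S, π)`
(with complex scalars, where spectral theory lives): `g ↦ ∫ g(y) Q(·, dy)`. -/
def transitionL2 (h : Q.Invariant π) : Lp ℂ 2 π →L[ℂ] Lp ℂ 2 π :=
  LinearMap.mkContinuous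
    { toFun := fun g => (memLp_transition h g).toLp (transition Q g)
      map_add' := fun g g' => by
        rw [← MemLp.toLp_add]
        refine MemLp.toLp_congr _ _ ?_
        filter_upwards [transition_congr h (Lp.coeFn_add g g'), ae_integrable_of_memLp h g,
          ae_integrable_of_memLp h g'] with x hx h1 h2
        rw [hx]
        exact integral_add h1 h2
      map_smul' := fun c g => by
        rw [RingHom.id_apply, ← MemLp.toLp_const_smul]
        refine MemLp.toLp_congr _ _ ?_
        filter_upwards [transition_congr h (Lp.coeFn_smul c g)] with x hx
        rw [hx]
        exact integral_smul c g }
    1 fun g => by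
      rw [one_mul, Lp.norm_def, Lp.norm_def]
      refine ENNReal.toReal_mono (Lp.eLpNorm_ne_top g) ?_
      refine (eLpNorm_congr_ae (MemLp.coeFn_toLp (memLp_transition h g))).trans_le ?_
      exact eLpNorm_transition_le h (Lp.stronglyMeasurable g)

end L2

/-- A square integrable real function as an element of `L²(S, π)`. -/
def toL2 {π : Measure S} (f : S → ℝ) (hf : MemLp f 2 π) : Lp ℂ 2 π :=
  MemLp.toLp (fun x => (f x : ℂ)) hf.ofReal

/-! ### Spectral measures -/

section Spectral

variable {H : Type*} [NormedAddCommGroup H] [InnerProductSpace ℂ H] [CompleteSpace H]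

/-- The positive square root of a positive operator. -/
def opSqrt (T : H →L[ℂ] H) : H →L[ℂ] H := CFC.sqrt T

/-- The positive linear functional `φ ↦ ⟨v, φ(T) v⟩`, with `φ(T)` given by the continuous
functional calculus of the bounded self-adjoint operator `T`. -/
def spectralFunctional (T : H →L[ℂ] H) (v : H) : C_c(ℝ, ℝ) →ₚ[ℝ] ℝ :=
  PositiveLinearMap.mk₀
    { toFun := fun φ => (inner ℂ v (cfc (φ : ℝ → ℝ) T v)).re
      map_add' := fun φ ψ => by
        have : cfc (⇑(φ + ψ)) T = cfc φ T + cfc ψ T :=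
          cfc_add (a := T) φ ψ φ.continuous.continuousOn ψ.continuous.continuousOn
        rw [this, add_apply, inner_add_right, Complex.add_re]
      map_smul' := fun c φ => by
        have : cfc (⇑(c • φ)) T = c • cfc φ T :=
          cfc_smul c φ T φ.continuous.continuousOn
        rw [this]
        simp [inner_smul_right_eq_smul] }
    fun φ hφ => by
      have h0 : 0 ≤ cfc (φ : ℝ → ℝ) T := cfc_nonneg fun x _ => hφ x
      exact ((ContinuousLinearMap.nonneg_iff_isPositive _).1 h0).re_inner_nonneg_right v

/-- The spectral measure `ρ_v` of the vector `v` for the self-adjoint operator `T`: the Borel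
measure on `ℝ`, given by the Riesz representation theorem, with `∫ φ dρ_v = ⟨v, φ(T) v⟩`. -/
def spectralMeasure (T : H →L[ℂ] H) (v : H) : Measure ℝ :=
  RealRMK.rieszMeasure (spectralFunctional T v)

end Spectral

/-! ### The quantities in the theorem -/

/-- the sums `∑_{k=1}^n E_π(f Q^k f)` are bounded. -/
def CovarianceSumsBounded (Q : Kernel S S) (π : Measure S) (f : S → ℝ) : Prop :=
  ∃ C : ℝ, ∀ n : ℕ, |∑ k ∈ Finset.Icc 1 n, ∫ x, f x * transitionPow Q k f x ∂π| ≤ C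

/-- `sup_n E(S_n²)/n < ∞`. -/
def VarianceLinearlyBounded (P : Measure Ω) (ξ : ℤ → Ω → S) (f : S → ℝ) : Prop :=
  ∃ C : ℝ, ∀ n : ℕ, 1 ≤ n → (∫ ω, partialSum f ξ n ω ^ 2 ∂P) / n ≤ C

/-- `E(S_n²)/n` converges to a finite limit `σ²`. -/
def VarianceConverges (P : Measure Ω) (ξ : ℤ → Ω → S) (f : S → ℝ) : Prop :=
  ∃ σ : ℝ, Tendsto (fun n : ℕ => (∫ ω, partialSum f ξ n ω ^ 2 ∂P) / n) atTop (𝓝 (σ ^ 2))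

/-- `∫_{-1}^1 (1 - t)⁻¹ dρ_f(t) < ∞`, the integrand being `∞` at `t = 1`. -/
def SpectralIntegralFinite {Q : Kernel S S} [IsMarkovKernel Q] {π : Measure S}
    (h : Q.Invariant π) (f : S → ℝ) (hf : MemLp f 2 π) : Prop :=
  ∫⁻ t in Set.Icc (-1 : ℝ) 1, (ENNReal.ofReal (1 - t))⁻¹
    ∂(spectralMeasure (transitionL2 h) (toL2 f hf)) < ∞

/-- `f = √(1 - Q) g` for a real square integrable `g` with mean zero. -/
def InRangeSqrt {Q : Kernel S S} [IsMarkovKernel Q] {π : Measure S}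
    (h : Q.Invariant π) (f : S → ℝ) (hf : MemLp f 2 π) : Prop :=
  ∃ (g : S → ℝ) (hg : MemLp g 2 π), ∫ x, g x ∂π = 0 ∧
    opSqrt (1 - transitionL2 h) (toL2 g hg) = toL2 f hf

/-- `E_π sup_{k ≥ 1} |∑_{j=1}^k j^{-1/2} Q^j f|²`, as an extended nonnegative real. -/
def maximalSecondMoment (Q : Kernel S S) (π : Measure S) (f : S → ℝ) : ℝ≥0∞ :=
  ∫⁻ x, ⨆ (k : ℕ) (_ : 1 ≤ k), ENNReal.ofReal
    (|∑ j ∈ Finset.Icc 1 k, (j : ℝ) ^ (-(1 / 2) : ℝ) * transitionPow Q j f x| ^ 2) ∂π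

end ReversibleChain

end

set_option linter.unusedSectionVars false

namespace ReversibleChain

/-! ### Joint laws of the chain -/

section Chain

variable {S Ω : Type*} [MeasurableSpace S] [MeasurableSpace Ω] {Q : Kernel S S}
  [IsMarkovKernel Q] {π : Measure S} {P : Measure Ω} [IsProbabilityMeasure P] {ξ : ℤ → Ω → S}

/-! Reversibility makes `Q` a self-adjoint contraction `T` of `L²(π)`, so everything is read off the
spectral measure `ν` of `f` on `[-1, 1]`. The Markov property gives `E f(ξ_i) f(ξ_{i+k}) = ∫ t^k
dν`, hence `E S_n² = ∫ V_n dν` for an explicit polynomial `V_n` (`varianceKernel`). Here `V_n / n ≥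
-1`, `V_n(1) / n = n`, and for `t < 1` both `|V_n| / n ≤ 6 / (1 - t)` and `V_n / n → (1 + t) / (1 -
t)`. Fatou turns a linear variance bound into `∫ dν / (1 - t) < ∞`. Dominated convergence gives the
converse with the limit, and geometric sums bound the covariance sums. For the range condition, `(1
- T)^{-1/2} f` is an `L²` limit of continuous functions of `T` applied to `f` (`exists_opSqrt_eq`).
Conversely, if `f = √(1 - T) g`, then `⟨f, T^k f⟩` telescopes.

For the maximal function, `T^{2j} f` and `T^{2j+1} f` are given the same weight, leaving sums `s_m`
of `b_j T^{2j} (f + T f)` plus errors of bounded variation in `L²`. The even powers have nonnegative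
spectrum, and the factor `1 + t` removes the singularity at `t = -1`, so only `∫ dν / (1 - t)` is
needed. With `A_i` the average of the first `2^i` powers of `T²` and `N = 2^M`, write `s_{2^i} = D_i
+ (s_N - A_i s_N)`. The scalar estimate `one_sub_mul_sq_difference_le` makes `∑ ‖D_i‖²` bounded
independently of `M`, while `sup_i |A_i s_N|` is controlled by the `L²` maximal inequality
`SymmetricKernel.lintegral_sq_dyadicMax_le`. Cauchy–Schwarz handles indices between powers of two.

That maximal inequality is proved by a `T T*` argument: after linearizing the maximum, `A_i A_k ≤ 2
A_{i+1}` for `k ≤ i` bounds the square of the maximal operator by the operator itself, and a crude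
finite constant improves itself down to `42`. -/

theorem IsStationaryReversibleMarkovChain.isProbabilityMeasure
    (h : IsStationaryReversibleMarkovChain Q π P ξ) : IsProbabilityMeasure π := by
  rw [← h.law 0]; exact Measure.isProbabilityMeasure_map (h.measurable 0).aemeasurable

/-- The joint law of a pair of values in the past and the next value of the chain. -/
theorem IsStationaryReversibleMarkovChain.map_triple
    (h : IsStationaryReversibleMarkovChain Q π P ξ) {i m : ℤ} (him : i ≤ m) :
    P.map (fun ω => ((ξ i ω, ξ m ω), ξ (m + 1) ω)) =
      (P.map fun ω => (ξ i ω, ξ m ω)) ⊗ₘ (Q.comap Prod.snd measurable_snd) := by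
  have hpair : Measurable fun ω => (ξ i ω, ξ m ω) := (h.measurable i).prodMk (h.measurable m)
  have htriple : Measurable fun ω => ((ξ i ω, ξ m ω), ξ (m + 1) ω) :=
    hpair.prodMk (h.measurable _)
  have : IsProbabilityMeasure (P.map fun ω => (ξ i ω, ξ m ω)) :=
    Measure.isProbabilityMeasure_map hpair.aemeasurable
  have : IsProbabilityMeasure (P.map fun ω => ((ξ i ω, ξ m ω), ξ (m + 1) ω)) :=
    Measure.isProbabilityMeasure_map htriple.aemeasurable
  refine Measure.ext_prod fun {B A} hB hA => ?_
  rw [Measure.compProd_apply_prod hB hA, Measure.map_apply htriple (hB.prod hA),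
    setLIntegral_map hB ((Q.comap Prod.snd measurable_snd).measurable_coe hA) hpair]
  have hm : (⨆ j : Set.Iic m, MeasurableSpace.comap (ξ j) inferInstance) ≤
      (inferInstance : MeasurableSpace Ω) := iSup_le fun j => (h.measurable j).comap_le
  have hF : ∀ j : ℤ, j ≤ m → MeasurableSpace.comap (ξ j) inferInstance ≤
      ⨆ j : Set.Iic m, MeasurableSpace.comap (ξ j) inferInstance := fun j hj =>
    le_iSup (fun j : Set.Iic m => MeasurableSpace.comap (ξ j) inferInstance) ⟨j, hj⟩
  have hBF : MeasurableSet[⨆ j : Set.Iic m, MeasurableSpace.comap (ξ j) inferInstance]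
      ((fun ω => (ξ i ω, ξ m ω)) ⁻¹' B) := by
    refine sup_le (hF i him) (hF m le_rfl) _ ?_
    rw [← MeasurableSpace.comap_prodMk]
    exact ⟨B, hB, rfl⟩
  have hAm := (h.measurable (m + 1)) hA
  have h1 := setIntegral_condExp hm
    ((integrable_const (1 : ℝ)).indicator hAm : Integrable _ P) hBF
  rw [setIntegral_congr_ae (hm _ hBF) ((h.markov m A hA).mono fun ω hω _ => hω),
    integral_indicator_const _ hAm, smul_eq_mul, mul_one] at h1
  simp only [Measure.real] at h1
  rw [integral_toReal (f := fun ω => Q (ξ m ω) A)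
    ((Q.measurable_coe hA).comp (h.measurable m)).aemeasurable
    (ae_of_all _ fun x => measure_lt_top _ _)] at h1
  rw [ENNReal.toReal_eq_toReal_iff' _ (measure_ne_top _ _), Measure.restrict_apply hAm] at h1
  · simp only [Kernel.comap_apply]
    rw [h1]
    congr 1
    ext ω
    simp [and_comm]
  · refine ((lintegral_mono fun x => prob_le_one).trans_lt ?_).ne
    simp

theorem IsStationaryReversibleMarkovChain.map_pair
    (h : IsStationaryReversibleMarkovChain Q π P ξ) (i : ℤ) :
    P.map (fun ω => (ξ i ω, ξ (i + 1) ω)) = π ⊗ₘ Q := by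
  have := h.isProbabilityMeasure
  have hi := h.measurable i
  have hi' := h.measurable (i + 1)
  have h1 := h.map_triple (le_refl i)
  have : IsProbabilityMeasure (P.map fun ω => (ξ i ω, ξ (i + 1) ω)) :=
    Measure.isProbabilityMeasure_map (hi.prodMk hi').aemeasurable
  refine Measure.ext_prod fun {B A} hB hA => ?_
  -- With `i = m` the past is the duplicated pair `(ξ_i, ξ_i)`; a set of the form `Prod.snd ⁻¹' B`
  -- sees only one copy.
  have h2 := DFunLike.congr_fun h1 ((Prod.snd ⁻¹' B) ×ˢ A)
  rw [Measure.compProd_apply_prod (measurable_snd hB) hA, Measure.map_apply (by fun_prop)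
    ((measurable_snd hB).prod hA), setLIntegral_map (measurable_snd hB)
    ((Q.comap Prod.snd measurable_snd).measurable_coe hA) (by fun_prop)] at h2
  rw [Measure.compProd_apply_prod hB hA, Measure.map_apply (by fun_prop) (hB.prod hA),
    ← h.law i, setLIntegral_map hB (Q.measurable_coe hA) hi]
  exact h2

/-- Detailed balance. -/
theorem IsStationaryReversibleMarkovChain.map_swap_compProd
    (h : IsStationaryReversibleMarkovChain Q π P ξ) :
    (π ⊗ₘ Q).map Prod.swap = π ⊗ₘ Q := by
  have hi := h.measurable 0
  have hi' := h.measurable (0 + 1)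
  rw [← h.map_pair 0, Measure.map_map measurable_swap (by fun_prop), h.reversible 0]
  rfl

end Chain

/-! ### The transition operator for a reversible kernel -/

section Operator

variable {S : Type*} [MeasurableSpace S] {Q : Kernel S S} [IsMarkovKernel Q] {π : Measure S}

theorem transition_ofReal (g : S → ℝ) :
    transition Q (fun x => (g x : ℂ)) = fun x => ((transition Q g x : ℝ) : ℂ) := by
  ext x
  exact integral_ofReal

theorem toL2_transition_aux (h : Q.Invariant π) {g : S → ℝ} (hg : MemLp g 2 π) :
    (transitionL2 h (toL2 g hg) : S → ℂ) =ᵐ[π] fun x => ((transition Q g x : ℝ) : ℂ) := by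
  have h1 : (transitionL2 h (toL2 g hg) : S → ℂ) =ᵐ[π] transition Q (toL2 g hg : S → ℂ) :=
    MemLp.coeFn_toLp (memLp_transition h _)
  refine h1.trans ((transition_congr h (MemLp.coeFn_toLp hg.ofReal)).trans ?_)
  exact Eventually.of_forall fun x => congrFun (transition_ofReal g) x

theorem memLp_transition_real (h : Q.Invariant π) {g : S → ℝ} (hg : MemLp g 2 π) :
    MemLp (transition Q g) 2 π := by
  have h1 := (memLp_congr_ae (toL2_transition_aux h hg)).1 (Lp.memLp _)
  simpa using h1.re

theorem toL2_transition (h : Q.Invariant π) {g : S → ℝ} (hg : MemLp g 2 π) :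
    toL2 (transition Q g) (memLp_transition_real h hg) = transitionL2 h (toL2 g hg) :=
  Lp.ext ((MemLp.coeFn_toLp _).trans (toL2_transition_aux h hg).symm)

theorem memLp_transitionPow (h : Q.Invariant π) (k : ℕ) {g : S → ℝ} (hg : MemLp g 2 π) :
    MemLp (transitionPow Q k g) 2 π := by
  induction k generalizing g with
  | zero => exact hg
  | succ k ih => exact ih (memLp_transition_real h hg)

theorem toL2_transitionPow (h : Q.Invariant π) (k : ℕ) {g : S → ℝ} (hg : MemLp g 2 π) :
    toL2 (transitionPow Q k g) (memLp_transitionPow h k hg) = (transitionL2 h ^ k) (toL2 g hg) := by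
  induction k generalizing g with
  | zero => rfl
  | succ k ih =>
    rw [pow_succ, mul_apply_eq_comp, ← toL2_transition h hg]
    exact ih (memLp_transition_real h hg)

theorem coeFn_toL2 {g : S → ℝ} (hg : MemLp g 2 π) :
    (toL2 g hg : S → ℂ) =ᵐ[π] fun x => (g x : ℂ) :=
  MemLp.coeFn_toLp _

theorem inner_toL2 {g g' : S → ℝ} (hg : MemLp g 2 π) (hg' : MemLp g' 2 π) :
    inner ℂ (toL2 g hg) (toL2 g' hg') = ((∫ x, g x * g' x ∂π : ℝ) : ℂ) := by
  rw [L2.inner_def]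
  refine Eq.trans (integral_congr_ae ?_) integral_ofReal
  filter_upwards [coeFn_toL2 hg, coeFn_toL2 hg'] with x h1 h2
  rw [h1, h2]
  simp [mul_comm]

/-- Detailed balance without integrability: both sides are integrals over `π ⊗ₘ Q`, exchanged by the
swap. The maximal inequality uses this form. -/
theorem lintegral_mul_lintegral_comm [SFinite π] (hrev : (π ⊗ₘ Q).map Prod.swap = π ⊗ₘ Q)
    {u v : S → ℝ≥0∞} (hu : Measurable u) (hv : Measurable v) :
    ∫⁻ x, u x * ∫⁻ y, v y ∂(Q x) ∂π = ∫⁻ x, (∫⁻ y, u y ∂(Q x)) * v x ∂π := by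
  have key : ∀ {u v : S → ℝ≥0∞}, Measurable u → Measurable v →
      ∫⁻ x, u x * ∫⁻ y, v y ∂(Q x) ∂π = ∫⁻ p, u p.1 * v p.2 ∂(π ⊗ₘ Q) := by
    intro u v hu hv
    rw [Measure.lintegral_compProd (by fun_prop)]
    exact lintegral_congr fun x => (lintegral_const_mul _ hv).symm
  rw [key hu hv, ← hrev, lintegral_map (by fun_prop) measurable_swap]
  simp only [Prod.fst_swap, Prod.snd_swap, mul_comm (u _)]
  rw [← key hv hu]
  simp only [mul_comm]

/-- Both marginals of `π ⊗ₘ Q` are `π`, so `⟨u, T v⟩` is an absolutely convergent integral of `conj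
(u x) * v y` over the joint law; swap invariance gives symmetry. -/
theorem isSelfAdjoint_transitionL2 [IsFiniteMeasure π] (h : Q.Invariant π)
    (hrev : (π ⊗ₘ Q).map Prod.swap = π ⊗ₘ Q) : IsSelfAdjoint (transitionL2 h) := by
  rw [ContinuousLinearMap.isSelfAdjoint_iff_isSymmetric]
  have hsnd : (π ⊗ₘ Q).map Prod.snd = π := by
    rw [← Measure.snd, Measure.snd_compProd, h.def]
  have hfst : (π ⊗ₘ Q).map Prod.fst = π := by
    rw [← Measure.fst, Measure.fst_compProd]
  have key : ∀ u v : Lp ℂ 2 π, inner ℂ u (transitionL2 h v) =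
      ∫ p, inner ℂ (u p.1) (v p.2) ∂(π ⊗ₘ Q) := by
    intro u v
    have hu : MemLp (fun p : S × S => u p.1) 2 (π ⊗ₘ Q) :=
      MemLp.comp_of_map (f := Prod.fst) (by rw [hfst]; exact Lp.memLp u) measurable_fst.aemeasurable
    have hv : MemLp (fun p : S × S => v p.2) 2 (π ⊗ₘ Q) :=
      MemLp.comp_of_map (f := Prod.snd) (by rw [hsnd]; exact Lp.memLp v) measurable_snd.aemeasurable
    have hint : Integrable (fun p : S × S => inner ℂ (u p.1) (v p.2)) (π ⊗ₘ Q) :=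
      hv.integrable_mul hu.star
    rw [Measure.integral_compProd hint, L2.inner_def]
    refine integral_congr_ae ?_
    filter_upwards [MemLp.coeFn_toLp (memLp_transition h v), ae_integrable_of_memLp h v]
      with x hx hi
    have hx' : (transitionL2 h v : S → ℂ) x = transition Q v x := hx
    rw [hx', integral_inner hi]
    rfl
  intro u v
  rw [ContinuousLinearMap.coe_coe, key u v, ← inner_conj_symm, key v u, ← integral_conj]
  conv_lhs => rw [← hrev]
  rw [integral_map measurable_swap.aemeasurable]
  · simp [mul_comm]
  · rw [hrev]
    have h1 : AEStronglyMeasurable (fun p : S × S => v p.1) (π ⊗ₘ Q) :=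
      ((Lp.stronglyMeasurable v).comp_measurable measurable_fst).aestronglyMeasurable
    have h2 : AEStronglyMeasurable (fun p : S × S => u p.2) (π ⊗ₘ Q) :=
      ((Lp.stronglyMeasurable u).comp_measurable measurable_snd).aestronglyMeasurable
    exact RCLike.continuous_conj.comp_aestronglyMeasurable (h1.inner h2)

theorem norm_transitionL2_le (h : Q.Invariant π) : ‖transitionL2 h‖ ≤ 1 :=
  LinearMap.mkContinuous_norm_le _ zero_le_one _

end Operator

/-! ### Covariances along the chain -/

section Covariance

variable {S Ω : Type*} [MeasurableSpace S] [MeasurableSpace Ω] {Q : Kernel S S}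
  [IsMarkovKernel Q] {π : Measure S} {P : Measure Ω} [IsProbabilityMeasure P] {ξ : ℤ → Ω → S}

theorem IsStationaryReversibleMarkovChain.memLp_comp
    (h : IsStationaryReversibleMarkovChain Q π P ξ) {g : S → ℝ} (hg : MemLp g 2 π) (i : ℤ) :
    MemLp (fun ω => g (ξ i ω)) 2 P :=
  MemLp.comp_of_map (f := ξ i) (by rw [h.law i]; exact hg) (h.measurable i).aemeasurable

/-- Conditioning `ξ_{m+1}` on the past replaces `g` by `Qg` one time step earlier. The value at time
`i` is kept, which is why the triple law is needed. -/
theorem IsStationaryReversibleMarkovChain.integral_mul_succ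
    (h : IsStationaryReversibleMarkovChain Q π P ξ) {f g : S → ℝ} (hf : MemLp f 2 π)
    (hg : MemLp g 2 π) {i m : ℤ} (him : i ≤ m) :
    ∫ ω, f (ξ i ω) * g (ξ (m + 1) ω) ∂P = ∫ ω, f (ξ i ω) * transition Q g (ξ m ω) ∂P := by
  have hi := h.measurable i
  have hm := h.measurable m
  have hm' := h.measurable (m + 1)
  have hpair : Measurable fun ω => (ξ i ω, ξ m ω) := by fun_prop
  have htr : Measurable fun ω => ((ξ i ω, ξ m ω), ξ (m + 1) ω) := by fun_prop
  have : IsProbabilityMeasure (P.map fun ω => (ξ i ω, ξ m ω)) :=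
    Measure.isProbabilityMeasure_map hpair.aemeasurable
  set ν := P.map fun ω => ((ξ i ω, ξ m ω), ξ (m + 1) ω)
  have hf1 : MemLp (fun p : (S × S) × S => f p.1.1) 2 ν := by
    refine MemLp.comp_of_map (f := fun p : (S × S) × S => p.1.1) (g := f) ?_ (by fun_prop)
    rw [Measure.map_map (by fun_prop) htr]
    exact (h.law i).symm ▸ hf
  have hg1 : MemLp (fun p : (S × S) × S => g p.2) 2 ν := by
    refine MemLp.comp_of_map (f := fun p : (S × S) × S => p.2) (g := g) ?_ (by fun_prop)
    rw [Measure.map_map (by fun_prop) htr]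
    exact (h.law (m + 1)).symm ▸ hg
  have hint : Integrable (fun p : (S × S) × S => f p.1.1 * g p.2) ν := hf1.integrable_mul hg1
  have hfm : MemLp (fun p : S × S => f p.1) 2 (P.map fun ω => (ξ i ω, ξ m ω)) := by
    refine MemLp.comp_of_map (f := Prod.fst) (g := f) ?_ (by fun_prop)
    rw [Measure.map_map (by fun_prop) hpair]
    exact (h.law i).symm ▸ hf
  have hgm : MemLp (fun p : S × S => transition Q g p.2) 2 (P.map fun ω => (ξ i ω, ξ m ω)) := by
    refine MemLp.comp_of_map (f := Prod.snd) (g := transition Q g) ?_ (by fun_prop)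
    rw [Measure.map_map (by fun_prop) hpair]
    exact (h.law m).symm ▸ memLp_transition_real h.invariant hg
  calc ∫ ω, f (ξ i ω) * g (ξ (m + 1) ω) ∂P = ∫ p, f p.1.1 * g p.2 ∂ν :=
        (integral_map htr.aemeasurable hint.aestronglyMeasurable).symm
    _ = ∫ p, f p.1 * transition Q g p.2 ∂(P.map fun ω => (ξ i ω, ξ m ω)) := by
        simp only [ν, h.map_triple him] at hint ⊢
        rw [Measure.integral_compProd hint]
        refine integral_congr_ae (Eventually.of_forall fun p => ?_)
        simp only [Kernel.comap_apply]
        exact integral_const_mul _ _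
    _ = _ := integral_map hpair.aemeasurable (hfm.integrable_mul hgm).aestronglyMeasurable

theorem IsStationaryReversibleMarkovChain.integral_mul_add
    (h : IsStationaryReversibleMarkovChain Q π P ξ) {f g : S → ℝ} (hf : MemLp f 2 π)
    (hg : MemLp g 2 π) (i : ℤ) (k : ℕ) :
    ∫ ω, f (ξ i ω) * g (ξ (i + k) ω) ∂P = ∫ x, f x * transitionPow Q k g x ∂π := by
  induction k generalizing g with
  | zero =>
    rw [← h.law i] at hf hg ⊢
    simp only [Nat.cast_zero, add_zero]
    exact (integral_map (h.measurable i).aemeasurable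
      (hf.integrable_mul hg).aestronglyMeasurable).symm
  | succ k ih =>
    have h1 := h.integral_mul_succ hf hg (show i ≤ i + (k : ℤ) by omega)
    rw [show i + ((k + 1 : ℕ) : ℤ) = i + k + 1 by push_cast; ring, h1,
      ih (memLp_transition_real h.invariant hg)]
    rfl

end Covariance

/-! ### Spectral measures of self-adjoint contractions -/

section Spectral

variable {H : Type*} [NormedAddCommGroup H] [InnerProductSpace ℂ H] [CompleteSpace H]
  {T : H →L[ℂ] H}

theorem spectrum_subset_Icc (hT : ‖T‖ ≤ 1) : spectrum ℝ T ⊆ Set.Icc (-1) 1 := by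
  intro t ht
  have h1 : (algebraMap ℝ ℂ t) ∈ spectrum ℂ T := spectrum.algebraMap_mem ℂ ht
  have h2 := (spectrum.subset_closedBall_norm_mul (𝕜 := ℂ) T h1)
  -- Only an inequality is available, since the norm is `0` when `H` is trivial.
  have h3 : ‖(1 : H →L[ℂ] H)‖ ≤ 1 := ContinuousLinearMap.norm_id_le
  rw [mem_closedBall_zero_iff] at h2
  have h4 : |t| ≤ 1 := by
    have : ‖algebraMap ℝ ℂ t‖ = |t| := by simp
    rw [← this]
    nlinarith [norm_nonneg T, norm_nonneg (1 : H →L[ℂ] H)]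
  exact abs_le.1 h4

/-- A continuous cutoff, `1` on `[-1, 1]` and decreasing at rate `c` outside of it. -/
noncomputable def cutoff (c t : ℝ) : ℝ := max 0 (1 - c * max 0 (|t| - 1))

theorem continuous_cutoff (c : ℝ) : Continuous (cutoff c) := by
  unfold cutoff; fun_prop

theorem cutoff_nonneg (c t : ℝ) : 0 ≤ cutoff c t := le_max_left _ _

theorem cutoff_eq_one (c : ℝ) {t : ℝ} (ht : t ∈ Set.Icc (-1 : ℝ) 1) : cutoff c t = 1 := by
  have : |t| ≤ 1 := abs_le.2 ht
  simp [cutoff, this]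

theorem cutoff_eq_zero {c t : ℝ} (h : 1 ≤ c * (|t| - 1)) (hc : 0 ≤ c) : cutoff c t = 0 := by
  refine max_eq_left ?_
  nlinarith [le_max_right 0 (|t| - 1)]

theorem cutoff_anti {c c' : ℝ} (h : c ≤ c') (t : ℝ) : cutoff c' t ≤ cutoff c t := by
  unfold cutoff
  have := le_max_left 0 (|t| - 1)
  gcongr

theorem hasCompactSupport_cutoff {c : ℝ} (hc : 1 ≤ c) : HasCompactSupport (cutoff c) := by
  refine HasCompactSupport.intro (isCompact_Icc (a := (-2 : ℝ)) (b := 2)) fun t ht => ?_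
  refine cutoff_eq_zero ?_ (by linarith)
  have : 2 < |t| := by
    by_contra! h
    exact ht (abs_le.1 h)
  nlinarith

/-- The Riesz theorem speaks only of compactly supported functions. Multiplying by a cutoff equal to
`1` on the spectrum does not change `φ(T)`, while the cutoffs decrease to the indicator of `[-1,
1]`. No statement about the support of the spectral measure is needed. -/
theorem setIntegral_spectralMeasure (hT : ‖T‖ ≤ 1) (v : H) {φ : ℝ → ℝ}
    (hφ : Continuous φ) :
    ∫ t in Set.Icc (-1 : ℝ) 1, φ t ∂(spectralMeasure T v) = (inner ℂ v (cfc φ T v)).re := by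
  have hreg : (spectralMeasure T v).Regular := RealRMK.regular_rieszMeasure _
  have hcs : ∀ n : ℕ, HasCompactSupport fun t => φ t * cutoff (n + 1) t := fun n =>
    (hasCompactSupport_cutoff (by linarith [n.cast_nonneg (α := ℝ)])).mul_left
  have hct : ∀ n : ℕ, Continuous fun t => φ t * cutoff (n + 1) t := fun n =>
    hφ.mul (continuous_cutoff _)
  have hval : ∀ n : ℕ, ∫ t, φ t * cutoff (n + 1) t ∂(spectralMeasure T v) =
      (inner ℂ v (cfc φ T v)).re := by
    intro n
    have h1 := RealRMK.integral_rieszMeasure (spectralFunctional T v) ⟨⟨_, hct n⟩, hcs n⟩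
    have h2 : cfc (fun t => φ t * cutoff (n + 1) t) T = cfc φ T :=
      cfc_congr fun t ht => by
        simp [cutoff_eq_one _ (spectrum_subset_Icc hT ht)]
    rw [← h2]
    exact h1
  have hlim : Tendsto (fun n : ℕ => ∫ t, φ t * cutoff (n + 1) t ∂(spectralMeasure T v)) atTop
      (𝓝 (∫ t, (Set.Icc (-1 : ℝ) 1).indicator φ t ∂(spectralMeasure T v))) := by
    refine tendsto_integral_of_dominated_convergence (fun t => ‖φ t * cutoff ((0 : ℕ) + 1) t‖)
      (fun n => (hct n).aestronglyMeasurable)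
      ((hct 0).integrable_of_hasCompactSupport (hcs 0)).norm
      (fun n => Eventually.of_forall fun t => ?_) (Eventually.of_forall fun t => ?_)
    · rw [norm_mul, norm_mul]
      refine mul_le_mul_of_nonneg_left ?_ (norm_nonneg _)
      rw [Real.norm_of_nonneg (cutoff_nonneg _ _), Real.norm_of_nonneg (cutoff_nonneg _ _)]
      exact cutoff_anti (by simp) t
    · by_cases ht : t ∈ Set.Icc (-1 : ℝ) 1
      · simp [ht, cutoff_eq_one _ ht]
      · rw [Set.indicator_of_notMem ht]
        have h1 : 0 < |t| - 1 := by
          by_contra! h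
          exact ht (abs_le.1 (by linarith))
        -- From this index on the cutoff vanishes at `t`.
        obtain ⟨N, hN⟩ := exists_nat_gt (1 / (|t| - 1))
        refine tendsto_const_nhds.congr' ?_
        filter_upwards [eventually_ge_atTop N] with n hn
        rw [cutoff_eq_zero, mul_zero]
        · rw [div_lt_iff₀ h1] at hN
          have : (N : ℝ) ≤ n := by exact_mod_cast hn
          nlinarith
        · positivity
  simp only [hval] at hlim
  rw [← integral_indicator measurableSet_Icc]
  exact tendsto_nhds_unique hlim tendsto_const_nhds

/-- For real `φ` the operator `φ(T)` is self-adjoint, so `⟨v, φ(T)² v⟩ = ‖φ(T) v‖²`. Norms thereby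
become scalar integrals. -/
theorem setIntegral_sq_spectralMeasure (hT : ‖T‖ ≤ 1) (v : H)
    {φ : ℝ → ℝ} (hφ : Continuous φ) :
    ∫ t in Set.Icc (-1 : ℝ) 1, φ t ^ 2 ∂(spectralMeasure T v) = ‖cfc φ T v‖ ^ 2 := by
  rw [setIntegral_spectralMeasure (φ := fun t => φ t ^ 2) hT v (hφ.pow 2)]
  have h1 : cfc (fun t => φ t ^ 2) T = cfc φ T * cfc φ T := by
    rw [← cfc_mul φ φ T hφ.continuousOn hφ.continuousOn]
    simp only [sq]
  have h2 : IsSelfAdjoint (cfc φ T) := cfc_predicate φ T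
  have h3 := (ContinuousLinearMap.isSelfAdjoint_iff_isSymmetric.1 h2) v (cfc φ T v)
  rw [h1, mul_apply_eq_comp]
  simp only [ContinuousLinearMap.coe_coe] at h3
  rw [← h3, inner_self_eq_norm_sq_to_K]
  norm_cast

instance isFiniteMeasure_restrict_spectralMeasure (v : H) :
    IsFiniteMeasure ((spectralMeasure T v).restrict (Set.Icc (-1 : ℝ) 1)) := by
  have hreg : (spectralMeasure T v).Regular := RealRMK.regular_rieszMeasure _
  exact ⟨by simpa using isCompact_Icc.measure_lt_top⟩

theorem integrableOn_spectralMeasure (v : H) {φ : ℝ → ℝ} (hφ : Continuous φ) :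
    IntegrableOn φ (Set.Icc (-1 : ℝ) 1) (spectralMeasure T v) := by
  have hreg : (spectralMeasure T v).Regular := RealRMK.regular_rieszMeasure _
  exact hφ.continuousOn.integrableOn_compact isCompact_Icc

end Spectral

/-! ### Integrals of geometric sums against a measure on `[-1, 1]` -/

section Kernels

theorem abs_one_sub_pow_le {t : ℝ} (ht : t ∈ Set.Icc (-1 : ℝ) 1) (n : ℕ) : |1 - t ^ n| ≤ 2 := by
  have h1 : |t ^ n| ≤ 1 := by
    rw [abs_pow]
    exact pow_le_one₀ (abs_nonneg _) (abs_le.2 ht)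
  rw [abs_le] at h1 ⊢
  constructor <;> linarith [h1.1, h1.2]

theorem one_sub_mul_geom_sum (t : ℝ) (n : ℕ) :
    (1 - t) * ∑ k ∈ Finset.range n, t ^ k = 1 - t ^ n := by
  rw [mul_comm]; exact geom_sum_mul_neg t n

theorem abs_geom_sum_le {t : ℝ} (ht : t ∈ Set.Icc (-1 : ℝ) 1) (ht1 : t < 1) (n : ℕ) :
    |∑ k ∈ Finset.range n, t ^ k| ≤ 2 / (1 - t) := by
  have h : 0 < 1 - t := by linarith
  have h1 := abs_one_sub_pow_le ht n
  rw [← one_sub_mul_geom_sum, abs_mul, abs_of_pos h] at h1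
  rwa [le_div_iff₀ h, mul_comm]

theorem geom_sum_nonneg_of_mem {t : ℝ} (ht : t ∈ Set.Icc (-1 : ℝ) 1) (n : ℕ) :
    0 ≤ ∑ k ∈ Finset.range n, t ^ k := by
  rcases ht.2.eq_or_lt with rfl | h1
  · simp
  · have h : 0 < 1 - t := by linarith
    refine nonneg_of_mul_nonneg_right (?_ : 0 ≤ (1 - t) * _) h
    rw [one_sub_mul_geom_sum]
    have h1 : |t ^ n| ≤ 1 := by
      rw [abs_pow]
      exact pow_le_one₀ (abs_nonneg _) (abs_le.2 ht)
    linarith [(abs_le.1 h1).2]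

/-- The polynomial whose integral against the spectral measure is `E(S_n²)`. -/
noncomputable def varianceKernel (n : ℕ) (t : ℝ) : ℝ :=
  ∑ m ∈ Finset.range n, (2 * ∑ k ∈ Finset.range (m + 1), t ^ k - 1)

theorem continuous_varianceKernel (n : ℕ) : Continuous (varianceKernel n) := by
  unfold varianceKernel; fun_prop

theorem one_sub_mul_varianceKernel (n : ℕ) (t : ℝ) :
    (1 - t) * varianceKernel n t = n * (1 + t) - 2 * (t * ∑ k ∈ Finset.range n, t ^ k) := by
  have h : ∀ m : ℕ, (1 - t) * (2 * ∑ k ∈ Finset.range (m + 1), t ^ k - 1) =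
      (1 + t) - 2 * (t * t ^ m) := by
    intro m
    linear_combination 2 * one_sub_mul_geom_sum t (m + 1)
  rw [varianceKernel, Finset.mul_sum]
  simp only [h, Finset.sum_sub_distrib, ← Finset.mul_sum]
  simp
  ring

/-- Each summand is at least `-1` because geometric sums are nonnegative on `[-1, 1]`; this lower
bound is what Fatou's lemma requires. -/
theorem neg_le_varianceKernel {t : ℝ} (ht : t ∈ Set.Icc (-1 : ℝ) 1) (n : ℕ) :
    -(n : ℝ) ≤ varianceKernel n t := by
  have h : ∑ m ∈ Finset.range n, (-1 : ℝ) ≤ varianceKernel n t :=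
    Finset.sum_le_sum fun m _ => by linarith [geom_sum_nonneg_of_mem ht (m + 1)]
  simpa using h

theorem abs_varianceKernel_le {t : ℝ} (ht : t ∈ Set.Icc (-1 : ℝ) 1) (ht1 : t < 1) (n : ℕ) :
    |varianceKernel n t| ≤ n * (6 * (1 / (1 - t))) := by
  have h : 0 < 1 - t := by linarith
  -- Twice the geometric sum costs `4 / (1 - t)`, and the `-1` in each summand costs another `2 / (1
  -- - t)`; this is the `6`.
  have h2 : 1 ≤ 2 * (1 / (1 - t)) := by
    rw [mul_one_div, le_div_iff₀ h]; linarith [ht.1]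
  calc |varianceKernel n t| ≤ ∑ m ∈ Finset.range n, 6 * (1 / (1 - t)) := by
        refine (Finset.abs_sum_le_sum_abs _ _).trans (Finset.sum_le_sum fun m _ => ?_)
        have h1 := abs_geom_sum_le ht ht1 (m + 1)
        have h3 : (2 : ℝ) / (1 - t) = 2 * (1 / (1 - t)) := by ring
        rw [h3] at h1
        rw [abs_le] at h1 ⊢
        constructor <;> linarith [h1.1, h1.2]
    _ = _ := by simp

theorem tendsto_varianceKernel_div {t : ℝ} (ht : t ∈ Set.Icc (-1 : ℝ) 1) (ht1 : t < 1) :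
    Tendsto (fun n : ℕ => varianceKernel n t / n) atTop (𝓝 ((1 + t) / (1 - t))) := by
  have h : 0 < 1 - t := by linarith
  have h1 : Tendsto (fun n : ℕ => 2 * t / (1 - t) * ((∑ k ∈ Finset.range n, t ^ k) / n)) atTop
      (𝓝 (2 * t / (1 - t) * 0)) := by
    refine Tendsto.const_mul _ (squeeze_zero_norm (a := fun n : ℕ => 2 / (1 - t) / n)
      (fun n => ?_) (tendsto_const_nhds.div_atTop tendsto_natCast_atTop_atTop))
    rw [norm_div, Real.norm_natCast]
    exact div_le_div_of_nonneg_right (abs_geom_sum_le ht ht1 n) n.cast_nonneg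
  have h2 := h1.const_sub ((1 + t) / (1 - t))
  rw [mul_zero, sub_zero] at h2
  refine h2.congr' ?_
  filter_upwards [eventually_ge_atTop 1] with n hn
  have hn0 : (n : ℝ) ≠ 0 := by positivity
  have h3 := one_sub_mul_varianceKernel n t
  have h4 : varianceKernel n t =
      (n * (1 + t) - 2 * (t * ∑ k ∈ Finset.range n, t ^ k)) / (1 - t) := by
    rw [eq_div_iff h.ne', mul_comm, h3]
  rw [h4]
  field_simp

/-- An atom at `1` would contribute quadratic growth, which a linear variance bound excludes. -/
theorem varianceKernel_one (n : ℕ) : varianceKernel n 1 = (n : ℝ) ^ 2 := by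
  induction n with
  | zero => simp [varianceKernel]
  | succ n ih =>
    rw [varianceKernel, Finset.sum_range_succ, ← varianceKernel, ih]
    simp
    ring

variable {ν : Measure ℝ} [IsFiniteMeasure ν]

theorem integrable_of_continuous (hν : ∀ᵐ t ∂ν, t ∈ Set.Icc (-1 : ℝ) 1) {φ : ℝ → ℝ}
    (hφ : Continuous φ) : Integrable φ ν := by
  rw [← Measure.restrict_eq_self_of_ae_mem hν]
  exact hφ.continuousOn.integrableOn_compact isCompact_Icc

theorem ae_lt_one (hI : ∫⁻ t, (ENNReal.ofReal (1 - t))⁻¹ ∂ν < ∞) : ∀ᵐ t ∂ν, t < 1 := by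
  have hm : Measurable fun t : ℝ => (ENNReal.ofReal (1 - t))⁻¹ := by fun_prop
  filter_upwards [ae_lt_top hm hI.ne] with t ht
  by_contra! h
  simp [ENNReal.ofReal_of_nonpos (show 1 - t ≤ 0 by linarith)] at ht

theorem integrable_inv_one_sub (hI : ∫⁻ t, (ENNReal.ofReal (1 - t))⁻¹ ∂ν < ∞) :
    Integrable (fun t : ℝ => 1 / (1 - t)) ν := by
  refine ⟨(by fun_prop : Measurable fun t : ℝ => 1 / (1 - t)).aestronglyMeasurable, ?_⟩
  rw [HasFiniteIntegral]
  refine lt_of_eq_of_lt (lintegral_congr_ae ?_) hI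
  filter_upwards [ae_lt_one hI] with t ht
  have h : 0 < 1 - t := by linarith
  rw [Real.enorm_of_nonneg (by positivity), one_div, ENNReal.ofReal_inv_of_pos h]

/-- Fatou's lemma for `V_n / n + 1 ≥ 0`, whose limit is `2 / (1 - t)` for `t < 1` and `∞` at `t =
1`. The index is shifted by one to avoid dividing by zero. -/
theorem lintegral_inv_one_sub_lt_top (hν : ∀ᵐ t ∂ν, t ∈ Set.Icc (-1 : ℝ) 1) {C : ℝ}
    (hC : ∀ n : ℕ, 1 ≤ n → (∫ t, varianceKernel n t ∂ν) / n ≤ C) :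
    ∫⁻ t, (ENNReal.ofReal (1 - t))⁻¹ ∂ν < ∞ := by
  set F : ℕ → ℝ → ℝ := fun n t => varianceKernel (n + 1) t / ((n + 1 : ℕ) : ℝ) + 1
  have hFc : ∀ n, Continuous (F n) := fun n =>
    ((continuous_varianceKernel _).div_const _).add_const _
  have hF0 : ∀ n t, t ∈ Set.Icc (-1 : ℝ) 1 → 0 ≤ F n t := by
    intro n t ht
    have h1 := neg_le_varianceKernel ht (n + 1)
    have h2 : (0 : ℝ) < ((n + 1 : ℕ) : ℝ) := by positivity
    have h3 : -1 ≤ varianceKernel (n + 1) t / ((n + 1 : ℕ) : ℝ) := by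
      rw [le_div_iff₀ h2]; linarith
    simp only [F]
    linarith
  have hlow : ∀ᵐ t ∂ν, (ENNReal.ofReal (1 - t))⁻¹ ≤
      liminf (fun n => ENNReal.ofReal (F n t)) atTop := by
    filter_upwards [hν] with t ht
    rcases ht.2.eq_or_lt with rfl | ht1
    · have h1 : Tendsto (fun n : ℕ => ENNReal.ofReal (F n 1)) atTop (𝓝 ∞) := by
        rw [ENNReal.tendsto_ofReal_nhds_top]
        refine tendsto_atTop_mono (fun n => ?_) tendsto_natCast_atTop_atTop
        simp only [F, varianceKernel_one]
        rw [sq, mul_div_assoc, div_self (by positivity)]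
        push_cast
        linarith
      rw [h1.liminf_eq]
      exact le_top
    · have h : 0 < 1 - t := by linarith
      have h1 := ((tendsto_add_atTop_iff_nat 1).2 (tendsto_varianceKernel_div ht ht1)).add_const 1
      have h2 : Tendsto (fun n : ℕ => ENNReal.ofReal (F n t)) atTop _ := ENNReal.tendsto_ofReal h1
      rw [h2.liminf_eq, ← ENNReal.ofReal_inv_of_pos h]
      refine ENNReal.ofReal_le_ofReal ?_
      rw [div_add_one h.ne', ← one_div]
      exact div_le_div_of_nonneg_right (by linarith) h.le
  refine (lintegral_mono_ae hlow).trans_lt ((lintegral_liminf_le fun n =>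
    (hFc n).measurable.ennreal_ofReal).trans_lt ?_)
  refine lt_of_le_of_lt (liminf_le_of_le ⟨0, by simp⟩
    (fun b hb => ?_)) (ENNReal.ofReal_lt_top (r := C + ν.real Set.univ))
  obtain ⟨n, hn⟩ := hb.exists
  refine hn.trans ?_
  rw [← ofReal_integral_eq_lintegral_ofReal (integrable_of_continuous hν (hFc n))
    (by filter_upwards [hν] with t ht using hF0 n t ht)]
  refine ENNReal.ofReal_le_ofReal ?_
  simp only [F]
  rw [integral_add (integrable_of_continuous hν ((continuous_varianceKernel _).div_const _))
    (integrable_const _), integral_div]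
  have := hC (n + 1) (by omega)
  simp only [integral_const, smul_eq_mul, mul_one]
  linarith

theorem tendsto_integral_varianceKernel (hν : ∀ᵐ t ∂ν, t ∈ Set.Icc (-1 : ℝ) 1)
    (hI : ∫⁻ t, (ENNReal.ofReal (1 - t))⁻¹ ∂ν < ∞) :
    Tendsto (fun n : ℕ => (∫ t, varianceKernel n t ∂ν) / n) atTop
      (𝓝 (∫ t, (1 + t) / (1 - t) ∂ν)) := by
  simp only [← integral_div]
  refine tendsto_integral_of_dominated_convergence (fun t => 6 * (1 / (1 - t)))
    (fun n => ((continuous_varianceKernel n).div_const _).aestronglyMeasurable)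
    ((integrable_inv_one_sub hI).const_mul 6) (fun n => ?_) ?_
  · filter_upwards [hν, ae_lt_one hI] with t ht ht1
    have h : 0 < 1 - t := by linarith
    rw [norm_div, Real.norm_natCast]
    refine div_le_of_le_mul₀ n.cast_nonneg (by positivity) ?_
    rw [mul_comm]
    exact abs_varianceKernel_le ht ht1 n
  · filter_upwards [hν, ae_lt_one hI] with t ht ht1 using tendsto_varianceKernel_div ht ht1

theorem abs_sum_integral_pow_le (hν : ∀ᵐ t ∂ν, t ∈ Set.Icc (-1 : ℝ) 1)
    (hI : ∫⁻ t, (ENNReal.ofReal (1 - t))⁻¹ ∂ν < ∞) (n : ℕ) :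
    |∑ k ∈ Finset.Icc 1 n, ∫ t, t ^ k ∂ν| ≤ ∫ t, 2 * (1 / (1 - t)) ∂ν := by
  rw [← integral_finsetSum _ fun k _ => integrable_of_continuous hν (continuous_pow k)]
  rw [← Real.norm_eq_abs]
  refine norm_integral_le_of_norm_le ((integrable_inv_one_sub hI).const_mul 2) ?_
  filter_upwards [hν, ae_lt_one hI] with t ht ht1
  have h1 : ∑ k ∈ Finset.Icc 1 n, t ^ k = t * ∑ k ∈ Finset.range n, t ^ k := by
    rw [Finset.mul_sum, ← Finset.Ico_add_one_right_eq_Icc, Finset.sum_Ico_eq_sum_range]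
    simp [pow_add]
  rw [h1, norm_mul, mul_one_div]
  have h2 : ‖t‖ ≤ 1 := abs_le.2 ht
  exact (mul_le_of_le_one_left (norm_nonneg _) h2).trans (abs_geom_sum_le ht ht1 n)

end Kernels

/-! ### The range of `√(1 - T)` -/

section SqrtRange

variable {H : Type*} [NormedAddCommGroup H] [InnerProductSpace ℂ H] [CompleteSpace H]
  {T : H →L[ℂ] H}

theorem cfc_sqrt_one_sub_mul_self (hsa : IsSelfAdjoint T) (hT : ‖T‖ ≤ 1) :
    cfc (fun t : ℝ => √(1 - t)) T * cfc (fun t : ℝ => √(1 - t)) T = 1 - T := by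
  have hc : ContinuousOn (fun t : ℝ => √(1 - t)) (spectrum ℝ T) := by fun_prop
  rw [← cfc_mul _ _ T hc hc]
  have h1 : cfc (fun t : ℝ => √(1 - t) * √(1 - t)) T = cfc (fun t : ℝ => 1 - t) T :=
    cfc_congr fun t ht =>
      Real.mul_self_sqrt (by linarith [(spectrum_subset_Icc hT ht).2])
  rw [h1, cfc_sub (fun _ : ℝ => (1 : ℝ)) (fun t => t) T, cfc_const_one ℝ T, cfc_id' ℝ T]

theorem opSqrt_one_sub (hsa : IsSelfAdjoint T) (hT : ‖T‖ ≤ 1) :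
    opSqrt (1 - T) = cfc (fun t : ℝ => √(1 - t)) T :=
  CFC.sqrt_unique (cfc_sqrt_one_sub_mul_self hsa hT)
    (cfc_nonneg fun _ _ => Real.sqrt_nonneg _)

theorem opSqrt_mul_self (hsa : IsSelfAdjoint T) (hT : ‖T‖ ≤ 1) (v : H) :
    opSqrt (1 - T) (opSqrt (1 - T) v) = v - T v := by
  have h := cfc_sqrt_one_sub_mul_self hsa hT
  rw [← opSqrt_one_sub hsa hT] at h
  have := DFunLike.congr_fun h v
  simpa using this

theorem inner_opSqrt_left (hsa : IsSelfAdjoint T) (hT : ‖T‖ ≤ 1) (u v : H) :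
    inner ℂ (opSqrt (1 - T) u) v = inner ℂ u (opSqrt (1 - T) v) := by
  have h : IsSelfAdjoint (opSqrt (1 - T)) := by
    rw [opSqrt_one_sub hsa hT]; exact cfc_predicate _ T
  exact (ContinuousLinearMap.isSelfAdjoint_iff_isSymmetric.1 h) u v

/-- With `R = √(1 - T)` commuting with `T` and `R² = 1 - T`, one has `⟨R g, T^k R g⟩ = ⟨g, T^k g⟩ -
⟨g, T^{k+1} g⟩`, and the sum telescopes. -/
theorem abs_sum_inner_pow_opSqrt_le (hsa : IsSelfAdjoint T) (hT : ‖T‖ ≤ 1) (g : H) (n : ℕ) :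
    |∑ k ∈ Finset.Icc 1 n, (inner ℂ (opSqrt (1 - T) g) ((T ^ k) (opSqrt (1 - T) g))).re| ≤
      2 * ‖g‖ ^ 2 := by
  set R := opSqrt (1 - T)
  -- Computing `R³ u` as `R (R² u)` and as `R² (R u)` gives the commutation.
  have hcomm : ∀ u, R (T u) = T (R u) := by
    intro u
    have h1 := opSqrt_mul_self hsa hT u
    have h2 := opSqrt_mul_self hsa hT (R u)
    have h3 : R (R (R u)) = R u - R (T u) := by rw [← map_sub]; exact congrArg R h1
    have h4 : R u - R (T u) = R u - T (R u) := h3.symm.trans h2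
    exact sub_right_injective h4
  have hpow : ∀ (k : ℕ) (u : H), R ((T ^ k) u) = (T ^ k) (R u) := by
    intro k
    induction k with
    | zero => intro u; rfl
    | succ k ih => intro u; rw [pow_succ, mul_apply_eq_comp, mul_apply_eq_comp, ih, hcomm]
  have hterm : ∀ k, (inner ℂ (R g) ((T ^ k) (R g))).re =
      (inner ℂ g ((T ^ k) g)).re - (inner ℂ g ((T ^ (k + 1)) g)).re := by
    intro k
    rw [inner_opSqrt_left hsa hT, ← hpow]
    have h1 : R (R ((T ^ k) g)) = (T ^ k) g - T ((T ^ k) g) := opSqrt_mul_self hsa hT _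
    rw [show opSqrt (1 - T) (R ((T ^ k) g)) = R (R ((T ^ k) g)) from rfl, h1, inner_sub_right,
      Complex.sub_re, pow_succ', mul_apply_eq_comp]
  have htel : ∑ k ∈ Finset.Icc 1 n, (inner ℂ (R g) ((T ^ k) (R g))).re =
      (inner ℂ g ((T ^ 1) g)).re - (inner ℂ g ((T ^ (n + 1)) g)).re := by
    simp only [hterm]
    induction n with
    | zero => simp
    | succ n ih => rw [Finset.sum_Icc_succ_top (by omega), ih]; ring
  have hb : ∀ k, |(inner ℂ g ((T ^ k) g)).re| ≤ ‖g‖ ^ 2 := by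
    intro k
    have h1 : ‖T ^ k‖ ≤ 1 := by
      induction k with
      | zero => exact ContinuousLinearMap.norm_id_le
      | succ k ih =>
        rw [pow_succ]
        exact (norm_mul_le _ _).trans (mul_le_one₀ ih (norm_nonneg _) hT)
    refine (Complex.abs_re_le_norm _).trans ((norm_inner_le_norm _ _).trans ?_)
    rw [sq]
    exact mul_le_mul_of_nonneg_left (((T ^ k).le_of_opNorm_le h1 g).trans_eq (one_mul _))
      (norm_nonneg _)
  rw [htel]
  refine (abs_sub _ _).trans ?_
  linarith [hb 1, hb (n + 1)]

/-- The preimage should be `(1 - T)^{-1/2} v`. The function `(1 - t)^{-1/2}` is unbounded but lies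
in `L²(ν)` by hypothesis, so the continuous regularizations `φ n` converge to it in `L²(ν)` and the
vectors `φ n (T) v` are Cauchy. Since `√(1 - t) φ n ≤ 1` tends to `1` almost everywhere, the limit
is mapped to `v`. -/
theorem exists_opSqrt_eq (hsa : IsSelfAdjoint T) (hT : ‖T‖ ≤ 1) (v : H)
    (hI : ∫⁻ t in Set.Icc (-1 : ℝ) 1, (ENNReal.ofReal (1 - t))⁻¹ ∂(spectralMeasure T v) < ∞) :
    ∃ w : H, opSqrt (1 - T) w = v := by
  set ν := (spectralMeasure T v).restrict (Set.Icc (-1 : ℝ) 1) with hνdef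
  have hν1 : ∀ᵐ t ∂ν, t < 1 := ae_lt_one hI
  have hint : Integrable (fun t : ℝ => 1 / (1 - t)) ν := integrable_inv_one_sub hI
  have hpos : ∀ (n : ℕ) (t : ℝ), 0 < √(1 - t) + 1 / ((n : ℝ) + 1) := fun n t => by positivity
  set φ : ℕ → ℝ → ℝ := fun n t => (√(1 - t) + 1 / ((n : ℝ) + 1))⁻¹ with hφdef
  have hφc : ∀ n, Continuous (φ n) := fun n =>
    Continuous.inv₀ (by fun_prop) fun t => (hpos n t).ne'
  have hlim : ∀ t : ℝ, t < 1 → Tendsto (fun n => φ n t) atTop (𝓝 (√(1 - t))⁻¹) := by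
    intro t ht
    have h1 : Tendsto (fun n : ℕ => √(1 - t) + 1 / ((n : ℝ) + 1)) atTop (𝓝 (√(1 - t) + 0)) :=
      tendsto_one_div_add_atTop_nhds_zero_nat.const_add _
    rw [add_zero] at h1
    exact h1.inv₀ (Real.sqrt_pos.2 (by linarith)).ne'
  have hle : ∀ (n : ℕ) (t : ℝ), t < 1 → 0 ≤ φ n t ∧ φ n t ≤ (√(1 - t))⁻¹ := by
    intro n t ht
    refine ⟨(inv_pos.2 (hpos n t)).le, inv_anti₀ (Real.sqrt_pos.2 (by linarith)) ?_⟩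
    have : 0 ≤ 1 / ((n : ℝ) + 1) := by positivity
    linarith
  have hmeas : ∀ n, AEStronglyMeasurable (fun t => (φ n t - (√(1 - t))⁻¹) ^ 2) ν := fun n => by
    have : Measurable fun t => (φ n t - (√(1 - t))⁻¹) ^ 2 := by
      have := (hφc n).measurable
      fun_prop
    exact this.aestronglyMeasurable
  have hbd : ∀ n, ∀ᵐ t ∂ν, ‖(φ n t - (√(1 - t))⁻¹) ^ 2‖ ≤ 1 / (1 - t) := by
    intro n
    filter_upwards [hν1] with t ht
    obtain ⟨h1, h2⟩ := hle n t ht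
    have h3 : ((√(1 - t))⁻¹) ^ 2 = 1 / (1 - t) := by
      rw [inv_pow, Real.sq_sqrt (by linarith), one_div]
    rw [Real.norm_of_nonneg (sq_nonneg _), ← h3]
    nlinarith
  -- The squared `L²(ν)` distance to the singular limit, which itself never enters the continuous
  -- functional calculus.
  set b : ℕ → ℝ := fun n => ∫ t, (φ n t - (√(1 - t))⁻¹) ^ 2 ∂ν with hbdef
  have hbi : ∀ n, Integrable (fun t => (φ n t - (√(1 - t))⁻¹) ^ 2) ν := fun n =>
    hint.mono' (hmeas n) (hbd n)
  have hb : Tendsto b atTop (𝓝 0) := by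
    have : Tendsto b atTop (𝓝 (∫ _, (0 : ℝ) ∂ν)) := by
      refine tendsto_integral_of_dominated_convergence _ hmeas hint hbd ?_
      filter_upwards [hν1] with t ht
      simpa using ((hlim t ht).sub_const (√(1 - t))⁻¹).pow 2
    simpa using this
  set w : ℕ → H := fun n => cfc (φ n) T v with hwdef
  have hdist : ∀ n m, ‖w n - w m‖ ^ 2 ≤ 2 * (b n + b m) := by
    intro n m
    have h1 : w n - w m = cfc (fun t => φ n t - φ m t) T v := by
      rw [cfc_sub (φ n) (φ m) T (hφc n).continuousOn (hφc m).continuousOn, sub_apply]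
    rw [h1, ← setIntegral_sq_spectralMeasure (φ := fun t => φ n t - φ m t) hT v
      ((hφc n).sub (hφc m)), ← hνdef, hbdef,
      ← integral_add (hbi n) (hbi m), ← integral_const_mul]
    refine integral_mono (integrableOn_spectralMeasure v (((hφc n).sub (hφc m)).pow 2))
      (((hbi n).add (hbi m)).const_mul 2) fun t => ?_
    simp only
    nlinarith [sq_nonneg ((φ n t - (√(1 - t))⁻¹) + (φ m t - (√(1 - t))⁻¹))]
  have hcauchy : CauchySeq w := by
    rw [Metric.cauchySeq_iff]
    intro ε hε
    obtain ⟨N, hN⟩ := (hb.eventually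
      (gt_mem_nhds (show 0 < ε ^ 2 / 4 by positivity))).exists_forall_of_atTop
    refine ⟨N, fun m hm n hn => ?_⟩
    rw [dist_eq_norm]
    refine lt_of_pow_lt_pow_left₀ 2 hε.le ((hdist m n).trans_lt ?_)
    linarith [hN m hm, hN n hn]
  obtain ⟨w₀, hw₀⟩ := cauchySeq_tendsto_of_complete hcauchy
  refine ⟨w₀, tendsto_nhds_unique (((opSqrt (1 - T)).continuous.tendsto w₀).comp hw₀) ?_⟩
  rw [tendsto_iff_norm_sub_tendsto_zero]
  have hsc : Continuous fun t : ℝ => √(1 - t) := by fun_prop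
  have hnorm : ∀ n, ‖opSqrt (1 - T) (w n) - v‖ ^ 2 = ∫ t, (√(1 - t) * φ n t - 1) ^ 2 ∂ν := by
    intro n
    have h1 : opSqrt (1 - T) (w n) - v = cfc (fun t => √(1 - t) * φ n t - 1) T v := by
      rw [cfc_sub (fun t => √(1 - t) * φ n t) (fun _ => (1 : ℝ)) T
        (hsc.mul (hφc n)).continuousOn continuousOn_const, cfc_const_one ℝ T,
        cfc_mul _ _ T hsc.continuousOn (hφc n).continuousOn, opSqrt_one_sub hsa hT]
      simp [hwdef]
    rw [h1, ← setIntegral_sq_spectralMeasure (φ := fun t => √(1 - t) * φ n t - 1) hT v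
      ((hsc.mul (hφc n)).sub continuous_const)]
  have hsq : Tendsto (fun n => ‖opSqrt (1 - T) (w n) - v‖ ^ 2) atTop (𝓝 0) := by
    simp only [hnorm]
    have : Tendsto (fun n => ∫ t, (√(1 - t) * φ n t - 1) ^ 2 ∂ν) atTop (𝓝 (∫ _, (0 : ℝ) ∂ν)) := by
      refine tendsto_integral_of_dominated_convergence (fun _ => 1)
        (fun n => (((hsc.mul (hφc n)).sub continuous_const).pow 2).aestronglyMeasurable)
        (integrable_const _) (fun n => ?_) ?_
      · filter_upwards [hν1] with t ht
        obtain ⟨h1, h2⟩ := hle n t ht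
        have h3 : 0 < √(1 - t) := Real.sqrt_pos.2 (by linarith)
        have h4 : √(1 - t) * φ n t ≤ 1 :=
          (mul_le_mul_of_nonneg_left h2 h3.le).trans_eq (mul_inv_cancel₀ h3.ne')
        have h5 : 0 ≤ √(1 - t) * φ n t := by positivity
        rw [Real.norm_of_nonneg (sq_nonneg _)]
        nlinarith
      · filter_upwards [hν1] with t ht
        have h3 : 0 < √(1 - t) := Real.sqrt_pos.2 (by linarith)
        have := (((hlim t ht).const_mul (√(1 - t))).sub_const 1).pow 2
        simpa [mul_inv_cancel₀ h3.ne'] using this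
    simpa using this
  have := (Real.continuous_sqrt.tendsto 0).comp hsq
  simpa [Function.comp_def, Real.sqrt_sq] using this

end SqrtRange

/-! ### Real functions -/

section Real

variable {S : Type*} [MeasurableSpace S] {Q : Kernel S S} [IsMarkovKernel Q] {π : Measure S}

theorem star_add_Lp (u v : Lp ℂ 2 π) : star (u + v) = star u + star v := by
  refine Lp.ext ?_
  filter_upwards [Lp.coeFn_star (u + v), Lp.coeFn_add u v, Lp.coeFn_star u, Lp.coeFn_star v,
    Lp.coeFn_add (star u) (star v)] with x h1 h2 h3 h4 h5
  rw [h1, h5, Pi.star_apply, h2, Pi.add_apply, Pi.add_apply, h3, h4]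
  simp

theorem star_smul_Lp (c : ℂ) (u : Lp ℂ 2 π) : star (c • u) = star c • star u := by
  refine Lp.ext ?_
  filter_upwards [Lp.coeFn_star (c • u), Lp.coeFn_smul c u, Lp.coeFn_star u,
    Lp.coeFn_smul (star c) (star u)] with x h1 h2 h3 h4
  rw [h1, h4, Pi.star_apply, h2, Pi.smul_apply, Pi.smul_apply, h3]
  simp

theorem norm_star_Lp (u : Lp ℂ 2 π) : ‖star u‖ = ‖u‖ := by
  refine le_antisymm (Lp.norm_le_norm_of_ae_le ?_) (Lp.norm_le_norm_of_ae_le ?_) <;>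
  · filter_upwards [Lp.coeFn_star u] with x h1
    simp [h1]

theorem inner_star_Lp (u v : Lp ℂ 2 π) : inner ℂ (star u) (star v) = inner ℂ v u := by
  rw [L2.inner_def, L2.inner_def]
  refine integral_congr_ae ?_
  filter_upwards [Lp.coeFn_star u, Lp.coeFn_star v] with x h1 h2
  rw [h1, h2]
  simp [mul_comm]

theorem star_toL2 {g : S → ℝ} (hg : MemLp g 2 π) : star (toL2 g hg) = toL2 g hg := by
  refine Lp.ext ?_
  filter_upwards [Lp.coeFn_star (toL2 g hg), coeFn_toL2 hg] with x h1 h2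
  rw [h1, Pi.star_apply, h2]
  simp

theorem star_transitionL2 (h : Q.Invariant π) (u : Lp ℂ 2 π) :
    star (transitionL2 h u) = transitionL2 h (star u) := by
  have hT : ∀ u : Lp ℂ 2 π, (transitionL2 h u : S → ℂ) =ᵐ[π] transition Q u := fun u =>
    MemLp.coeFn_toLp (memLp_transition h u)
  refine Lp.ext ?_
  filter_upwards [Lp.coeFn_star (transitionL2 h u), hT u, hT (star u),
    transition_congr h (Lp.coeFn_star u)] with x h1 h2 h3 h4
  rw [h1, Pi.star_apply, h2, h3, h4]
  exact integral_conj.symm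

/-- Conjugation of an operator by the complex conjugation of `L²(π)`. -/
noncomputable def conjOperator (A : Lp ℂ 2 π →L[ℂ] Lp ℂ 2 π) : Lp ℂ 2 π →L[ℂ] Lp ℂ 2 π :=
  LinearMap.mkContinuous
    { toFun := fun u => star (A (star u))
      map_add' := fun u v => by rw [star_add_Lp, map_add, star_add_Lp]
      map_smul' := fun c u => by rw [star_smul_Lp, map_smul, star_smul_Lp, star_star]; rfl }
    ‖A‖ fun u => by
      change ‖star (A (star u))‖ ≤ _
      rw [norm_star_Lp, ← norm_star_Lp u]
      exact A.le_opNorm _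

theorem conjOperator_apply (A : Lp ℂ 2 π →L[ℂ] Lp ℂ 2 π) (u : Lp ℂ 2 π) :
    conjOperator A u = star (A (star u)) := rfl

/-- Since `T` comes from a real kernel, conjugating `√(1 - T)` by complex conjugation gives another
positive square root of `1 - T`; uniqueness identifies the two. -/
theorem star_opSqrt [IsFiniteMeasure π] (h : Q.Invariant π)
    (hrev : (π ⊗ₘ Q).map Prod.swap = π ⊗ₘ Q) (u : Lp ℂ 2 π) :
    star (opSqrt (1 - transitionL2 h) u) = opSqrt (1 - transitionL2 h) (star u) := by
  have hsa := isSelfAdjoint_transitionL2 h hrev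
  have hT := norm_transitionL2_le h
  set R := opSqrt (1 - transitionL2 h) with hR
  have hR0 : R.IsPositive := by
    rw [← ContinuousLinearMap.nonneg_iff_isPositive, hR]
    exact CFC.sqrt_nonneg _
  have hneg : ∀ u : Lp ℂ 2 π, star (-u) = -star u := fun u => by
    have := star_smul_Lp (-1 : ℂ) u
    simpa using this
  have h1 : conjOperator R * conjOperator R = 1 - transitionL2 h := by
    ext1 v
    rw [mul_apply_eq_comp, conjOperator_apply, conjOperator_apply, star_star,
      opSqrt_mul_self hsa hT, sub_eq_add_neg, star_add_Lp, hneg, star_transitionL2, star_star]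
    simp [sub_eq_add_neg]
  have h2 : 0 ≤ conjOperator R := by
    rw [ContinuousLinearMap.nonneg_iff_isPositive]
    refine ⟨?_, fun v => ?_⟩
    · intro x y
      have h3 : inner ℂ (R (star y)) (star x) = inner ℂ (star y) (R (star x)) :=
        hR0.isSymmetric (star y) (star x)
      have h4 := inner_star_Lp (R (star x)) (star y)
      have h5 := inner_star_Lp (star x) (R (star y))
      rw [star_star] at h4 h5
      exact h4.trans (h3.symm.trans h5.symm)
    · have h3 := hR0.inner_nonneg_right (star v)
      have h4 := inner_star_Lp (R (star v)) (star v)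
      rw [star_star] at h4
      rw [ContinuousLinearMap.reApplyInnerSelf_apply, conjOperator_apply, h4]
      exact (RCLike.nonneg_iff.1 h3).1
  have h3 : R = conjOperator R := CFC.sqrt_unique h1 h2
  conv_rhs => rw [h3, conjOperator_apply, star_star]

end Real

/-! ### The equivalences -/

section Range

variable {S : Type*} [MeasurableSpace S] {Q : Kernel S S} [IsMarkovKernel Q] {π : Measure S}

theorem transitionL2_const [IsFiniteMeasure π] (h : Q.Invariant π) (c : ℝ) :
    transitionL2 h (toL2 (fun _ => c) (memLp_const c)) = toL2 (fun _ => c) (memLp_const c) := by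
  refine Lp.ext ((toL2_transition_aux h _).trans (EventuallyEq.trans ?_ (coeFn_toL2 _).symm))
  exact Eventually.of_forall fun x => by simp [transition]

/-- Constants are fixed by `T`, and `‖√(1 - T) c‖² = ⟨c, (1 - T) c⟩ = 0`. -/
theorem opSqrt_const [IsFiniteMeasure π] (h : Q.Invariant π)
    (hrev : (π ⊗ₘ Q).map Prod.swap = π ⊗ₘ Q) (c : ℝ) :
    opSqrt (1 - transitionL2 h) (toL2 (fun _ => c) (memLp_const c)) = 0 := by
  have hsa := isSelfAdjoint_transitionL2 h hrev
  have hT := norm_transitionL2_le h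
  rw [← inner_self_eq_zero (𝕜 := ℂ), inner_opSqrt_left hsa hT, opSqrt_mul_self hsa hT,
    transitionL2_const, sub_self, inner_zero_right]

/-- The real part of a preimage is still a preimage because `√(1 - T)` commutes with conjugation,
and subtracting its mean changes nothing because constants are in the kernel. -/
theorem inRangeSqrt_of_exists [IsProbabilityMeasure π] (h : Q.Invariant π)
    (hrev : (π ⊗ₘ Q).map Prod.swap = π ⊗ₘ Q) {f : S → ℝ} (hf : MemLp f 2 π)
    (hex : ∃ w, opSqrt (1 - transitionL2 h) w = toL2 f hf) : InRangeSqrt h f hf := by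
  obtain ⟨w, hw⟩ := hex
  have hg : MemLp (fun x => (w x).re) 2 π := (Lp.memLp w).re
  have hw2 : toL2 _ hg = (1 / 2 : ℂ) • (w + star w) := by
    refine Lp.ext ?_
    filter_upwards [coeFn_toL2 hg, Lp.coeFn_smul (1 / 2 : ℂ) (w + star w), Lp.coeFn_add w (star w),
      Lp.coeFn_star w] with x h1 h2 h3 h4
    rw [h1, h2, Pi.smul_apply, h3, Pi.add_apply, h4, Pi.star_apply, smul_eq_mul,
      RCLike.star_def, Complex.add_conj]
    push_cast
    ring
  have hR : opSqrt (1 - transitionL2 h) (toL2 _ hg) = toL2 f hf := by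
    rw [hw2, map_smul, map_add, ← star_opSqrt h hrev, hw, star_toL2, ← two_smul ℂ (toL2 f hf),
      smul_smul]
    norm_num
  set c := ∫ x, (w x).re ∂π
  refine ⟨fun x => (w x).re - c, hg.sub (memLp_const c), ?_, ?_⟩
  · rw [integral_sub (hg.integrable (by norm_num)) (integrable_const _)]
    simp [c]
  · have hsub : toL2 (fun x => (w x).re - c) (hg.sub (memLp_const c)) =
        toL2 _ hg - toL2 (fun _ => c) (memLp_const c) := by
      refine Lp.ext ?_
      filter_upwards [coeFn_toL2 (hg.sub (memLp_const c)), coeFn_toL2 hg,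
        coeFn_toL2 (π := π) (memLp_const c), Lp.coeFn_sub (toL2 _ hg)
        (toL2 (π := π) (fun _ => c) (memLp_const c))] with x h1 h2 h3 h4
      rw [h4, Pi.sub_apply, h2, h3]
      refine h1.trans ?_
      simp
    rw [hsub, map_sub, opSqrt_const h hrev, sub_zero, hR]

theorem integral_mul_transitionPow_eq_inner (h : Q.Invariant π) {f : S → ℝ} (hf : MemLp f 2 π)
    (k : ℕ) : ∫ x, f x * transitionPow Q k f x ∂π =
      (inner ℂ (toL2 f hf) ((transitionL2 h ^ k) (toL2 f hf))).re := by
  rw [← toL2_transitionPow h k hf, inner_toL2 hf (memLp_transitionPow h k hf), Complex.ofReal_re]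

theorem integral_mul_transitionPow_eq_setIntegral [IsFiniteMeasure π] (h : Q.Invariant π)
    (hrev : (π ⊗ₘ Q).map Prod.swap = π ⊗ₘ Q) {f : S → ℝ} (hf : MemLp f 2 π) (k : ℕ) :
    ∫ x, f x * transitionPow Q k f x ∂π =
      ∫ t in Set.Icc (-1 : ℝ) 1, t ^ k ∂(spectralMeasure (transitionL2 h) (toL2 f hf)) := by
  have hsa := isSelfAdjoint_transitionL2 h hrev
  rw [integral_mul_transitionPow_eq_inner h hf k,
    setIntegral_spectralMeasure (norm_transitionL2_le h) _ (continuous_pow k),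
    cfc_pow_id (R := ℝ) _ k]

end Range

/-! ### Variance of the partial sums -/

section Chain

variable {S Ω : Type*} [MeasurableSpace S] [MeasurableSpace Ω] {Q : Kernel S S}
  [IsMarkovKernel Q] {π : Measure S} {P : Measure Ω} [IsProbabilityMeasure P] {ξ : ℤ → Ω → S}

/-- With `c_k` the covariance at lag `k`, passing from `n` to `n + 1` adds `2 ∑_{k=1}^n c_k + c_0`,
written as `2 ∑_{k=0}^n c_k - c_0` to match `varianceKernel`. -/
theorem IsStationaryReversibleMarkovChain.integral_partialSum_sq
    (h : IsStationaryReversibleMarkovChain Q π P ξ) {f : S → ℝ} (hf : MemLp f 2 π) (n : ℕ) :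
    ∫ ω, partialSum f ξ n ω ^ 2 ∂P = ∑ m ∈ Finset.range n,
      (2 * ∑ k ∈ Finset.range (m + 1), ∫ x, f x * transitionPow Q k f x ∂π -
        ∫ x, f x * transitionPow Q 0 f x ∂π) := by
  have hL : ∀ i, MemLp (fun ω => f (ξ i ω)) 2 P := h.memLp_comp hf
  have hS : ∀ n, MemLp (partialSum f ξ n) 2 P := fun n =>
    memLp_finsetSum _ fun i _ => hL i
  induction n with
  | zero => simp [partialSum]
  | succ n ih =>
    rw [Finset.sum_range_succ, ← ih]
    have hsucc : ∀ ω, partialSum f ξ (n + 1) ω =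
        partialSum f ξ n ω + f (ξ ((n + 1 : ℕ) : ℤ) ω) := fun ω =>
      Finset.sum_Icc_succ_top (by omega) _
    have hexp : ∀ ω, partialSum f ξ (n + 1) ω ^ 2 = partialSum f ξ n ω ^ 2 +
        (2 * (partialSum f ξ n ω * f (ξ ((n + 1 : ℕ) : ℤ) ω)) +
          f (ξ ((n + 1 : ℕ) : ℤ) ω) * f (ξ ((n + 1 : ℕ) : ℤ) ω)) := fun ω => by
      rw [hsucc]; ring
    simp only [hexp]
    have i1 : Integrable (fun ω => partialSum f ξ n ω ^ 2) P := (hS n).integrable_sq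
    have i2 : Integrable (fun ω => partialSum f ξ n ω * f (ξ ((n + 1 : ℕ) : ℤ) ω)) P :=
      (hS n).integrable_mul (hL _)
    have i3 : Integrable (fun ω => f (ξ ((n + 1 : ℕ) : ℤ) ω) * f (ξ ((n + 1 : ℕ) : ℤ) ω)) P :=
      (hL _).integrable_mul (hL _)
    have i4 : Integrable (fun ω => 2 * (partialSum f ξ n ω * f (ξ ((n + 1 : ℕ) : ℤ) ω)) +
        f (ξ ((n + 1 : ℕ) : ℤ) ω) * f (ξ ((n + 1 : ℕ) : ℤ) ω)) P := (i2.const_mul 2).add i3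
    rw [integral_add i1 i4, integral_add (i2.const_mul 2) i3,
      integral_const_mul]
    have h0 := h.integral_mul_add hf hf ((n + 1 : ℕ) : ℤ) 0
    simp only [Nat.cast_zero, add_zero] at h0
    have hcross : ∫ ω, partialSum f ξ n ω * f (ξ ((n + 1 : ℕ) : ℤ) ω) ∂P =
        ∑ k ∈ Finset.range n, ∫ x, f x * transitionPow Q (k + 1) f x ∂π := by
      have hi : ∀ i ∈ Finset.Icc 1 n,
          Integrable (fun ω => f (ξ (i : ℤ) ω) * f (ξ ((n + 1 : ℕ) : ℤ) ω)) P :=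
        fun i _ => (hL i).integrable_mul (hL _)
      simp only [partialSum, Finset.sum_mul]
      rw [integral_finsetSum _ hi,
        ← Finset.sum_range_reflect, ← Finset.Ico_add_one_right_eq_Icc,
        Finset.sum_Ico_eq_sum_range]
      refine Finset.sum_congr (by simp) fun j hj => ?_
      have hj' : j < n := by simpa using hj
      -- The lag between times `1 + j` and `n + 1` is `n - j`, the reflected summation index plus
      -- one.
      rw [← h.integral_mul_add hf hf ((1 + j : ℕ) : ℤ) (n - 1 - j + 1)]
      have : (((1 + j : ℕ) : ℤ)) + ((n - 1 - j + 1 : ℕ) : ℤ) = ((n + 1 : ℕ) : ℤ) := by omega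
      rw [this]
    rw [h0, hcross, Finset.sum_range_succ']
    ring

end Chain

/-! ### The five equivalent conditions -/

section Main

variable {S Ω : Type*} [MeasurableSpace S] [MeasurableSpace Ω] {Q : Kernel S S}
  [IsMarkovKernel Q] {π : Measure S} {P : Measure Ω} [IsProbabilityMeasure P] {ξ : ℤ → Ω → S}

/-- The spectral condition is the hub: `1 → 2 → 4`, then `4 → 3 → 2`, `4 → 1` and `4 → 5 → 1`. -/
theorem IsStationaryReversibleMarkovChain.tfae (h : IsStationaryReversibleMarkovChain Q π P ξ)
    {f : S → ℝ} (hf : MemLp f 2 π) :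
    List.TFAE
      [CovarianceSumsBounded Q π f,
       VarianceLinearlyBounded P ξ f,
       VarianceConverges P ξ f,
       SpectralIntegralFinite h.invariant f hf,
       InRangeSqrt h.invariant f hf] := by
  have hπ := h.isProbabilityMeasure
  have hrev := h.map_swap_compProd
  have hsa := isSelfAdjoint_transitionL2 h.invariant hrev
  have hT := norm_transitionL2_le h.invariant
  set ν := (spectralMeasure (transitionL2 h.invariant) (toL2 f hf)).restrict
    (Set.Icc (-1 : ℝ) 1) with hνdef
  have hν : ∀ᵐ t ∂ν, t ∈ Set.Icc (-1 : ℝ) 1 := ae_restrict_mem measurableSet_Icc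
  have hcov : ∀ k, ∫ x, f x * transitionPow Q k f x ∂π = ∫ t, t ^ k ∂ν := fun k =>
    integral_mul_transitionPow_eq_setIntegral h.invariant hrev hf k
  have hvar : ∀ n, ∫ ω, partialSum f ξ n ω ^ 2 ∂P = ∫ t, varianceKernel n t ∂ν := by
    intro n
    have hi : ∀ k : ℕ, Integrable (fun t : ℝ => t ^ k) ν := fun k =>
      integrable_of_continuous hν (continuous_pow k)
    have hi' : ∀ m : ℕ, Integrable (fun t : ℝ => 2 * ∑ k ∈ Finset.range (m + 1), t ^ k) ν :=
      fun m => (integrable_finsetSum _ fun k _ => hi k).const_mul 2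
    have hi2 : ∀ m : ℕ, Integrable
        (fun t : ℝ => 2 * ∑ k ∈ Finset.range (m + 1), t ^ k - 1) ν :=
      fun m => (hi' m).sub (integrable_const 1)
    rw [h.integral_partialSum_sq hf n]
    simp only [hcov]
    unfold varianceKernel
    rw [integral_finsetSum _ fun m _ => hi2 m]
    refine Finset.sum_congr rfl fun m _ => ?_
    rw [integral_sub (hi' m) (integrable_const 1), integral_const_mul,
      integral_finsetSum _ fun k _ => hi k]
    simp
  tfae_have 1 → 2 := by
    rintro ⟨C, hC⟩
    set a0 := ∫ x, f x * transitionPow Q 0 f x ∂π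
    refine ⟨2 * C + a0, fun n hn => ?_⟩
    rw [h.integral_partialSum_sq hf n, div_le_iff₀ (by positivity)]
    have hle : ∀ m ∈ Finset.range n,
        (2 * ∑ k ∈ Finset.range (m + 1), ∫ x, f x * transitionPow Q k f x ∂π - a0) ≤
          2 * C + a0 := by
      intro m _
      have h1 := (abs_le.1 (hC m)).2
      rw [← Finset.Ico_add_one_right_eq_Icc, Finset.sum_Ico_eq_sum_range] at h1
      simp only [Nat.add_sub_cancel, add_comm 1] at h1
      rw [Finset.sum_range_succ']
      linarith
    refine (Finset.sum_le_sum hle).trans_eq ?_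
    simp
    ring
  tfae_have 2 → 4 := by
    rintro ⟨C, hC⟩
    simp only [hvar] at hC
    exact lintegral_inv_one_sub_lt_top hν hC
  tfae_have 4 → 3 := by
    intro hI
    have h1 := tendsto_integral_varianceKernel hν hI
    simp only [← hvar] at h1
    -- The limit is nonnegative because `t ≥ -1`, hence a square.
    refine ⟨√(∫ t, (1 + t) / (1 - t) ∂ν), ?_⟩
    rwa [Real.sq_sqrt]
    refine integral_nonneg_of_ae ?_
    filter_upwards [hν, ae_lt_one hI] with t ht ht1
    exact div_nonneg (by linarith [ht.1]) (by linarith)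
  tfae_have 3 → 2 := by
    rintro ⟨σ, hσ⟩
    obtain ⟨C, hC⟩ := hσ.bddAbove_range
    exact ⟨C, fun n _ => hC ⟨n, rfl⟩⟩
  tfae_have 4 → 1 := by
    intro hI
    refine ⟨∫ t, 2 * (1 / (1 - t)) ∂ν, fun n => ?_⟩
    simp only [hcov]
    exact abs_sum_integral_pow_le hν hI n
  tfae_have 4 → 5 := fun hI =>
    inRangeSqrt_of_exists h.invariant hrev hf (exists_opSqrt_eq hsa hT _ hI)
  tfae_have 5 → 1 := by
    rintro ⟨g, hg, -, hgf⟩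
    refine ⟨2 * ‖toL2 g hg‖ ^ 2, fun n => ?_⟩
    simp only [integral_mul_transitionPow_eq_inner h.invariant hf, ← hgf]
    exact abs_sum_inner_pow_opSqrt_le hsa hT _ n
  tfae_finish

end Main

/-! ### A maximal inequality for dyadic averages of a symmetric Markov kernel -/

section ENNRealInequalities

theorem ennreal_two_mul_le_add_sq (a b : ℝ≥0∞) : 2 * (a * b) ≤ a ^ 2 + b ^ 2 := by
  induction a with
  | top => simp
  | coe a =>
    induction b with
    | top => simp
    | coe b =>
      have := two_mul_le_add_sq a b
      rw [mul_assoc] at this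
      exact_mod_cast this

theorem ennreal_add_sq_le (a b : ℝ≥0∞) : (a + b) ^ 2 ≤ 2 * a ^ 2 + 2 * b ^ 2 := by
  have := ennreal_two_mul_le_add_sq a b
  calc (a + b) ^ 2 = a ^ 2 + b ^ 2 + 2 * (a * b) := by ring
    _ ≤ a ^ 2 + b ^ 2 + (a ^ 2 + b ^ 2) := by gcongr
    _ = _ := by ring

/-- The crude constant is harmless: it only serves the qualitative bound
`SymmetricKernel.exists_dyadicMax_bound`. -/
theorem ennreal_sq_sum_le (x : ℕ → ℝ≥0∞) (n : ℕ) :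
    (∑ i ∈ Finset.range n, x i) ^ 2 ≤ 2 ^ n * ∑ i ∈ Finset.range n, x i ^ 2 := by
  induction n with
  | zero => simp
  | succ n ih =>
    rw [Finset.sum_range_succ, Finset.sum_range_succ]
    refine (ennreal_add_sq_le _ _).trans ?_
    rw [mul_add, pow_succ' (2 : ℝ≥0∞), mul_assoc]
    gcongr
    exact le_mul_of_one_le_right zero_le (one_le_pow₀ one_le_two)

/-- Keeping only the pairs `k ≤ i` lets the longer average absorb the shorter one in the `T T*`
estimate. -/
theorem ennreal_sq_sum_le_two_mul (x : ℕ → ℝ≥0∞) (n : ℕ) :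
    (∑ i ∈ Finset.range n, x i) ^ 2 ≤
      2 * ∑ i ∈ Finset.range n, ∑ k ∈ Finset.range (i + 1), x i * x k := by
  induction n with
  | zero => simp
  | succ n ih =>
    rw [Finset.sum_range_succ, Finset.sum_range_succ, ← Finset.mul_sum,
      Finset.sum_range_succ _ n]
    set s := ∑ i ∈ Finset.range n, x i
    calc (s + x n) ^ 2 = s ^ 2 + (2 * (x n * s) + x n * x n) := by ring
      _ ≤ s ^ 2 + (2 * (x n * s) + 2 * (x n * x n)) := by
        exact add_le_add_right (add_le_add_right (le_mul_of_one_le_left zero_le one_le_two) _) _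
      _ = s ^ 2 + 2 * (x n * (s + x n)) := by ring
      _ ≤ _ := by rw [mul_add 2]; gcongr

end ENNRealInequalities

/-! ### Dyadic averages of a symmetric kernel -/

section Averages

variable {S : Type*} [MeasurableSpace S]

/-- The action of a kernel on `[0, ∞]`-valued functions. -/
noncomputable def kernelOp (κ : Kernel S S) (g : S → ℝ≥0∞) (x : S) : ℝ≥0∞ := ∫⁻ y, g y ∂(κ x)

/-- The average of the first `2 ^ i` iterates. -/
noncomputable def dyadicAverage (κ : Kernel S S) (i : ℕ) (g : S → ℝ≥0∞) (x : S) : ℝ≥0∞ :=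
  (2 ^ i)⁻¹ * ∑ l ∈ Finset.range (2 ^ i), (kernelOp κ)^[l] g x

variable {κ : Kernel S S} {π : Measure S} {g h : S → ℝ≥0∞}

theorem measurable_fun_mul (hg : Measurable g) (hh : Measurable h) :
    Measurable fun x => g x * h x := hg.mul hh

theorem measurable_iterate_kernelOp (hg : Measurable g) (l : ℕ) :
    Measurable ((kernelOp κ)^[l] g) := by
  induction l with
  | zero => exact hg
  | succ l ih => rw [Function.iterate_succ_apply']; exact ih.lintegral_kernel

theorem measurable_dyadicAverage (hg : Measurable g) (i : ℕ) :
    Measurable (dyadicAverage κ i g) := by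
  have := measurable_iterate_kernelOp (κ := κ) hg
  exact (Finset.measurable_fun_sum _ fun l _ => this l).const_mul _

theorem iterate_kernelOp_sum {f : ℕ → S → ℝ≥0∞} (hf : ∀ i, Measurable (f i)) (s : Finset ℕ)
    (l : ℕ) (x : S) :
    (kernelOp κ)^[l] (fun y => ∑ i ∈ s, f i y) x = ∑ i ∈ s, (kernelOp κ)^[l] (f i) x := by
  induction l generalizing x with
  | zero => rfl
  | succ l ih =>
    simp only [Function.iterate_succ_apply']
    rw [kernelOp, lintegral_congr ih,
      lintegral_finsetSum _ fun i _ => measurable_iterate_kernelOp (hf i) l]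
    rfl

theorem iterate_kernelOp_const_mul (hg : Measurable g) (c : ℝ≥0∞) (l : ℕ) (x : S) :
    (kernelOp κ)^[l] (fun y => c * g y) x = c * (kernelOp κ)^[l] g x := by
  induction l generalizing x with
  | zero => rfl
  | succ l ih =>
    simp only [Function.iterate_succ_apply']
    rw [kernelOp, lintegral_congr ih, lintegral_const_mul _ (measurable_iterate_kernelOp hg l)]
    rfl

theorem dyadicAverage_sum {f : ℕ → S → ℝ≥0∞} (hf : ∀ i, Measurable (f i)) (s : Finset ℕ)
    (j : ℕ) (x : S) :
    dyadicAverage κ j (fun y => ∑ i ∈ s, f i y) x = ∑ i ∈ s, dyadicAverage κ j (f i) x := by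
  simp only [dyadicAverage, iterate_kernelOp_sum hf, ← Finset.mul_sum]
  rw [Finset.sum_comm]

/-- For each `b < 2^k`, the exponents `a + b` with `a < 2^i` are distinct and below `2^{i+1}`, so
nonnegativity bounds the inner sum by the first `2^{i+1}` iterates. Doubling the length costs the
factor `2`. -/
theorem dyadicAverage_dyadicAverage_le (hg : Measurable g) {i k : ℕ} (hki : k ≤ i) (x : S) :
    dyadicAverage κ i (dyadicAverage κ k g) x ≤ 2 * dyadicAverage κ (i + 1) g x := by
  have hm := measurable_iterate_kernelOp (κ := κ) hg
  have hpow : 2 ^ k ≤ 2 ^ i := Nat.pow_le_pow_right two_pos hki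
  have h1 : ∀ a, (kernelOp κ)^[a] (dyadicAverage κ k g) x =
      (2 ^ k)⁻¹ * ∑ b ∈ Finset.range (2 ^ k), (kernelOp κ)^[a + b] g x := by
    intro a
    unfold dyadicAverage
    rw [iterate_kernelOp_const_mul (Finset.measurable_fun_sum _ fun l _ => hm l),
      iterate_kernelOp_sum hm]
    simp only [Function.iterate_add_apply]
  have h2 : ∀ b ∈ Finset.range (2 ^ k), ∑ a ∈ Finset.range (2 ^ i), (kernelOp κ)^[a + b] g x ≤
      ∑ c ∈ Finset.range (2 ^ (i + 1)), (kernelOp κ)^[c] g x := by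
    intro b hb
    have hb' : b < 2 ^ k := by simpa using hb
    have h3 := Finset.sum_Ico_add' (fun c => (kernelOp κ)^[c] g x) 0 (2 ^ i) b
    rw [← Finset.range_eq_Ico] at h3
    rw [h3]
    refine Finset.sum_le_sum_of_subset fun c hc => ?_
    simp only [Finset.mem_Ico, Finset.mem_range] at hc ⊢
    rw [pow_succ]
    omega
  rw [dyadicAverage]
  simp only [h1]
  rw [← Finset.mul_sum, Finset.sum_comm]
  calc (2 ^ i)⁻¹ * ((2 ^ k)⁻¹ * ∑ b ∈ Finset.range (2 ^ k), ∑ a ∈ Finset.range (2 ^ i),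
        (kernelOp κ)^[a + b] g x)
      ≤ (2 ^ i)⁻¹ * ((2 ^ k)⁻¹ * ∑ b ∈ Finset.range (2 ^ k),
        ∑ c ∈ Finset.range (2 ^ (i + 1)), (kernelOp κ)^[c] g x) := by
        gcongr with b hb
        exact h2 b hb
    _ = (2 ^ i)⁻¹ * ∑ c ∈ Finset.range (2 ^ (i + 1)), (kernelOp κ)^[c] g x := by
        rw [Finset.sum_const, Finset.card_range, nsmul_eq_mul, ← mul_assoc (2 ^ k)⁻¹]
        push_cast
        rw [ENNReal.inv_mul_cancel (by simp) (by simp), one_mul]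
    _ = _ := by
        rw [dyadicAverage, ← mul_assoc, pow_succ (2 : ℝ≥0∞),
          ENNReal.mul_inv (by simp) (by simp), mul_comm _ (2 : ℝ≥0∞)⁻¹, ← mul_assoc 2,
          ENNReal.mul_inv_cancel (by simp) (by simp), one_mul]

/-- The kernel is symmetric with respect to the measure. -/
def SymmetricKernel (κ : Kernel S S) (π : Measure S) : Prop :=
  ∀ u v : S → ℝ≥0∞, Measurable u → Measurable v →
    ∫⁻ x, u x * kernelOp κ v x ∂π = ∫⁻ x, kernelOp κ u x * v x ∂π

theorem SymmetricKernel.iterate (hκ : SymmetricKernel κ π) (hg : Measurable g)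
    (hh : Measurable h) (l : ℕ) :
    ∫⁻ x, g x * (kernelOp κ)^[l] h x ∂π = ∫⁻ x, (kernelOp κ)^[l] g x * h x ∂π := by
  induction l generalizing g with
  | zero => rfl
  | succ l ih =>
    rw [Function.iterate_succ_apply', hκ _ _ hg (measurable_iterate_kernelOp hh l),
      ih (g := kernelOp κ g) (measurable_iterate_kernelOp hg 1)]
    rfl

theorem SymmetricKernel.dyadicAverage (hκ : SymmetricKernel κ π) (hg : Measurable g)
    (hh : Measurable h) (i : ℕ) :
    ∫⁻ x, g x * dyadicAverage κ i h x ∂π = ∫⁻ x, dyadicAverage κ i g x * h x ∂π := by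
  have hmg := measurable_iterate_kernelOp (κ := κ) hg
  have hmh := measurable_iterate_kernelOp (κ := κ) hh
  have e1 : ∀ x, g x * ReversibleChain.dyadicAverage κ i h x =
      (2 ^ i)⁻¹ * ∑ l ∈ Finset.range (2 ^ i), g x * (kernelOp κ)^[l] h x := fun x => by
    rw [ReversibleChain.dyadicAverage, mul_left_comm, Finset.mul_sum]
  have e2 : ∀ x, ReversibleChain.dyadicAverage κ i g x * h x =
      (2 ^ i)⁻¹ * ∑ l ∈ Finset.range (2 ^ i), (kernelOp κ)^[l] g x * h x := fun x => by
    rw [ReversibleChain.dyadicAverage, mul_assoc, Finset.sum_mul]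
  simp only [e1, e2]
  rw [lintegral_const_mul _ (Finset.measurable_fun_sum _ fun l _ => measurable_fun_mul hg (hmh l)),
    lintegral_const_mul _ (Finset.measurable_fun_sum _ fun l _ => measurable_fun_mul (hmg l) hh),
    lintegral_finsetSum _ fun l _ => measurable_fun_mul hg (hmh l),
    lintegral_finsetSum _ fun l _ => measurable_fun_mul (hmg l) hh]
  simp only [hκ.iterate hg hh]

/-- Integrate `2 m g ≤ m² + g²` with `m` the mean, and cancel `m²`. If `m = ∞`, then `g ≤ 1 + g²`
makes the right side infinite. -/
theorem sq_lintegral_le {μ : Measure S} [IsProbabilityMeasure μ] (hg : Measurable g) :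
    (∫⁻ x, g x ∂μ) ^ 2 ≤ ∫⁻ x, g x ^ 2 ∂μ := by
  set m := ∫⁻ x, g x ∂μ
  by_cases hm : m = ∞
  · have h1 : ∀ x, g x ≤ 1 + g x ^ 2 := fun x => by
      rcases le_total (g x) 1 with h | h
      · exact h.trans le_self_add
      · exact (le_self_pow₀ h two_ne_zero).trans le_add_self
    have h2 : m ≤ 1 + ∫⁻ x, g x ^ 2 ∂μ := by
      refine (lintegral_mono h1).trans_eq ?_
      rw [lintegral_add_left measurable_const]
      simp
    rw [hm, top_le_iff, ENNReal.add_eq_top] at h2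
    rw [h2.resolve_left ENNReal.one_ne_top]
    exact le_top
  · have h1 : 2 * (m * m) ≤ m ^ 2 + ∫⁻ x, g x ^ 2 ∂μ := by
      calc 2 * (m * m) = ∫⁻ x, 2 * (m * g x) ∂μ := by
            rw [lintegral_const_mul _ (by fun_prop), lintegral_const_mul _ hg]
        _ ≤ ∫⁻ x, (m ^ 2 + g x ^ 2) ∂μ := lintegral_mono fun x => ennreal_two_mul_le_add_sq _ _
        _ = _ := by rw [lintegral_add_left measurable_const]; simp
    rw [two_mul, ← sq] at h1
    exact (ENNReal.add_le_add_iff_left (ENNReal.pow_ne_top hm)).1 h1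

theorem SymmetricKernel.lintegral_kernelOp [IsMarkovKernel κ] (hκ : SymmetricKernel κ π)
    (hg : Measurable g) : ∫⁻ x, kernelOp κ g x ∂π = ∫⁻ x, g x ∂π := by
  have := hκ (fun _ => 1) g measurable_const hg
  simpa [kernelOp] using this

theorem SymmetricKernel.lintegral_sq_iterate_le [IsMarkovKernel κ] (hκ : SymmetricKernel κ π)
    (hg : Measurable g) (l : ℕ) :
    ∫⁻ x, (kernelOp κ)^[l] g x ^ 2 ∂π ≤ ∫⁻ x, g x ^ 2 ∂π := by
  induction l with
  | zero => rfl
  | succ l ih =>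
    refine le_trans ?_ ih
    have hm := measurable_iterate_kernelOp (κ := κ) hg l
    rw [Function.iterate_succ_apply', ← hκ.lintegral_kernelOp (hm.pow_const 2)]
    exact lintegral_mono fun x => sq_lintegral_le hm

theorem SymmetricKernel.lintegral_mul_dyadicAverage_le [IsMarkovKernel κ]
    (hκ : SymmetricKernel κ π) (hg : Measurable g) (i : ℕ) :
    ∫⁻ x, g x * ReversibleChain.dyadicAverage κ i g x ∂π ≤ ∫⁻ x, g x ^ 2 ∂π := by
  have hm := measurable_iterate_kernelOp (κ := κ) hg
  have h1 : ∀ l, ∫⁻ x, g x * (kernelOp κ)^[l] g x ∂π ≤ ∫⁻ x, g x ^ 2 ∂π := by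
    intro l
    have h2 : 2 * ∫⁻ x, g x * (kernelOp κ)^[l] g x ∂π ≤ 2 * ∫⁻ x, g x ^ 2 ∂π := by
      rw [← lintegral_const_mul _ (measurable_fun_mul hg (hm l)), two_mul (∫⁻ x, g x ^ 2 ∂π)]
      refine (lintegral_mono fun x => ennreal_two_mul_le_add_sq _ _).trans ?_
      rw [lintegral_add_left (hg.pow_const 2)]
      exact add_le_add_right (hκ.lintegral_sq_iterate_le hg l) _
    exact (ENNReal.mul_le_mul_iff_right (by simp) (by simp)).1 h2
  have e1 : ∀ x, g x * ReversibleChain.dyadicAverage κ i g x =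
      (2 ^ i)⁻¹ * ∑ l ∈ Finset.range (2 ^ i), g x * (kernelOp κ)^[l] g x := fun x => by
    rw [ReversibleChain.dyadicAverage, mul_left_comm, Finset.mul_sum]
  simp only [e1]
  rw [lintegral_const_mul _ (Finset.measurable_fun_sum _ fun l _ => measurable_fun_mul hg (hm l)),
    lintegral_finsetSum _ fun l _ => measurable_fun_mul hg (hm l)]
  calc (2 ^ i)⁻¹ * ∑ l ∈ Finset.range (2 ^ i), ∫⁻ x, g x * (kernelOp κ)^[l] g x ∂π
      ≤ (2 ^ i)⁻¹ * ∑ l ∈ Finset.range (2 ^ i), ∫⁻ x, g x ^ 2 ∂π := by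
        exact mul_le_mul_right (Finset.sum_le_sum fun l _ => h1 l) _
    _ = _ := by
        rw [Finset.sum_const, Finset.card_range, nsmul_eq_mul, ← mul_assoc]
        push_cast
        rw [ENNReal.inv_mul_cancel (by simp) (by simp), one_mul]

/-- The `T T*` estimate for linearized dyadic averages. -/
theorem SymmetricKernel.lintegral_sq_sum_dyadicAverage_le (hκ : SymmetricKernel κ π)
    {f : ℕ → S → ℝ≥0∞} (hf : ∀ i, Measurable (f i)) (n : ℕ) {B : S → ℝ≥0∞}
    (hBm : Measurable B) (hB : ∀ i < n, ∀ x, ReversibleChain.dyadicAverage κ (i + 1)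
      (fun y => ∑ k ∈ Finset.range n, f k y) x ≤ B x) :
    ∫⁻ x, (∑ i ∈ Finset.range n, ReversibleChain.dyadicAverage κ i (f i) x) ^ 2 ∂π ≤
      4 * ∫⁻ x, (∑ i ∈ Finset.range n, f i x) * B x ∂π := by
  have hm : ∀ i, Measurable (ReversibleChain.dyadicAverage κ i (f i)) := fun i =>
    measurable_dyadicAverage (hf i) i
  have hmm : ∀ i k, Measurable
      (ReversibleChain.dyadicAverage κ i (ReversibleChain.dyadicAverage κ k (f k))) :=
    fun i k => measurable_dyadicAverage (hm k) i
  calc ∫⁻ x, (∑ i ∈ Finset.range n, ReversibleChain.dyadicAverage κ i (f i) x) ^ 2 ∂π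
      ≤ ∫⁻ x, 2 * ∑ i ∈ Finset.range n, ∑ k ∈ Finset.range (i + 1),
          ReversibleChain.dyadicAverage κ i (f i) x *
            ReversibleChain.dyadicAverage κ k (f k) x ∂π :=
        lintegral_mono fun x => ennreal_sq_sum_le_two_mul _ _
    _ = 2 * ∑ i ∈ Finset.range n, ∑ k ∈ Finset.range (i + 1), ∫⁻ x, f i x *
          ReversibleChain.dyadicAverage κ i (ReversibleChain.dyadicAverage κ k (f k)) x ∂π := by
        rw [lintegral_const_mul _ (Finset.measurable_fun_sum _ fun i _ =>
          Finset.measurable_fun_sum _ fun k _ => measurable_fun_mul (hm i) (hm k)),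
          lintegral_finsetSum _ fun i _ =>
            Finset.measurable_fun_sum _ fun k _ => measurable_fun_mul (hm i) (hm k)]
        congr 1
        refine Finset.sum_congr rfl fun i _ => ?_
        rw [lintegral_finsetSum _ fun k _ => measurable_fun_mul (hm i) (hm k)]
        exact Finset.sum_congr rfl fun k _ => (hκ.dyadicAverage (hf i) (hm k) i).symm
    _ = 2 * ∑ i ∈ Finset.range n, ∫⁻ x, f i x * ∑ k ∈ Finset.range (i + 1),
          ReversibleChain.dyadicAverage κ i (ReversibleChain.dyadicAverage κ k (f k)) x ∂π := by
        congr 1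
        refine Finset.sum_congr rfl fun i _ => ?_
        rw [← lintegral_finsetSum _ fun k _ => measurable_fun_mul (hf i) (hmm i k)]
        simp only [Finset.mul_sum]
    -- Every inner average with `k ≤ i` is replaced by `A_{i+1}`; nonnegativity then allows all `k <
    -- n`, so that `A_{i+1}` acts on the full sum.
    _ ≤ 2 * ∑ i ∈ Finset.range n, ∫⁻ x, f i x * (2 * B x) ∂π := by
        gcongr with i hi x
        have hi' : i < n := by simpa using hi
        calc ∑ k ∈ Finset.range (i + 1),
              ReversibleChain.dyadicAverage κ i (ReversibleChain.dyadicAverage κ k (f k)) x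
            ≤ ∑ k ∈ Finset.range (i + 1), 2 * ReversibleChain.dyadicAverage κ (i + 1) (f k) x :=
              Finset.sum_le_sum fun k hk => dyadicAverage_dyadicAverage_le (hf k)
                (by have := Finset.mem_range.1 hk; omega) x
          _ ≤ ∑ k ∈ Finset.range n, 2 * ReversibleChain.dyadicAverage κ (i + 1) (f k) x :=
              Finset.sum_le_sum_of_subset (Finset.range_mono hi')
          _ = 2 * ReversibleChain.dyadicAverage κ (i + 1)
                (fun y => ∑ k ∈ Finset.range n, f k y) x := by
              rw [dyadicAverage_sum hf, Finset.mul_sum]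
          _ ≤ 2 * B x := by gcongr; exact hB i hi' x
    _ ≤ 4 * ∫⁻ x, (∑ i ∈ Finset.range n, f i x) * B x ∂π := by
        have e : ∀ i, ∫⁻ x, f i x * (2 * B x) ∂π = 2 * ∫⁻ x, f i x * B x ∂π := fun i => by
          rw [← lintegral_const_mul' _ _ (by simp)]
          exact lintegral_congr fun x => mul_left_comm _ _ _
        simp only [e, Finset.sum_mul]
        rw [lintegral_finsetSum _ fun i _ => measurable_fun_mul (hf i) hBm, ← Finset.mul_sum,
          ← mul_assoc]
        norm_num

/-- The maximum of the first `n + 1` dyadic averages. -/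
noncomputable def dyadicMax (κ : Kernel S S) (n : ℕ) (g : S → ℝ≥0∞) (x : S) : ℝ≥0∞ :=
  partialSups (fun i => dyadicAverage κ i g x) n

theorem dyadicMax_succ (n : ℕ) (x : S) :
    dyadicMax κ (n + 1) g x = dyadicMax κ n g x ⊔ dyadicAverage κ (n + 1) g x :=
  partialSups_add_one _ _

theorem measurable_fun_partialSups {a : ℕ → S → ℝ≥0∞} (ha : ∀ i, Measurable (a i)) (n : ℕ) :
    Measurable fun x => partialSups (fun i => a i x) n := by
  induction n with
  | zero => simpa using ha 0
  | succ n ih =>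
    simp only [partialSups_add_one]
    exact ih.sup (ha _)

theorem measurable_dyadicMax (hg : Measurable g) (n : ℕ) : Measurable (dyadicMax κ n g) :=
  measurable_fun_partialSups (fun i => measurable_dyadicAverage hg i) n

/-- A measurable selection of the index at which a finite maximum is attained. -/
theorem exists_linearization {a : ℕ → S → ℝ≥0∞} (ha : ∀ i, Measurable (a i)) (hh : Measurable h)
    (n : ℕ) : ∃ f : ℕ → S → ℝ≥0∞, (∀ i, Measurable (f i)) ∧
      (∀ x, ∑ i ∈ Finset.range (n + 1), f i x = h x) ∧
      ∀ x, ∑ i ∈ Finset.range (n + 1), f i x * a i x =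
        h x * partialSups (fun i => a i x) n := by
  induction n with
  | zero => exact ⟨fun _ => h, fun _ => hh, fun x => by simp, fun x => by simp⟩
  | succ n ih =>
    obtain ⟨f, hf, hsum, hmul⟩ := ih
    have hps := measurable_fun_partialSups ha n
    -- Where the new function attains the maximum, all the mass of `h` moves to the index `n + 1`;
    -- elsewhere the old selection is kept.
    set E : Set S := {x | partialSups (fun i => a i x) n ≤ a (n + 1) x}
    have hE : MeasurableSet E := measurableSet_le hps (ha _)
    refine ⟨fun i => if i = n + 1 then E.indicator h else Eᶜ.indicator (f i), fun i => ?_,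
      fun x => ?_, fun x => ?_⟩
    · dsimp only
      split_ifs
      · exact hh.indicator hE
      · exact (hf i).indicator hE.compl
    · rw [Finset.sum_range_succ, Finset.sum_congr rfl (g := fun i => Eᶜ.indicator (f i) x)
        fun i hi => by simp only [if_neg (Finset.mem_range.1 hi).ne]]
      by_cases hx : x ∈ E
      · simp [hx]
      · simp [hx, hsum]
    · rw [Finset.sum_range_succ,
        Finset.sum_congr rfl (g := fun i => Eᶜ.indicator (f i) x * a i x)
        fun i hi => by simp only [if_neg (Finset.mem_range.1 hi).ne], partialSups_add_one]
      by_cases hx : x ∈ E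
      · simp [hx, sup_eq_right.2 (show partialSups (fun i => a i x) n ≤ a (n + 1) x from hx)]
      · have hx' : a (n + 1) x ≤ partialSups (fun i => a i x) n := (not_le.1 hx).le
        simp [hx, hmul, sup_eq_left.2 hx']

/-- Linearize `h = M_n g`, so that `‖h‖² = ⟨F, g⟩` with `F = ∑ A_i f_i`. The `T T*` estimate gives
`‖F‖² ≤ 4 ⟨h, M_{n+1} h⟩`, and `M_{n+1} h ≤ M_n h + A_{n+1} h`, so the assumed constant applies once
more, to `M_n h`. -/
theorem SymmetricKernel.dyadicMax_bound_improve [IsMarkovKernel κ] (hκ : SymmetricKernel κ π)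
    {n : ℕ} {C : ℝ≥0∞} (hCtop : C ≠ ∞)
    (hC : ∀ g : S → ℝ≥0∞, Measurable g →
      ∫⁻ x, dyadicMax κ n g x ^ 2 ∂π ≤ C * ∫⁻ x, g x ^ 2 ∂π)
    (hg : Measurable g) (hfin : ∫⁻ x, g x ^ 2 ∂π ≠ ∞) :
    3 * ∫⁻ x, dyadicMax κ n g x ^ 2 ∂π ≤ (80 + C) * ∫⁻ x, g x ^ 2 ∂π := by
  set X := ∫⁻ x, g x ^ 2 ∂π
  set h : S → ℝ≥0∞ := dyadicMax κ n g with hdef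
  set Y := ∫⁻ x, h x ^ 2 ∂π
  -- Needed to cancel `c * Y` at the end.
  have hY : Y ≠ ∞ := ((hC g hg).trans_lt (ENNReal.mul_lt_top hCtop.lt_top hfin.lt_top)).ne
  have hh : Measurable h := measurable_dyadicMax hg n
  obtain ⟨f, hf, hsum, hmul⟩ :=
    exists_linearization (fun i => measurable_dyadicAverage (κ := κ) hg i) hh n
  have hsum' : (fun y => ∑ k ∈ Finset.range (n + 1), f k y) = h := funext hsum
  set B : S → ℝ≥0∞ := dyadicMax κ (n + 1) h
  have hB : Measurable B := measurable_dyadicMax hh _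
  set F : S → ℝ≥0∞ := fun x =>
    ∑ i ∈ Finset.range (n + 1), ReversibleChain.dyadicAverage κ i (f i) x
  have hF : Measurable F :=
    Finset.measurable_fun_sum _ fun i _ => measurable_dyadicAverage (hf i) i
  have h1 : ∫⁻ x, F x ^ 2 ∂π ≤ 4 * ∫⁻ x, h x * B x ∂π := by
    have := hκ.lintegral_sq_sum_dyadicAverage_le hf (n + 1) (B := B) hB fun i hi x => by
      rw [hsum']
      exact le_partialSups_of_le (fun i => ReversibleChain.dyadicAverage κ i h x)
        (by omega : i + 1 ≤ n + 1)
    simpa only [hsum] using this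
  -- The splitting `16 h M_n h ≤ 64 h² + (M_n h)²` gives `C` the coefficient `1`; the last average
  -- adds `16` to `64`.
  have h2 : 16 * ∫⁻ x, h x * B x ∂π ≤ (80 + C) * Y := by
    have hpt : ∀ x, 16 * (h x * B x) ≤ 64 * h x ^ 2 + dyadicMax κ n h x ^ 2 +
        16 * (h x * ReversibleChain.dyadicAverage κ (n + 1) h x) := by
      intro x
      have h3 := ennreal_two_mul_le_add_sq (8 * h x) (dyadicMax κ n h x)
      calc 16 * (h x * B x) ≤ 16 * (h x * (dyadicMax κ n h x +
            ReversibleChain.dyadicAverage κ (n + 1) h x)) := by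
            gcongr
            exact (dyadicMax_succ n x).trans_le (sup_le le_self_add le_add_self)
        _ = 2 * (8 * h x * dyadicMax κ n h x) +
            16 * (h x * ReversibleChain.dyadicAverage κ (n + 1) h x) := by ring
        _ ≤ ((8 * h x) ^ 2 + dyadicMax κ n h x ^ 2) +
            16 * (h x * ReversibleChain.dyadicAverage κ (n + 1) h x) := by gcongr
        _ = _ := by ring
    have hm1 : Measurable fun x => 64 * h x ^ 2 := (hh.pow_const 2).const_mul _
    have hm2 : Measurable fun x => dyadicMax κ n h x ^ 2 :=
      (measurable_dyadicMax hh n).pow_const 2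
    have hm3 : Measurable fun x => h x * ReversibleChain.dyadicAverage κ (n + 1) h x :=
      hh.mul (measurable_dyadicAverage hh _)
    calc 16 * ∫⁻ x, h x * B x ∂π = ∫⁻ x, 16 * (h x * B x) ∂π :=
          (lintegral_const_mul _ (hh.mul hB)).symm
      _ ≤ ∫⁻ x, (64 * h x ^ 2 + dyadicMax κ n h x ^ 2 +
        16 * (h x * ReversibleChain.dyadicAverage κ (n + 1) h x)) ∂π := lintegral_mono hpt
      _ = 64 * Y + ∫⁻ x, dyadicMax κ n h x ^ 2 ∂π +
          16 * ∫⁻ x, h x * ReversibleChain.dyadicAverage κ (n + 1) h x ∂π := by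
          rw [lintegral_add_left (by exact hm1.add hm2), lintegral_add_left hm1,
            lintegral_const_mul _ (hh.pow_const 2), lintegral_const_mul _ hm3]
      _ ≤ 64 * Y + C * Y + 16 * Y := by
          gcongr
          · exact hC h hh
          · exact hκ.lintegral_mul_dyadicAverage_le hh (n + 1)
      _ = (80 + C) * Y := by ring
  have h3 : Y = ∫⁻ x, F x * g x ∂π := by
    have e1 : ∀ x, h x ^ 2 = ∑ i ∈ Finset.range (n + 1),
        f i x * ReversibleChain.dyadicAverage κ i g x := fun x => by
      rw [hmul x, sq]; rfl
    have e2 : ∀ x, F x * g x = ∑ i ∈ Finset.range (n + 1),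
        ReversibleChain.dyadicAverage κ i (f i) x * g x := fun x => Finset.sum_mul _ _ _
    simp only [Y, e1, e2]
    rw [lintegral_finsetSum _ fun i _ => measurable_fun_mul (hf i) (measurable_dyadicAverage hg i),
      lintegral_finsetSum _ fun i _ => measurable_fun_mul (measurable_dyadicAverage (hf i) i) hg]
    exact Finset.sum_congr rfl fun i _ => hκ.dyadicAverage (hf i) hg i
  set c := 80 + C with hc
  have hctop : c ≠ ∞ := ENNReal.add_ne_top.2 ⟨by simp, hCtop⟩
  have hc0 : c ≠ 0 := by simp [hc]
  -- The weights in `4 c F g ≤ 4 F² + c² g²` are chosen so that `4 ‖F‖² ≤ c Y` is absorbed on the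
  -- left.
  have h4 : 4 * c * Y ≤ c * Y + c ^ 2 * X := by
    calc 4 * c * Y = ∫⁻ x, 2 * (2 * F x * (c * g x)) ∂π := by
          rw [h3, ← lintegral_const_mul _ (measurable_fun_mul hF hg)]
          exact lintegral_congr fun x => by ring
      _ ≤ ∫⁻ x, (4 * F x ^ 2 + c ^ 2 * g x ^ 2) ∂π := lintegral_mono fun x =>
          (ennreal_two_mul_le_add_sq _ _).trans_eq (by ring)
      _ = 4 * ∫⁻ x, F x ^ 2 ∂π + c ^ 2 * X := by
          rw [lintegral_add_left ((hF.pow_const 2).const_mul _),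
            lintegral_const_mul _ (hF.pow_const 2), lintegral_const_mul _ (hg.pow_const 2)]
      _ ≤ 4 * (4 * ∫⁻ x, h x * B x ∂π) + c ^ 2 * X := by gcongr
      _ = 16 * ∫⁻ x, h x * B x ∂π + c ^ 2 * X := by ring
      _ ≤ _ := by gcongr
  have h5 : c * Y + c * (3 * Y) ≤ c * Y + c * (c * X) := by
    refine le_of_eq_of_le ?_ (h4.trans_eq ?_) <;> ring
  exact (ENNReal.mul_le_mul_iff_right hc0 hctop).1
    ((ENNReal.add_le_add_iff_left (ENNReal.mul_ne_top hctop hY)).1 h5)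

/-- An a priori constant, growing with `n`, from bounding the maximum by the sum; it only starts the
self-improvement. -/
theorem SymmetricKernel.exists_dyadicMax_bound [IsMarkovKernel κ] (hκ : SymmetricKernel κ π)
    (n : ℕ) : ∃ C : ℕ, ∀ g : S → ℝ≥0∞, Measurable g →
      ∫⁻ x, dyadicMax κ n g x ^ 2 ∂π ≤ C * ∫⁻ x, g x ^ 2 ∂π := by
  have hav : ∀ i, ∃ C : ℕ, ∀ g : S → ℝ≥0∞, Measurable g →
      ∫⁻ x, ReversibleChain.dyadicAverage κ i g x ^ 2 ∂π ≤ C * ∫⁻ x, g x ^ 2 ∂π := by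
    intro i
    refine ⟨2 ^ 2 ^ i * 2 ^ i, fun g hg => ?_⟩
    have hm := measurable_iterate_kernelOp (κ := κ) hg
    calc ∫⁻ x, ReversibleChain.dyadicAverage κ i g x ^ 2 ∂π
        ≤ ∫⁻ x, 2 ^ 2 ^ i * ∑ l ∈ Finset.range (2 ^ i), (kernelOp κ)^[l] g x ^ 2 ∂π := by
          refine lintegral_mono fun x => le_trans ?_ (ennreal_sq_sum_le _ _)
          refine pow_le_pow_left' ?_ 2
          exact mul_le_of_le_one_left zero_le (ENNReal.inv_le_one.2 (one_le_pow₀ one_le_two))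
      _ = 2 ^ 2 ^ i * ∑ l ∈ Finset.range (2 ^ i), ∫⁻ x, (kernelOp κ)^[l] g x ^ 2 ∂π := by
          rw [lintegral_const_mul _ (Finset.measurable_fun_sum _ fun l _ => (hm l).pow_const 2),
            lintegral_finsetSum _ fun l _ => (hm l).pow_const 2]
      _ ≤ 2 ^ 2 ^ i * ∑ l ∈ Finset.range (2 ^ i), ∫⁻ x, g x ^ 2 ∂π :=
          mul_le_mul_right (Finset.sum_le_sum fun l _ => hκ.lintegral_sq_iterate_le hg l) _
      _ = _ := by
          rw [Finset.sum_const, Finset.card_range, nsmul_eq_mul, ← mul_assoc]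
          push_cast
          rfl
  induction n with
  | zero => exact hav 0
  | succ n ih =>
    obtain ⟨C, hC⟩ := ih
    obtain ⟨C', hC'⟩ := hav (n + 1)
    refine ⟨C + C', fun g hg => ?_⟩
    have hpt : ∀ x, dyadicMax κ (n + 1) g x ^ 2 ≤ dyadicMax κ n g x ^ 2 +
        ReversibleChain.dyadicAverage κ (n + 1) g x ^ 2 := by
      intro x
      rw [dyadicMax_succ]
      rcases le_total (dyadicMax κ n g x) (ReversibleChain.dyadicAverage κ (n + 1) g x) with h | h
      · rw [sup_eq_right.2 h]; exact le_add_self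
      · rw [sup_eq_left.2 h]; exact le_self_add
    refine (lintegral_mono hpt).trans ?_
    rw [lintegral_add_left ((measurable_dyadicMax hg n).pow_const 2)]
    push_cast
    rw [add_mul]
    exact add_le_add (hC g hg) (hC' g hg)

/-- The maximal inequality for dyadic averages in `L²`. -/
theorem SymmetricKernel.lintegral_sq_dyadicMax_le [IsMarkovKernel κ] (hκ : SymmetricKernel κ π)
    (hg : Measurable g) (n : ℕ) :
    ∫⁻ x, dyadicMax κ n g x ^ 2 ∂π ≤ 42 * ∫⁻ x, g x ^ 2 ∂π := by
  -- The improvement `C ↦ (80 + C) / 3` has fixed point `40`; from `42 + (d + 1)` it gives at most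
  -- `42 + d`, so finitely many steps descend to `42`.
  have key : ∀ d : ℕ, (∀ g : S → ℝ≥0∞, Measurable g →
      ∫⁻ x, dyadicMax κ n g x ^ 2 ∂π ≤ ((42 + d : ℕ) : ℝ≥0∞) * ∫⁻ x, g x ^ 2 ∂π) →
      ∀ g : S → ℝ≥0∞, Measurable g →
      ∫⁻ x, dyadicMax κ n g x ^ 2 ∂π ≤ 42 * ∫⁻ x, g x ^ 2 ∂π := by
    intro d
    induction d with
    | zero => intro h; simpa using h
    | succ d ih =>
      refine fun h => ih fun g hg => ?_
      by_cases hfin : ∫⁻ x, g x ^ 2 ∂π = ∞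
      · rw [hfin, ENNReal.mul_top (by simp)]
        exact le_top
      · have h1 := hκ.dyadicMax_bound_improve (ENNReal.natCast_ne_top _) h hg hfin
        have h2 : (80 + ((42 + (d + 1) : ℕ) : ℝ≥0∞)) ≤ 3 * ((42 + d : ℕ) : ℝ≥0∞) := by
          have : 80 + (42 + (d + 1)) ≤ 3 * (42 + d) := by omega
          exact_mod_cast this
        have h3 := h1.trans (mul_le_mul_left h2 _)
        rw [mul_assoc] at h3
        exact (ENNReal.mul_le_mul_iff_right (by simp) (by simp)).1 h3
  obtain ⟨C, hC⟩ := hκ.exists_dyadicMax_bound n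
  refine key C (fun g hg => (hC g hg).trans ?_) g hg
  gcongr
  exact Nat.le_add_left _ _

theorem SymmetricKernel.lintegral_iSup_sq_dyadicAverage_le [IsMarkovKernel κ]
    (hκ : SymmetricKernel κ π) (hg : Measurable g) :
    ∫⁻ x, ⨆ i, ReversibleChain.dyadicAverage κ i g x ^ 2 ∂π ≤ 42 * ∫⁻ x, g x ^ 2 ∂π := by
  have h1 : ∀ x, ⨆ i, ReversibleChain.dyadicAverage κ i g x ^ 2 ≤
      ⨆ n, dyadicMax κ n g x ^ 2 := fun x => iSup_mono fun i => by
    gcongr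
    exact le_partialSups (fun i => ReversibleChain.dyadicAverage κ i g x) i
  refine (lintegral_mono h1).trans ?_
  rw [lintegral_iSup (fun n => (measurable_dyadicMax hg n).pow_const 2)
    (monotone_nat_of_le_succ fun n x => by
      dsimp only
      gcongr
      exact (partialSups (fun i => ReversibleChain.dyadicAverage κ i g x)).monotone n.le_succ)]
  exact iSup_le fun n => hκ.lintegral_sq_dyadicMax_le hg n

end Averages

/-! ### Elementary estimates for weighted geometric sums -/

section Scalar

theorem sum_inv_sqrt_le (n : ℕ) : ∑ j ∈ Finset.Icc 1 n, 1 / √(j : ℝ) ≤ 2 * √(n : ℝ) := by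
  induction n with
  | zero => simp
  | succ n ih =>
    rw [Finset.sum_Icc_succ_top (by omega)]
    have h1 : 0 < √((n + 1 : ℕ) : ℝ) := Real.sqrt_pos.2 (by positivity)
    have h2 : √((n + 1 : ℕ) : ℝ) ^ 2 = n + 1 := by
      rw [Real.sq_sqrt (by positivity)]; push_cast; ring
    have h3 : √(n : ℝ) ^ 2 = n := Real.sq_sqrt (by positivity)
    have h4 : 1 / √((n + 1 : ℕ) : ℝ) ≤ 2 * √((n + 1 : ℕ) : ℝ) - 2 * √(n : ℝ) := by
      rw [div_le_iff₀ h1]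
      nlinarith [sq_nonneg (√((n + 1 : ℕ) : ℝ) - √(n : ℝ))]
    linarith

variable {b : ℕ → ℝ} {p : ℝ}

/-- The weighted geometric sum `∑_{j = 1}^n b_j p^j`. -/
noncomputable def weightedSum (b : ℕ → ℝ) (n : ℕ) (p : ℝ) : ℝ :=
  ∑ j ∈ Finset.Icc 1 n, b j * p ^ j

theorem weightedSum_mono (hb0 : ∀ j, 0 ≤ b j) (hp0 : 0 ≤ p) {n m : ℕ} (hnm : n ≤ m) :
    weightedSum b n p ≤ weightedSum b m p :=
  Finset.sum_le_sum_of_subset_of_nonneg (Finset.Icc_subset_Icc_right hnm)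
    fun j _ _ => mul_nonneg (hb0 j) (pow_nonneg hp0 j)

theorem weightedSum_nonneg (hb0 : ∀ j, 0 ≤ b j) (hp0 : 0 ≤ p) (n : ℕ) : 0 ≤ weightedSum b n p :=
  Finset.sum_nonneg fun j _ => mul_nonneg (hb0 j) (pow_nonneg hp0 j)

theorem weightedSum_le_sqrt (hb0 : ∀ j, 0 ≤ b j) (hb : ∀ j, b j ≤ 1 / √(j : ℝ)) (hp0 : 0 ≤ p)
    (hp1 : p < 1) (n : ℕ) : weightedSum b n p ≤ 2 * √(n : ℝ) := by
  refine le_trans (Finset.sum_le_sum fun j _ => ?_) (sum_inv_sqrt_le n)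
  exact (mul_le_of_le_one_right (hb0 j) (pow_le_one₀ hp0 hp1.le)).trans (hb j)

/-- Beyond `n` the weights are at most `1 / √n`, and the geometric tail sums to at most `1 / (1 -
p)`. -/
theorem weightedSum_tail_le (hb : ∀ j, b j ≤ 1 / √(j : ℝ)) (hp0 : 0 ≤ p)
    (hp1 : p < 1) {n m : ℕ} (hn : 1 ≤ n) (hnm : n ≤ m) :
    weightedSum b m p - weightedSum b n p ≤ 1 / (√(n : ℝ) * (1 - p)) := by
  have hu : 0 < 1 - p := by linarith
  have hs : 0 < √(n : ℝ) := Real.sqrt_pos.2 (by exact_mod_cast hn)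
  have key : ∀ m, n ≤ m → weightedSum b m p - weightedSum b n p ≤
      (1 / √(n : ℝ)) * ((1 - p ^ (m + 1)) / (1 - p)) := by
    intro m hm
    induction m, hm using Nat.le_induction with
    | base =>
      rw [sub_self]
      have : p ^ (n + 1) ≤ 1 := pow_le_one₀ hp0 hp1.le
      exact mul_nonneg (by positivity) (div_nonneg (by linarith) hu.le)
    | succ m hm ih =>
      have h1 : weightedSum b (m + 1) p = weightedSum b m p + b (m + 1) * p ^ (m + 1) :=
        Finset.sum_Icc_succ_top (by omega) _
      have h2 : b (m + 1) ≤ 1 / √(n : ℝ) := by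
        refine (hb _).trans (one_div_le_one_div_of_le hs (Real.sqrt_le_sqrt ?_))
        exact_mod_cast (by omega : n ≤ m + 1)
      have h3 : b (m + 1) * p ^ (m + 1) ≤ 1 / √(n : ℝ) * p ^ (m + 1) :=
        mul_le_mul_of_nonneg_right h2 (pow_nonneg hp0 _)
      have h4 : (1 - p ^ (m + 1 + 1)) / (1 - p) = (1 - p ^ (m + 1)) / (1 - p) + p ^ (m + 1) := by
        field_simp
        ring
      rw [h1, h4, mul_add]
      linarith
  refine (key m hnm).trans ?_
  rw [← one_div_mul_one_div]
  refine mul_le_mul_of_nonneg_left ?_ (by positivity)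
  refine div_le_div_of_nonneg_right ?_ hu.le
  linarith [pow_nonneg hp0 (m + 1)]

/-- Split at `n = ⌈1 / (1 - p)⌉`: the head is at most `2 √n ≤ 3 / √(1 - p)` and the tail at most `1
/ √(1 - p)`. -/
theorem weightedSum_le (hb0 : ∀ j, 0 ≤ b j) (hb : ∀ j, b j ≤ 1 / √(j : ℝ)) (hp0 : 0 ≤ p)
    (hp1 : p < 1) (m : ℕ) : weightedSum b m p ≤ 4 / √(1 - p) := by
  have hu : 0 < 1 - p := by linarith
  set r := √(1 - p) with hr
  have hr0 : 0 < r := Real.sqrt_pos.2 hu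
  have hr2 : r ^ 2 = 1 - p := Real.sq_sqrt hu.le
  set n := ⌈1 / (1 - p)⌉₊
  have hn1 : 1 / (1 - p) ≤ n := Nat.le_ceil _
  have hn2 : (n : ℝ) < 1 / (1 - p) + 1 := Nat.ceil_lt_add_one (by positivity)
  have hn : 1 ≤ n := Nat.one_le_ceil_iff.2 (by positivity)
  have hone : 1 ≤ 1 / (1 - p) := by rw [le_div_iff₀ hu]; linarith
  have hs1 : 1 / r ≤ √(n : ℝ) := by
    rw [Real.le_sqrt (by positivity) (by positivity), div_pow, one_pow, hr2]
    exact hn1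
  have hs2 : √(n : ℝ) ≤ 3 / 2 * (1 / r) := by
    rw [Real.sqrt_le_left (by positivity), mul_pow, div_pow 1 r, one_pow, hr2]
    nlinarith
  have h1 := weightedSum_le_sqrt hb0 hb hp0 hp1 n
  rcases le_total m n with h | h
  · have h2 := weightedSum_mono hb0 hp0 h
    have h3 : 4 / r = 4 * (1 / r) := by ring
    have : 0 < 1 / r := by positivity
    linarith
  · have h2 := weightedSum_tail_le hb hp0 hp1 hn h
    have h4 : 1 / (√(n : ℝ) * (1 - p)) ≤ 1 / r := by
      refine one_div_le_one_div_of_le hr0 ?_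
      rw [← hr2]
      calc r = 1 / r * r ^ 2 := by field_simp
        _ ≤ _ := by gcongr
    have h3 : 4 / r = 4 * (1 / r) := by ring
    linarith

/-- The average `n⁻¹ ∑_{l < n} p ^ l`. -/
noncomputable def geomAverage (n : ℕ) (p : ℝ) : ℝ := (n : ℝ)⁻¹ * ∑ l ∈ Finset.range n, p ^ l

theorem geomAverage_nonneg (hp0 : 0 ≤ p) (n : ℕ) : 0 ≤ geomAverage n p :=
  mul_nonneg (by positivity) (Finset.sum_nonneg fun l _ => pow_nonneg hp0 l)

theorem geomAverage_le (hp0 : 0 ≤ p) (hp1 : p < 1) {n : ℕ} (hn : 1 ≤ n) :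
    geomAverage n p ≤ 1 / (n * (1 - p)) := by
  have hu : 0 < 1 - p := by linarith
  have hn0 : (0 : ℝ) < n := by exact_mod_cast hn
  rw [geomAverage, ← one_div_mul_one_div, ← one_div]
  refine mul_le_mul_of_nonneg_left ?_ (by positivity)
  rw [le_div_iff₀ hu, mul_comm, one_sub_mul_geom_sum]
  linarith [pow_nonneg hp0 n]

theorem one_sub_geomAverage_le (hp0 : 0 ≤ p) (hp1 : p < 1) {n : ℕ} (hn : 1 ≤ n) :
    1 - geomAverage n p ≤ n * (1 - p) := by
  have hn0 : (0 : ℝ) < n := by exact_mod_cast hn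
  have h1 : ∀ l ∈ Finset.range n, 1 - n * (1 - p) ≤ p ^ l := by
    intro l hl
    have hl' : (l : ℝ) ≤ n := by exact_mod_cast (Finset.mem_range.1 hl).le
    have := one_add_mul_le_pow (a := p - 1) (by linarith) l
    rw [add_sub_cancel] at this
    nlinarith
  have h2 := Finset.sum_le_sum h1
  rw [Finset.sum_const, Finset.card_range, nsmul_eq_mul] at h2
  have h3 : (n : ℝ) * geomAverage n p = ∑ l ∈ Finset.range n, p ^ l := by
    rw [geomAverage, ← mul_assoc, mul_inv_cancel₀ hn0.ne', one_mul]
  rw [← h3] at h2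
  linarith [le_of_mul_le_mul_left h2 hn0]

theorem geomAverage_le_one (hp0 : 0 ≤ p) (hp1 : p < 1) {n : ℕ} (hn : 1 ≤ n) :
    geomAverage n p ≤ 1 := by
  have hn0 : (0 : ℝ) < n := by exact_mod_cast hn
  have h2 := Finset.sum_le_sum (s := Finset.range n) fun l _ => pow_le_one₀ (n := l) hp0 hp1.le
  rw [Finset.sum_const, Finset.card_range, nsmul_eq_mul, mul_one] at h2
  rw [geomAverage, inv_mul_le_iff₀ hn0, mul_one]
  exact h2

theorem one_sub_mul_sq_weightedSum_le (hb0 : ∀ j, 0 ≤ b j) (hb : ∀ j, b j ≤ 1 / √(j : ℝ))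
    (hp0 : 0 ≤ p) (hp1 : p < 1) (m : ℕ) : weightedSum b m p ^ 2 * (1 - p) ≤ 16 := by
  have hu : 0 < 1 - p := by linarith
  have h1 := weightedSum_le hb0 hb hp0 hp1 m
  have h2 := pow_le_pow_left₀ (weightedSum_nonneg hb0 hp0 m) h1 2
  rw [div_pow, Real.sq_sqrt hu.le, le_div_iff₀ hu] at h2
  linarith

/-- This is the multiplier of `D_i`. If `n (1 - p) ≤ 1`, both `A ≤ 2 √n` and `(1 - α) B ≤ 4 √n` are
small. If `n (1 - p) ≥ 1`, the tail `B - A` and the averaged term `α B` are small. Decay on both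
sides of `n (1 - p) = 1` makes the sum over dyadic `n` converge uniformly in `p`. -/
theorem one_sub_mul_sq_difference_le (hb0 : ∀ j, 0 ≤ b j) (hb : ∀ j, b j ≤ 1 / √(j : ℝ))
    (hp0 : 0 ≤ p) (hp1 : p < 1) {n m : ℕ} (hn : 1 ≤ n) (hnm : n ≤ m) :
    (weightedSum b n p - weightedSum b m p + geomAverage n p * weightedSum b m p) ^ 2 * (1 - p) ≤
      36 * min (n * (1 - p)) (1 / (n * (1 - p))) := by
  have hu : 0 < 1 - p := by linarith
  have hn0 : (0 : ℝ) < n := by exact_mod_cast hn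
  set r := √(1 - p) with hr
  have hr0 : 0 < r := Real.sqrt_pos.2 hu
  have hr2 : r ^ 2 = 1 - p := Real.sq_sqrt hu.le
  set s := √(n : ℝ) with hs
  have hs0 : 0 < s := Real.sqrt_pos.2 hn0
  have hs2 : s ^ 2 = n := Real.sq_sqrt hn0.le
  set A := weightedSum b n p
  set B := weightedSum b m p
  set α := geomAverage n p
  have hA0 : 0 ≤ A := weightedSum_nonneg hb0 hp0 n
  have hB0 : 0 ≤ B := weightedSum_nonneg hb0 hp0 m
  have hAB : A ≤ B := weightedSum_mono hb0 hp0 hnm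
  have hA : A ≤ 2 * s := weightedSum_le_sqrt hb0 hb hp0 hp1 n
  have hB : B ≤ 4 / r := weightedSum_le hb0 hb hp0 hp1 m
  have hT : B - A ≤ 1 / (s * r ^ 2) := by
    rw [hr2]; exact weightedSum_tail_le hb hp0 hp1 hn hnm
  have hα0 : 0 ≤ α := geomAverage_nonneg hp0 n
  have hα1 : α ≤ 1 := geomAverage_le_one hp0 hp1 hn
  have hα : α ≤ 1 / (s ^ 2 * r ^ 2) := by
    rw [hs2, hr2]; exact geomAverage_le hp0 hp1 hn
  have hα' : 1 - α ≤ s ^ 2 * r ^ 2 := by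
    rw [hs2, hr2]; exact one_sub_geomAverage_le hp0 hp1 hn
  rw [← hr2, ← hs2]
  have hx0 : 0 < s * r := by positivity
  have hsr : s ^ 2 * r ^ 2 = (s * r) ^ 2 := by ring
  have habs : (A - B + α * B) ^ 2 * r ^ 2 = (|A - B + α * B| * r) ^ 2 := by
    rw [mul_pow, sq_abs]
  rw [habs, hsr]
  rcases le_total (s * r) 1 with h | h
  · have hmin : min ((s * r) ^ 2) (1 / (s * r) ^ 2) = (s * r) ^ 2 := by
      refine min_eq_left (le_trans (pow_le_one₀ hx0.le h) ?_)
      rw [le_div_iff₀ (by positivity), one_mul]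
      exact pow_le_one₀ hx0.le h
    rw [hmin]
    have h1 : (1 - α) * B ≤ 4 * s := by
      calc (1 - α) * B ≤ (s ^ 2 * r ^ 2) * (4 / r) :=
            mul_le_mul hα' hB hB0 (by positivity)
        _ = 4 * s * (s * r) := by field_simp
        _ ≤ 4 * s * 1 := by gcongr
        _ = _ := mul_one _
    have h2 : 0 ≤ (1 - α) * B := mul_nonneg (by linarith) hB0
    have h3 : |A - B + α * B| ≤ 6 * s := by
      rw [abs_le]
      constructor <;> linarith
    calc (|A - B + α * B| * r) ^ 2 ≤ (6 * s * r) ^ 2 := by gcongr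
      _ = _ := by ring
  · have hmin : min ((s * r) ^ 2) (1 / (s * r) ^ 2) = 1 / (s * r) ^ 2 := by
      refine min_eq_right (le_trans ?_ (one_le_pow₀ h))
      rw [div_le_iff₀ (by positivity), one_mul]
      exact one_le_pow₀ h
    rw [hmin]
    have h1 : α * B * r ≤ 4 / (s * r) := by
      calc α * B * r ≤ 1 / (s ^ 2 * r ^ 2) * (4 / r) * r := by gcongr
        _ = 4 / (s * r) * (1 / (s * r)) := by field_simp
        _ ≤ 4 / (s * r) * 1 := by
            refine mul_le_mul_of_nonneg_left ?_ (by positivity)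
            rw [div_le_iff₀ hx0]; linarith
        _ = _ := mul_one _
    have h2 : (B - A) * r ≤ 1 / (s * r) := by
      calc (B - A) * r ≤ 1 / (s * r ^ 2) * r := by gcongr
        _ = _ := by field_simp
    have h3 : |A - B + α * B| ≤ (B - A) + α * B := by
      rw [abs_le]
      constructor <;> nlinarith [mul_nonneg hα0 hB0]
    have h4 : |A - B + α * B| * r ≤ 6 / (s * r) := by
      calc |A - B + α * B| * r ≤ ((B - A) + α * B) * r := by gcongr
        _ = (B - A) * r + α * B * r := by ring
        _ ≤ 1 / (s * r) + 4 / (s * r) := add_le_add h2 h1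
        _ ≤ _ := by
          rw [← add_div]
          exact div_le_div_of_nonneg_right (by norm_num) hx0.le
    calc (|A - B + α * B| * r) ^ 2 ≤ (6 / (s * r)) ^ 2 := by gcongr
      _ = _ := by rw [div_pow]; ring

/-- Each term is at most `6 (ψ(2x) - ψ(x))` with `ψ(x) = x / (1 + x)`, with equality at `x = 1`; the
sum telescopes and `ψ ≤ 1`. -/
theorem sum_min_dyadic_le {u : ℝ} (hu : 0 < u) (n : ℕ) :
    ∑ i ∈ Finset.range n, min ((2 : ℝ) ^ i * u) (1 / (2 ^ i * u)) ≤ 6 := by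
  have hstep : ∀ x : ℝ, 0 < x → min x (1 / x) ≤ 6 * (2 * x / (1 + 2 * x) - x / (1 + x)) := by
    intro x hx
    have h1 : 2 * x / (1 + 2 * x) - x / (1 + x) = x / ((1 + x) * (1 + 2 * x)) := by
      field_simp
      ring
    rw [h1]
    rcases le_total x 1 with h | h
    · refine (min_le_left _ _).trans ?_
      rw [← mul_div_assoc, le_div_iff₀ (by positivity)]
      nlinarith [mul_nonneg hx.le hx.le, mul_nonneg hx.le (sub_nonneg.2 h)]
    · refine (min_le_right _ _).trans ?_
      rw [← mul_div_assoc, div_le_div_iff₀ hx (by positivity)]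
      nlinarith
  have htel : ∀ n : ℕ, ∑ i ∈ Finset.range n, min ((2 : ℝ) ^ i * u) (1 / (2 ^ i * u)) ≤
      6 * (2 ^ n * u / (1 + 2 ^ n * u) - u / (1 + u)) := by
    intro n
    induction n with
    | zero => simp
    | succ n ih =>
      rw [Finset.sum_range_succ]
      have := hstep (2 ^ n * u) (by positivity)
      rw [← mul_assoc, ← pow_succ'] at this
      linarith
  refine (htel n).trans ?_
  have h1 : 2 ^ n * u / (1 + 2 ^ n * u) ≤ 1 := by
    rw [div_le_one (by positivity)]; linarith
  have h2 : 0 ≤ u / (1 + u) := by positivity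
  linarith

theorem sum_sq_difference_dyadic_le (hb0 : ∀ j, 0 ≤ b j) (hb : ∀ j, b j ≤ 1 / √(j : ℝ))
    (hp0 : 0 ≤ p) (hp1 : p < 1) (m : ℕ) :
    (∑ i ∈ Finset.range (m + 1), (weightedSum b (2 ^ i) p - weightedSum b (2 ^ m) p +
      geomAverage (2 ^ i) p * weightedSum b (2 ^ m) p) ^ 2) * (1 - p) ≤ 216 := by
  rw [Finset.sum_mul]
  have h1 : ∀ i ∈ Finset.range (m + 1), (weightedSum b (2 ^ i) p - weightedSum b (2 ^ m) p +
      geomAverage (2 ^ i) p * weightedSum b (2 ^ m) p) ^ 2 * (1 - p) ≤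
      36 * min ((2 : ℝ) ^ i * (1 - p)) (1 / (2 ^ i * (1 - p))) := by
    intro i hi
    have := one_sub_mul_sq_difference_le hb0 hb hp0 hp1 (n := 2 ^ i) (m := 2 ^ m)
      Nat.one_le_two_pow (Nat.pow_le_pow_right two_pos
        (by have := Finset.mem_range.1 hi; omega))
    exact_mod_cast this
  refine (Finset.sum_le_sum h1).trans ?_
  rw [← Finset.mul_sum]
  have := sum_min_dyadic_le (show 0 < 1 - p by linarith) (m + 1)
  linarith

theorem one_sub_mul_sum_sq_pow_le (hp0 : 0 ≤ p) (hp1 : p < 1) (n : ℕ) :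
    (∑ j ∈ Finset.range n, (p ^ j) ^ 2) * (1 - p) ≤ 1 := by
  have h1 : ∑ j ∈ Finset.range n, (p ^ j) ^ 2 ≤ ∑ j ∈ Finset.range n, p ^ j :=
    Finset.sum_le_sum fun j _ => by
      have h0 := pow_nonneg hp0 j
      have h2 : p ^ j ≤ 1 := pow_le_one₀ hp0 hp1.le
      nlinarith
  have h2 := one_sub_mul_geom_sum p n
  have h3 := pow_nonneg hp0 n
  nlinarith

/-- Since `1 - t² = (1 - t)(1 + t)`, one factor `1 + t` cancels the singularity at `-1` and the
other is at most `2`. The point `t = -1`, where nothing is assumed about `X 1`, is covered by the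
vanishing prefactor. -/
theorem one_add_sq_mul_le {X : ℝ → ℝ} {C : ℝ} (hC : 0 ≤ C)
    (hX : ∀ p, 0 ≤ p → p < 1 → X p * (1 - p) ≤ C) {t : ℝ} (ht : t ∈ Set.Icc (-1 : ℝ) 1)
    (ht1 : t < 1) : (1 + t) ^ 2 * X (t ^ 2) ≤ 2 * C * (1 / (1 - t)) := by
  have hu : 0 < 1 - t := by linarith
  rw [mul_one_div, le_div_iff₀ hu]
  rcases ht.1.eq_or_lt with rfl | h
  · norm_num
    exact hC
  · have h1 := hX (t ^ 2) (sq_nonneg t) (by nlinarith)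
    nlinarith

end Scalar

/-! ### Second moments of maximal functions -/

section MaxSq

variable {S : Type*} [MeasurableSpace S] {π : Measure S}

theorem measurable_enorm_Lp (w : Lp ℂ 2 π) : Measurable fun x => ‖w x‖ₑ :=
  (Lp.stronglyMeasurable w).measurable.enorm

theorem lintegral_enorm_sq (w : Lp ℂ 2 π) : ∫⁻ x, ‖w x‖ₑ ^ 2 ∂π = ‖w‖ₑ ^ 2 := by
  have h := eLpNorm_nnreal_pow_eq_lintegral (p := 2) (f := (w : S → ℂ)) (μ := π) (by norm_num)
  rw [Lp.enorm_def]
  simpa using h.symm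

/-- The second moment of the maximal function of a sequence in `L²(π)`. -/
noncomputable def maxSq (z : ℕ → Lp ℂ 2 π) : ℝ≥0∞ := ∫⁻ x, ⨆ k, ‖z k x‖ₑ ^ 2 ∂π

theorem measurable_iSup_enorm_sq (z : ℕ → Lp ℂ 2 π) : Measurable fun x => ⨆ k, ‖z k x‖ₑ ^ 2 :=
  Measurable.iSup fun k => (measurable_enorm_Lp (z k)).pow_const 2

theorem maxSq_mono {z z' : ℕ → Lp ℂ 2 π} (h : ∀ᵐ x ∂π, ∀ k, ∃ l, ‖z k x‖ₑ ≤ ‖z' l x‖ₑ) :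
    maxSq z ≤ maxSq z' := by
  refine lintegral_mono_ae ?_
  filter_upwards [h] with x hx
  refine iSup_le fun k => ?_
  obtain ⟨l, hl⟩ := hx k
  exact le_iSup_of_le l (pow_le_pow_left' hl 2)

theorem maxSq_le_two_mul_add {z u w : ℕ → Lp ℂ 2 π}
    (h : ∀ᵐ x ∂π, ∀ k, ∃ l l', ‖z k x‖ₑ ≤ ‖u l x‖ₑ + ‖w l' x‖ₑ) :
    maxSq z ≤ 2 * maxSq u + 2 * maxSq w := by
  calc maxSq z ≤ ∫⁻ x, (2 * ⨆ k, ‖u k x‖ₑ ^ 2) + 2 * ⨆ k, ‖w k x‖ₑ ^ 2 ∂π := by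
        refine lintegral_mono_ae ?_
        filter_upwards [h] with x hx
        refine iSup_le fun k => ?_
        obtain ⟨l, l', hl⟩ := hx k
        refine (pow_le_pow_left' hl 2).trans ((ennreal_add_sq_le _ _).trans ?_)
        gcongr
        · exact le_iSup (fun k => ‖u k x‖ₑ ^ 2) l
        · exact le_iSup (fun k => ‖w k x‖ₑ ^ 2) l'
    _ = _ := by
        rw [lintegral_add_left ((measurable_iSup_enorm_sq u).const_mul 2),
          lintegral_const_mul _ (measurable_iSup_enorm_sq u),
          lintegral_const_mul _ (measurable_iSup_enorm_sq w)]
        rfl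

theorem maxSq_add_le (u w : ℕ → Lp ℂ 2 π) :
    maxSq (fun k => u k + w k) ≤ 2 * maxSq u + 2 * maxSq w := by
  refine maxSq_le_two_mul_add ?_
  filter_upwards [ae_all_iff.2 fun k => Lp.coeFn_add (u k) (w k)] with x hx k
  refine ⟨k, k, ?_⟩
  rw [hx k]
  exact enorm_add_le _ _

theorem maxSq_sub_le (u w : ℕ → Lp ℂ 2 π) :
    maxSq (fun k => u k - w k) ≤ 2 * maxSq u + 2 * maxSq w := by
  refine maxSq_le_two_mul_add ?_
  filter_upwards [ae_all_iff.2 fun k => Lp.coeFn_sub (u k) (w k)] with x hx k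
  refine ⟨k, k, ?_⟩
  rw [hx k]
  exact enorm_sub_le

theorem maxSq_const (w : Lp ℂ 2 π) : maxSq (fun _ => w) = ‖w‖ₑ ^ 2 := by
  rw [← lintegral_enorm_sq]
  simp [maxSq]

theorem maxSq_truncation_le_sum (z : ℕ → Lp ℂ 2 π) (n : ℕ) :
    maxSq (fun k => z (min k n)) ≤ ∑ k ∈ Finset.range (n + 1), ‖z k‖ₑ ^ 2 := by
  calc maxSq (fun k => z (min k n)) ≤ ∫⁻ x, ∑ k ∈ Finset.range (n + 1), ‖z k x‖ₑ ^ 2 ∂π :=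
        lintegral_mono fun x => iSup_le fun k =>
          Finset.single_le_sum (f := fun k => ‖z k x‖ₑ ^ 2) (fun _ _ => zero_le)
            (Finset.mem_range.2 (Nat.lt_succ_of_le (min_le_right k n)))
    _ = _ := by
        rw [lintegral_finsetSum _ fun k _ => (measurable_enorm_Lp (z k)).pow_const 2]
        simp only [lintegral_enorm_sq]

/-- Monotone convergence for the maximal function. -/
theorem maxSq_le_of_forall_truncation {z : ℕ → Lp ℂ 2 π} {C : ℝ≥0∞}
    (h : ∀ n, maxSq (fun k => z (min k n)) ≤ C) : maxSq z ≤ C := by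
  have hsup : ∀ x, ⨆ k, ‖z k x‖ₑ ^ 2 ≤ ⨆ n, ⨆ k, ‖z (min k n) x‖ₑ ^ 2 := fun x =>
    iSup_le fun k => le_iSup_of_le k (le_iSup_of_le k (by rw [min_self]))
  refine (lintegral_mono hsup).trans ?_
  rw [lintegral_iSup (fun n => measurable_iSup_enorm_sq _)
    (monotone_nat_of_le_succ fun n x => iSup_le fun k => le_iSup_of_le (min k n) ?_)]
  · exact iSup_le h
  · rw [min_eq_left ((min_le_right k n).trans n.le_succ)]

/-- Bounded variation in `L²` suffices: pointwise the sequence is dominated by its first term plus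
its total variation, whose norm Minkowski's inequality and monotone convergence control. -/
theorem maxSq_lt_top_of_sum_norm_sub_le {z : ℕ → Lp ℂ 2 π} {C : ℝ}
    (h : ∀ n, ∑ k ∈ Finset.range n, ‖z (k + 1) - z k‖ ≤ C) : maxSq z < ∞ := by
  set G : ℕ → S → ℝ≥0∞ := fun n x =>
    ‖z 0 x‖ₑ + ∑ k ∈ Finset.range n, ‖(z (k + 1) - z k : Lp ℂ 2 π) x‖ₑ
  have hGm : ∀ n, Measurable (G n) := fun n => (measurable_enorm_Lp _).add
    (Finset.measurable_fun_sum _ fun k _ => measurable_enorm_Lp _)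
  have hGmono : Monotone G := monotone_nat_of_le_succ fun n x => by
    simp only [G, Finset.sum_range_succ, ← add_assoc]
    exact le_self_add
  have hpt : ∀ᵐ x ∂π, ∀ n, ‖z n x‖ₑ ≤ G n x := by
    filter_upwards [ae_all_iff.2 fun k => Lp.coeFn_sub (z (k + 1)) (z k)] with x hx n
    induction n with
    | zero => simp [G]
    | succ n ih =>
      have h1 : z (n + 1) x = z n x + (z (n + 1) - z n : Lp ℂ 2 π) x := by
        rw [hx n, Pi.sub_apply, add_sub_cancel]
      rw [h1]
      refine (enorm_add_le _ _).trans ?_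
      simp only [G, Finset.sum_range_succ, ← add_assoc]
      gcongr
  have hroot : ∀ w : Lp ℂ 2 π, (∫⁻ x, ‖w x‖ₑ ^ (2 : ℝ) ∂π) ^ (1 / 2 : ℝ) = ‖w‖ₑ := by
    intro w
    have := lintegral_enorm_sq w
    simp only [← ENNReal.rpow_two] at this
    rw [this, ← ENNReal.rpow_mul]
    norm_num
  have hG : ∀ n, (∫⁻ x, G n x ^ (2 : ℝ) ∂π) ^ (1 / 2 : ℝ) ≤
      ‖z 0‖ₑ + ∑ k ∈ Finset.range n, ‖z (k + 1) - z k‖ₑ := by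
    intro n
    induction n with
    | zero => simpa only [G, Finset.range_zero, Finset.sum_empty, add_zero] using (hroot (z 0)).le
    | succ n ih =>
      have h1 : G (n + 1) = G n + fun x => ‖(z (n + 1) - z n : Lp ℂ 2 π) x‖ₑ := by
        ext x
        simp only [G, Finset.sum_range_succ, ← add_assoc, Pi.add_apply]
      rw [h1, Finset.sum_range_succ, ← add_assoc]
      refine (ENNReal.lintegral_Lp_add_le (hGm n).aemeasurable
        (measurable_enorm_Lp _).aemeasurable one_le_two).trans ?_
      rw [hroot]
      gcongr
  have hbound : ∀ n, ∫⁻ x, G n x ^ 2 ∂π ≤ (‖z 0‖ₑ + ENNReal.ofReal C) ^ 2 := by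
    intro n
    have h1 : ∑ k ∈ Finset.range n, ‖z (k + 1) - z k‖ₑ ≤ ENNReal.ofReal C := by
      simp only [← ofReal_norm]
      rw [← ENNReal.ofReal_sum_of_nonneg fun _ _ => norm_nonneg _]
      exact ENNReal.ofReal_le_ofReal (h n)
    have h2 := (hG n).trans (add_le_add_right h1 _)
    have h3 := ENNReal.rpow_le_rpow h2 (show (0 : ℝ) ≤ 2 by norm_num)
    rw [← ENNReal.rpow_mul] at h3
    norm_num at h3
    exact h3
  have htop : (‖z 0‖ₑ + ENNReal.ofReal C) ^ 2 < ∞ :=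
    ENNReal.pow_lt_top (ENNReal.add_lt_top.2 ⟨enorm_lt_top, ENNReal.ofReal_lt_top⟩)
  refine lt_of_le_of_lt ?_ htop
  calc maxSq z ≤ ∫⁻ x, ⨆ n, G n x ^ 2 ∂π := by
        refine lintegral_mono_ae ?_
        filter_upwards [hpt] with x hx
        exact iSup_mono fun n => pow_le_pow_left' (hx n) 2
    _ ≤ _ := by
        rw [lintegral_iSup (fun n => (hGm n).pow_const 2)
          fun n m hnm x => pow_le_pow_left' (hGmono hnm x) 2]
        exact iSup_le hbound

end MaxSq

/-! ### Domination of the operator on `L²(π)` by the kernel -/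

section Domination

variable {S : Type*} [MeasurableSpace S] {Q : Kernel S S} [IsMarkovKernel Q] {π : Measure S}

theorem symmetricKernel_of_map_swap [SFinite π] (hrev : (π ⊗ₘ Q).map Prod.swap = π ⊗ₘ Q) :
    SymmetricKernel Q π := fun _ _ hu hv => lintegral_mul_lintegral_comm hrev hu hv

theorem kernelOp_comp {g : S → ℝ≥0∞} (hg : Measurable g) :
    kernelOp (Q ∘ₖ Q) g = kernelOp Q (kernelOp Q g) := by
  ext x
  exact Kernel.lintegral_comp _ _ _ hg

theorem SymmetricKernel.comp_self (hQ : SymmetricKernel Q π) : SymmetricKernel (Q ∘ₖ Q) π := by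
  intro u v hu hv
  rw [kernelOp_comp hu, kernelOp_comp hv, hQ u (kernelOp Q v) hu hv.lintegral_kernel,
    hQ (kernelOp Q u) v hu.lintegral_kernel hv]

theorem kernelOp_mono_ae (h : Q.Invariant π) {g g' : S → ℝ≥0∞} (hg : ∀ᵐ x ∂π, g x ≤ g' x) :
    ∀ᵐ x ∂π, kernelOp Q g x ≤ kernelOp Q g' x := by
  filter_upwards [ae_ae_of_invariant h hg] with x hx using lintegral_mono_ae hx

theorem enorm_transitionL2_le (h : Q.Invariant π) (w : Lp ℂ 2 π) :
    ∀ᵐ x ∂π, ‖transitionL2 h w x‖ₑ ≤ kernelOp Q (fun y => ‖w y‖ₑ) x := by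
  have h1 : (transitionL2 h w : S → ℂ) =ᵐ[π] transition Q w :=
    MemLp.coeFn_toLp (memLp_transition h w)
  filter_upwards [h1] with x hx
  rw [hx]
  exact enorm_integral_le_lintegral_enorm _

theorem enorm_sq_pow_transitionL2_le (h : Q.Invariant π) (w : Lp ℂ 2 π) (l : ℕ) :
    ∀ᵐ x ∂π, ‖((transitionL2 h ^ 2) ^ l) w x‖ₑ ≤
      (kernelOp (Q ∘ₖ Q))^[l] (fun y => ‖w y‖ₑ) x := by
  induction l with
  | zero => exact Eventually.of_forall fun x => le_rfl
  | succ l ih =>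
    have hm := measurable_iterate_kernelOp (κ := Q ∘ₖ Q) (measurable_enorm_Lp w) l
    rw [pow_succ', mul_apply_eq_comp, sq, mul_apply_eq_comp, Function.iterate_succ_apply',
      kernelOp_comp hm]
    set u := ((transitionL2 h ^ 2) ^ l) w with hu
    rw [← sq, ← hu]
    filter_upwards [enorm_transitionL2_le h (transitionL2 h u),
      kernelOp_mono_ae h (enorm_transitionL2_le h u),
      kernelOp_mono_ae h (kernelOp_mono_ae h ih)] with x h1 h2 h3
    exact h1.trans (h2.trans h3)

theorem ae_coeFn_sum (s : Finset ℕ) (u : ℕ → Lp ℂ 2 π) :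
    ∀ᵐ x ∂π, (∑ i ∈ s, u i : Lp ℂ 2 π) x = ∑ i ∈ s, u i x := by
  induction s using Finset.induction_on with
  | empty =>
    filter_upwards [Lp.coeFn_zero ℂ 2 π] with x hx
    simpa using hx
  | insert a s ha ih =>
    rw [Finset.sum_insert ha]
    filter_upwards [ih, Lp.coeFn_add (u a) (∑ i ∈ s, u i)] with x h1 h2
    rw [h2, Pi.add_apply, h1, Finset.sum_insert ha]

/-- The maximal inequality for the dyadic averages of `Q²`. -/
theorem maxSq_average_le [SFinite π] (h : Q.Invariant π)
    (hrev : (π ⊗ₘ Q).map Prod.swap = π ⊗ₘ Q) (w : Lp ℂ 2 π) :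
    maxSq (fun i => ((2 : ℝ) ^ i)⁻¹ • ∑ l ∈ Finset.range (2 ^ i), ((transitionL2 h ^ 2) ^ l) w) ≤
      42 * ‖w‖ₑ ^ 2 := by
  have hκ := (symmetricKernel_of_map_swap hrev).comp_self
  rw [← lintegral_enorm_sq]
  refine le_trans (lintegral_mono_ae ?_)
    (hκ.lintegral_iSup_sq_dyadicAverage_le (measurable_enorm_Lp w))
  filter_upwards [ae_all_iff.2 fun l => enorm_sq_pow_transitionL2_le h w l,
    ae_all_iff.2 fun i : ℕ => ae_coeFn_sum (Finset.range (2 ^ i))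
      fun l => ((transitionL2 h ^ 2) ^ l) w,
    ae_all_iff.2 fun i : ℕ => Lp.coeFn_smul (((2 : ℝ) ^ i)⁻¹)
      (∑ l ∈ Finset.range (2 ^ i), ((transitionL2 h ^ 2) ^ l) w)] with x h1 h2 h3
  refine iSup_mono fun i => pow_le_pow_left' ?_ 2
  rw [h3 i, Pi.smul_apply, h2 i, enorm_smul, dyadicAverage]
  have h4 : ‖((2 : ℝ) ^ i)⁻¹‖ₑ = (2 ^ i)⁻¹ := by
    rw [Real.enorm_of_nonneg (by positivity), ENNReal.ofReal_inv_of_pos (by positivity),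
      ENNReal.ofReal_pow (by norm_num)]
    simp
  rw [h4]
  gcongr
  exact (enorm_sum_le _ _).trans (Finset.sum_le_sum fun l _ => h1 l)

end Domination

/-! ### Spectral bounds for polynomials of the operator -/

section PolynomialBounds

variable {H : Type*} [NormedAddCommGroup H] [InnerProductSpace ℂ H] [CompleteSpace H]
  {T : H →L[ℂ] H} {v : H}

open Polynomial in
theorem norm_sq_aeval (hsa : IsSelfAdjoint T) (hT : ‖T‖ ≤ 1) (v : H) (q : ℝ[X]) :
    ‖aeval T q v‖ ^ 2 =
      ∫ t in Set.Icc (-1 : ℝ) 1, q.eval t ^ 2 ∂(spectralMeasure T v) := by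
  rw [setIntegral_sq_spectralMeasure (φ := fun t => q.eval t) hT v q.continuous,
    cfc_polynomial q T]

open Polynomial in
-- The passage from scalars to operators: a pointwise bound of squared multipliers by `K / (1 - t)`
-- becomes a square function bound. The point `t = 1` is null by `hI`.
theorem sum_enorm_sq_aeval_le (hsa : IsSelfAdjoint T) (hT : ‖T‖ ≤ 1)
    (hI : ∫⁻ t in Set.Icc (-1 : ℝ) 1, (ENNReal.ofReal (1 - t))⁻¹ ∂(spectralMeasure T v) < ∞)
    (s : Finset ℕ) (q : ℕ → ℝ[X]) (K : ℝ)
    (hq : ∀ t ∈ Set.Icc (-1 : ℝ) 1, t < 1 → ∑ i ∈ s, (q i).eval t ^ 2 ≤ K * (1 / (1 - t))) :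
    ∑ i ∈ s, ‖aeval T (q i) v‖ₑ ^ 2 ≤ ENNReal.ofReal
      (K * ∫ t in Set.Icc (-1 : ℝ) 1, 1 / (1 - t) ∂(spectralMeasure T v)) := by
  have h1 : ∑ i ∈ s, ‖aeval T (q i) v‖ₑ ^ 2 =
      ENNReal.ofReal (∑ i ∈ s, ‖aeval T (q i) v‖ ^ 2) := by
    rw [ENNReal.ofReal_sum_of_nonneg fun _ _ => sq_nonneg _]
    exact Finset.sum_congr rfl fun i _ => by
      rw [ENNReal.ofReal_pow (norm_nonneg _), ofReal_norm]
  rw [h1]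
  refine ENNReal.ofReal_le_ofReal ?_
  simp only [norm_sq_aeval hsa hT]
  have hi : ∀ i ∈ s, Integrable (fun t => (q i).eval t ^ 2)
      ((spectralMeasure T v).restrict (Set.Icc (-1 : ℝ) 1)) := fun i _ =>
    integrableOn_spectralMeasure v ((q i).continuous.pow 2)
  rw [← integral_finsetSum _ hi, ← integral_const_mul]
  refine integral_mono_ae (integrable_finsetSum _ hi) ((integrable_inv_one_sub hI).const_mul K) ?_
  filter_upwards [ae_restrict_mem measurableSet_Icc, ae_lt_one hI] with t ht ht1 using hq t ht ht1

open Polynomial in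
theorem norm_aeval_le (hsa : IsSelfAdjoint T) (hT : ‖T‖ ≤ 1) (v : H) (q : ℝ[X]) {C : ℝ}
    (hC : 0 ≤ C) (hq : ∀ t ∈ Set.Icc (-1 : ℝ) 1, |q.eval t| ≤ C) :
    ‖aeval T q v‖ ≤ C * ‖v‖ := by
  refine (pow_le_pow_iff_left₀ (norm_nonneg _) (by positivity) two_ne_zero).1 ?_
  have h1 := norm_sq_aeval hsa hT v 1
  simp only [map_one, one_apply_eq_self, eval_one] at h1
  rw [mul_pow, h1, norm_sq_aeval hsa hT, ← integral_const_mul]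
  refine integral_mono_ae (integrableOn_spectralMeasure v (q.continuous.pow 2))
    (integrable_const _) ?_
  filter_upwards [ae_restrict_mem measurableSet_Icc] with t ht
  simp only [one_pow, mul_one]
  exact sq_le_sq' (abs_le.1 (hq t ht)).1 (abs_le.1 (hq t ht)).2

theorem norm_pow_apply_le (hT : ‖T‖ ≤ 1) (k : ℕ) (v : H) : ‖(T ^ k) v‖ ≤ ‖v‖ := by
  induction k with
  | zero => exact le_rfl
  | succ k ih =>
    rw [pow_succ', mul_apply_eq_comp]
    exact ((T.le_of_opNorm_le hT _).trans_eq (one_mul _)).trans ih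

open Polynomial in
-- With `s = t²`, `(m + 1) s^m (1 - s) ≤ (1 - s) ∑_{l ≤ m} s^l ≤ 1`.
theorem norm_pow_sub_pow_le (hsa : IsSelfAdjoint T) (hT : ‖T‖ ≤ 1) (v : H) (m : ℕ) :
    ‖(T ^ (2 * m + 3)) v - (T ^ (2 * m + 1)) v‖ ≤ 1 / ((m : ℝ) + 1) * ‖v‖ := by
  have h1 : (T ^ (2 * m + 3)) v - (T ^ (2 * m + 1)) v =
      aeval T (X ^ (2 * m + 3) - X ^ (2 * m + 1) : ℝ[X]) v := by simp
  rw [h1]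
  refine norm_aeval_le hsa hT v _ (by positivity) fun t ht => ?_
  have hm : (0 : ℝ) < (m : ℝ) + 1 := by positivity
  have ht1 : |t| ≤ 1 := abs_le.2 ht
  have ht2 : t ^ 2 ≤ 1 := by rw [← sq_abs]; exact pow_le_one₀ (abs_nonneg _) ht1
  have e : (X ^ (2 * m + 3) - X ^ (2 * m + 1) : ℝ[X]).eval t =
      -(t * ((1 - t ^ 2) * (t ^ 2) ^ m)) := by
    simp only [eval_sub, eval_pow, eval_X]
    ring
  have hnn : 0 ≤ (1 - t ^ 2) * (t ^ 2) ^ m :=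
    mul_nonneg (by linarith) (pow_nonneg (sq_nonneg t) m)
  rw [e, abs_neg, abs_mul, abs_of_nonneg hnn, le_div_iff₀ hm]
  have h2 : (1 - t ^ 2) * (t ^ 2) ^ m * ((m : ℝ) + 1) ≤ 1 := by
    have h3 : ∑ _l ∈ Finset.range (m + 1), (t ^ 2) ^ m ≤
        ∑ l ∈ Finset.range (m + 1), (t ^ 2) ^ l :=
      Finset.sum_le_sum fun l hl => pow_le_pow_of_le_one (sq_nonneg t) ht2
        (by have := Finset.mem_range.1 hl; omega)
    rw [Finset.sum_const, Finset.card_range, nsmul_eq_mul] at h3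
    push_cast at h3
    have h4 := one_sub_mul_geom_sum (t ^ 2) (m + 1)
    have h5 := mul_le_mul_of_nonneg_left h3 (show 0 ≤ 1 - t ^ 2 by linarith)
    have h6 := pow_nonneg (sq_nonneg t) (m + 1)
    linarith
  calc |t| * ((1 - t ^ 2) * (t ^ 2) ^ m) * ((m : ℝ) + 1)
      = |t| * ((1 - t ^ 2) * (t ^ 2) ^ m * ((m : ℝ) + 1)) := by ring
    _ ≤ 1 * 1 := mul_le_mul ht1 h2 (by positivity) zero_le_one
    _ = 1 := one_mul 1

end PolynomialBounds

/-! ### The maximal function of the weighted sums -/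

section Weights

theorem inv_sqrt_anti {x y : ℝ} (hx : 0 < x) (hxy : x ≤ y) : 1 / √y ≤ 1 / √x :=
  one_div_le_one_div_of_le (Real.sqrt_pos.2 hx) (Real.sqrt_le_sqrt hxy)

/-- Both sides are of order `m^{-3/2}`; the right side telescopes, which bounds the variation of
`oddTerm`. -/
theorem inv_sqrt_div_le (m : ℕ) : 1 / √(2 * m + 3 : ℝ) * (1 / ((m : ℝ) + 1)) ≤
    3 * (1 / √(2 * m + 1 : ℝ) - 1 / √(2 * m + 3 : ℝ)) := by
  have hx : 0 < √(2 * m + 1 : ℝ) := Real.sqrt_pos.2 (by positivity)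
  have hy : 0 < √(2 * m + 3 : ℝ) := Real.sqrt_pos.2 (by positivity)
  have hx2 : √(2 * m + 1 : ℝ) ^ 2 = 2 * m + 1 := Real.sq_sqrt (by positivity)
  have hy2 : √(2 * m + 3 : ℝ) ^ 2 = 2 * m + 3 := Real.sq_sqrt (by positivity)
  have hxy : √(2 * m + 1 : ℝ) ≤ √(2 * m + 3 : ℝ) := Real.sqrt_le_sqrt (by linarith)
  set x := √(2 * m + 1 : ℝ)
  set y := √(2 * m + 3 : ℝ)
  have hm : (0 : ℝ) < (m : ℝ) + 1 := by positivity
  have h1 : 1 / ((m : ℝ) + 1) ≤ 3 / y ^ 2 := by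
    rw [div_le_div_iff₀ hm (by positivity), hy2]; linarith [m.cast_nonneg (α := ℝ)]
  have h2 : 1 / y ^ 3 ≤ 1 / x - 1 / y := by
    have h3 : 1 / x - 1 / y = 2 / (x * y * (x + y)) := by
      have : (y - x) * (y + x) = 2 := by ring_nf; rw [hx2, hy2]; ring
      field_simp
      linarith
    rw [h3, div_le_div_iff₀ (by positivity) (by positivity)]
    have h4 : x * y * (x + y) ≤ y * y * (y + y) := by gcongr
    nlinarith
  calc 1 / y * (1 / ((m : ℝ) + 1)) ≤ 1 / y * (3 / y ^ 2) := by gcongr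
    _ = 3 * (1 / y ^ 3) := by field_simp
    _ ≤ _ := by gcongr

theorem sum_sub_succ_le {c : ℕ → ℝ} (hc : ∀ n, 0 ≤ c n) (n : ℕ) :
    ∑ k ∈ Finset.range n, (c k - c (k + 1)) ≤ c 0 := by
  rw [Finset.sum_range_sub']
  linarith [hc n]

end Weights

/-! ### The maximal function of the paired sums -/

section Maximal

variable {S : Type*} [MeasurableSpace S] {Q : Kernel S S} [IsMarkovKernel Q] {π : Measure S}
  [IsFiniteMeasure π]

/-- The weighted partial sums of even powers. -/
noncomputable def evenSum (T : Lp ℂ 2 π →L[ℂ] Lp ℂ 2 π) (b : ℕ → ℝ) (v : Lp ℂ 2 π) (m : ℕ) :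
    Lp ℂ 2 π :=
  ∑ j ∈ Finset.Icc 1 m, b j • ((T ^ 2) ^ j) (v + T v)

open Polynomial in
/-- The polynomial underlying `evenSum`. -/
noncomputable def evenPoly (b : ℕ → ℝ) (m : ℕ) : ℝ[X] :=
  ∑ j ∈ Finset.Icc 1 m, C (b j) * ((X ^ 2) ^ j * (1 + X))

theorem eval_evenPoly (b : ℕ → ℝ) (m : ℕ) (t : ℝ) :
    (evenPoly b m).eval t = (1 + t) * weightedSum b m (t ^ 2) := by
  simp only [evenPoly, Polynomial.eval_finsetSum, weightedSum, Finset.mul_sum]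
  refine Finset.sum_congr rfl fun j _ => ?_
  simp
  ring

theorem aeval_evenPoly (T : Lp ℂ 2 π →L[ℂ] Lp ℂ 2 π) (b : ℕ → ℝ) (v : Lp ℂ 2 π) (m : ℕ) :
    Polynomial.aeval T (evenPoly b m) v = evenSum T b v m := by
  simp only [evenPoly, map_sum, evenSum, sum_apply]
  refine Finset.sum_congr rfl fun j _ => ?_
  simp [Algebra.algebraMap_eq_smul_one]

open Polynomial in
-- Up to a horizon `N = 2^M`, each `s_{2^i}` is compared with `s_N - A_i s_N`. The differences are
-- square summable, and the averages obey the maximal inequality. No bound depends on `M`, so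
-- monotone convergence concludes.
theorem maxSq_evenSum_dyadic_lt_top (h : Q.Invariant π)
    (hrev : (π ⊗ₘ Q).map Prod.swap = π ⊗ₘ Q) {b : ℕ → ℝ} (hb0 : ∀ j, 0 ≤ b j)
    (hb : ∀ j, b j ≤ 1 / √(j : ℝ)) (v : Lp ℂ 2 π)
    (hI : ∫⁻ t in Set.Icc (-1 : ℝ) 1, (ENNReal.ofReal (1 - t))⁻¹
      ∂(spectralMeasure (transitionL2 h) v) < ∞) :
    maxSq (fun i => evenSum (transitionL2 h) b v (2 ^ i)) < ∞ := by
  have hsa := isSelfAdjoint_transitionL2 h hrev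
  have hT := norm_transitionL2_le h
  set T := transitionL2 h
  set J := ∫ t in Set.Icc (-1 : ℝ) 1, 1 / (1 - t) ∂(spectralMeasure T v)
  set K₁ : ℝ≥0∞ := ENNReal.ofReal (2 * 216 * J)
  set K₂ : ℝ≥0∞ := ENNReal.ofReal (2 * 16 * J)
  have hs : ∀ m, ‖evenSum T b v m‖ₑ ^ 2 ≤ K₂ := by
    intro m
    have := sum_enorm_sq_aeval_le hsa hT hI {0} (fun _ => evenPoly b m) (2 * 16) fun t ht ht1 => by
      rw [Finset.sum_singleton, eval_evenPoly, mul_pow]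
      exact one_add_sq_mul_le (X := fun p => weightedSum b m p ^ 2) (by norm_num)
        (fun p hp0 hp1 => one_sub_mul_sq_weightedSum_le hb0 hb hp0 hp1 m) ht ht1
    rw [Finset.sum_singleton] at this
    rw [← aeval_evenPoly]
    exact this
  -- `K₁` bounds the differences, `K₂` the squared norm of `s_N`, and `42 * K₂` the maximal function
  -- of its averages; the factors `2` come from splitting squares.
  refine lt_of_le_of_lt (b := 2 * K₁ + 2 * (2 * K₂ + 2 * (42 * K₂)))
    (maxSq_le_of_forall_truncation fun M => ?_) ?_
  · set N := 2 ^ M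
    set A : ℕ → Lp ℂ 2 π := fun i => ((2 : ℝ) ^ i)⁻¹ •
      ∑ l ∈ Finset.range (2 ^ i), ((T ^ 2) ^ l) (evenSum T b v N) with hA
    set D : ℕ → Lp ℂ 2 π := fun i => evenSum T b v (2 ^ i) - evenSum T b v N + A i with hD
    have hz : ∀ i, evenSum T b v (2 ^ i) = D i + (evenSum T b v N - A i) := fun i => by
      simp only [hD]; abel
    have hDq : ∀ i, D i = aeval T (evenPoly b (2 ^ i) - evenPoly b N +
        C (((2 : ℝ) ^ i)⁻¹) * ((∑ l ∈ Finset.range (2 ^ i), (X ^ 2) ^ l) * evenPoly b N)) v := by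
      intro i
      simp only [hD, hA, map_add, map_sub, map_mul, map_sum, map_pow, aeval_X, aeval_C,
        add_apply, sub_apply, mul_apply_eq_comp, sum_apply, aeval_evenPoly,
        Algebra.algebraMap_eq_smul_one, smul_apply, one_apply_eq_self, Finset.smul_sum]
    have hDb : ∑ i ∈ Finset.range (M + 1), ‖D i‖ₑ ^ 2 ≤ K₁ := by
      simp only [hDq]
      refine sum_enorm_sq_aeval_le hsa hT hI _ _ _ fun t ht ht1 => ?_
      have := one_add_sq_mul_le (X := fun p => ∑ i ∈ Finset.range (M + 1),
        (weightedSum b (2 ^ i) p - weightedSum b (2 ^ M) p +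
          geomAverage (2 ^ i) p * weightedSum b (2 ^ M) p) ^ 2) (C := 216) (by norm_num)
        (fun p hp0 hp1 => sum_sq_difference_dyadic_le hb0 hb hp0 hp1 M) ht ht1
      refine le_of_eq_of_le ?_ this
      rw [Finset.mul_sum]
      refine Finset.sum_congr rfl fun i _ => ?_
      simp only [eval_add, eval_sub, eval_mul, eval_C, eval_finsetSum, eval_pow, eval_X,
        eval_evenPoly, geomAverage, N]
      push_cast
      ring
    simp only [hz]
    refine (maxSq_add_le (fun k => D (min k M)) _).trans ?_
    gcongr
    · exact (maxSq_truncation_le_sum D M).trans hDb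
    · refine (maxSq_sub_le _ _).trans ?_
      rw [maxSq_const]
      gcongr
      · exact hs N
      · refine (maxSq_mono (z' := A) (Eventually.of_forall fun x k => ⟨min k M, le_rfl⟩)).trans ?_
        exact (maxSq_average_le h hrev _).trans (by gcongr; exact hs N)
  · have h1 : K₁ ≠ ∞ := ENNReal.ofReal_ne_top
    have h2 : K₂ ≠ ∞ := ENNReal.ofReal_ne_top
    finiteness

open Polynomial in
-- Between consecutive powers of two there are at most `2^i` terms with `b_j² ≤ 2^{-i}`, so by
-- Cauchy–Schwarz the squared increment is at most `∑_j |u_j|²`, which is integrable by the spectral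
-- bound.
theorem maxSq_evenSum_lt_top (h : Q.Invariant π)
    (hrev : (π ⊗ₘ Q).map Prod.swap = π ⊗ₘ Q) {b : ℕ → ℝ} (hb0 : ∀ j, 0 ≤ b j)
    (hb : ∀ j, b j ≤ 1 / √(j : ℝ)) (v : Lp ℂ 2 π)
    (hI : ∫⁻ t in Set.Icc (-1 : ℝ) 1, (ENNReal.ofReal (1 - t))⁻¹
      ∂(spectralMeasure (transitionL2 h) v) < ∞) :
    maxSq (evenSum (transitionL2 h) b v) < ∞ := by
  have hsa := isSelfAdjoint_transitionL2 h hrev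
  have hT := norm_transitionL2_le h
  set T := transitionL2 h
  set J := ∫ t in Set.Icc (-1 : ℝ) 1, 1 / (1 - t) ∂(spectralMeasure T v)
  set u : ℕ → Lp ℂ 2 π := fun j => ((T ^ 2) ^ j) (v + T v) with hu
  set y : ℕ → Lp ℂ 2 π := fun k => ∑ j ∈ Finset.Ioc (2 ^ Nat.log 2 k) k, b j • u j with hy
  have hsub : ∀ k, k ≠ 0 → evenSum T b v k = evenSum T b v (2 ^ Nat.log 2 k) + y k := by
    intro k hk
    have h1 : 2 ^ Nat.log 2 k ≤ k := Nat.pow_log_le_self 2 hk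
    have h2 : ∀ m : ℕ, Finset.Icc 1 m = Finset.Ioc 0 m := fun m => by
      ext j; simp [Nat.one_le_iff_ne_zero, Nat.pos_iff_ne_zero]
    simp only [evenSum, hy, h2]
    exact (Finset.sum_Ioc_consecutive _ (Nat.zero_le _) h1).symm
  have hsum : ∑' j, ‖u j‖ₑ ^ 2 ≤ ENNReal.ofReal (2 * 1 * J) := by
    refine ENNReal.tsum_le_of_sum_range_le fun n => ?_
    have huq : ∀ j, u j = aeval T ((X ^ 2) ^ j * (1 + X) : ℝ[X]) v := fun j => by simp [hu]
    simp only [huq]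
    refine sum_enorm_sq_aeval_le hsa hT hI _ _ _ fun t ht ht1 => ?_
    have := one_add_sq_mul_le (X := fun p => ∑ j ∈ Finset.range n, (p ^ j) ^ 2) (C := 1)
      (by norm_num) (fun p hp0 hp1 => one_sub_mul_sum_sq_pow_le hp0 hp1 n) ht ht1
    refine le_of_eq_of_le ?_ this
    rw [Finset.mul_sum]
    refine Finset.sum_congr rfl fun j _ => ?_
    simp only [eval_mul, eval_pow, eval_X, eval_add, eval_one]
    ring
  have hymax : maxSq y < ∞ := by
    refine lt_of_le_of_lt ?_ (hsum.trans_lt ENNReal.ofReal_lt_top)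
    simp only [← lintegral_enorm_sq]
    rw [← lintegral_tsum fun j => ((measurable_enorm_Lp (u j)).pow_const 2).aemeasurable]
    refine lintegral_mono_ae ?_
    filter_upwards [ae_all_iff.2 fun k : ℕ => ae_coeFn_sum (Finset.Ioc (2 ^ Nat.log 2 k) k)
      fun j => b j • u j, ae_all_iff.2 fun j => Lp.coeFn_smul (b j) (u j)] with x h1 h2
    refine iSup_le fun k => ?_
    refine le_trans ?_ (ENNReal.sum_le_tsum (Finset.Ioc (2 ^ Nat.log 2 k) k))
    set i := Nat.log 2 k
    have hcard : ((Finset.Ioc (2 ^ i) k).card : ℝ) ≤ 2 ^ i := by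
      have h3 : k < 2 ^ (i + 1) := Nat.lt_pow_succ_log_self one_lt_two k
      have h4 : (Finset.Ioc (2 ^ i) k).card ≤ 2 ^ i := by
        rw [Nat.card_Ioc]; rw [pow_succ] at h3; omega
      exact_mod_cast h4
    have hreal : ‖y k x‖ ^ 2 ≤ ∑ j ∈ Finset.Ioc (2 ^ i) k, ‖u j x‖ ^ 2 := by
      have h3 : y k x = ∑ j ∈ Finset.Ioc (2 ^ i) k, b j • u j x := by
        refine (h1 k).trans (Finset.sum_congr rfl fun j _ => ?_)
        rw [h2 j, Pi.smul_apply]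
      calc ‖y k x‖ ^ 2 ≤ (∑ j ∈ Finset.Ioc (2 ^ i) k, ‖b j • u j x‖) ^ 2 := by
            rw [h3]
            gcongr
            exact norm_sum_le _ _
        _ ≤ (Finset.Ioc (2 ^ i) k).card * ∑ j ∈ Finset.Ioc (2 ^ i) k, ‖b j • u j x‖ ^ 2 :=
            sq_sum_le_card_mul_sum_sq
        _ ≤ 2 ^ i * ∑ j ∈ Finset.Ioc (2 ^ i) k, ((2 : ℝ) ^ i)⁻¹ * ‖u j x‖ ^ 2 := by
            refine mul_le_mul hcard (Finset.sum_le_sum fun j hj => ?_)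
              (Finset.sum_nonneg fun _ _ => sq_nonneg _) (by positivity)
            rw [norm_smul, mul_pow, Real.norm_of_nonneg (hb0 j)]
            refine mul_le_mul_of_nonneg_right ?_ (sq_nonneg _)
            have hj' : (2 : ℝ) ^ i ≤ j := by exact_mod_cast (Finset.mem_Ioc.1 hj).1.le
            calc b j ^ 2 ≤ (1 / √(j : ℝ)) ^ 2 := pow_le_pow_left₀ (hb0 j) (hb j) 2
              _ = (j : ℝ)⁻¹ := by rw [div_pow, Real.sq_sqrt j.cast_nonneg, one_pow, one_div]
              _ ≤ _ := inv_anti₀ (by positivity) hj'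
        _ = _ := by
            rw [← Finset.mul_sum, ← mul_assoc, mul_inv_cancel₀ (by positivity), one_mul]
    have h5 := ENNReal.ofReal_le_ofReal hreal
    rw [ENNReal.ofReal_sum_of_nonneg fun _ _ => sq_nonneg _] at h5
    simpa only [ENNReal.ofReal_pow (norm_nonneg _), ofReal_norm] using h5
  have hdy := maxSq_evenSum_dyadic_lt_top h hrev hb0 hb v hI
  refine lt_of_le_of_lt (maxSq_le_two_mul_add (u := fun i => evenSum T b v (2 ^ i)) (w := y) ?_)
    (ENNReal.add_lt_top.2 ⟨ENNReal.mul_lt_top (by simp) hdy, ENNReal.mul_lt_top (by simp) hymax⟩)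
  filter_upwards [ae_all_iff.2 fun k : ℕ =>
    Lp.coeFn_add (evenSum T b v (2 ^ Nat.log 2 k)) (y k), Lp.coeFn_zero ℂ 2 π] with x hx h0 k
  refine ⟨Nat.log 2 k, k, ?_⟩
  -- `Nat.log 2 0 = 0` would point to time `1 > 0`, so the empty sum is treated apart.
  rcases eq_or_ne k 0 with rfl | hk
  · have : evenSum T b v 0 = 0 := by simp [evenSum]
    rw [this, h0]
    simp
  · rw [hsub k hk, hx k]
    exact enorm_add_le _ _

end Maximal

/-! ### From the paired sums to the full sums -/

section Final

variable {S : Type*} [MeasurableSpace S] {Q : Kernel S S} [IsMarkovKernel Q] {π : Measure S}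
  [IsFiniteMeasure π]

/-- The partial sums `∑_{j = 1}^k j^{-1/2} T^j v`. -/
noncomputable def rootSum (T : Lp ℂ 2 π →L[ℂ] Lp ℂ 2 π) (v : Lp ℂ 2 π) (k : ℕ) : Lp ℂ 2 π :=
  ∑ j ∈ Finset.Icc 1 k, (1 / √(j : ℝ)) • (T ^ j) v

/-- The absolutely summable error made when consecutive powers get the same weight. -/
noncomputable def pairingError (T : Lp ℂ 2 π →L[ℂ] Lp ℂ 2 π) (v : Lp ℂ 2 π) (m : ℕ) : Lp ℂ 2 π :=
  T v + ∑ j ∈ Finset.range m,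
    (1 / √(2 * j + 3 : ℝ) - 1 / √(2 * j + 2 : ℝ)) • (T ^ (2 * j + 3)) v

/-- The weighted odd powers. -/
noncomputable def oddTerm (T : Lp ℂ 2 π →L[ℂ] Lp ℂ 2 π) (v : Lp ℂ 2 π) (m : ℕ) : Lp ℂ 2 π :=
  (1 / √(2 * m + 1 : ℝ)) • (T ^ (2 * m + 1)) v

theorem rootSum_succ (T : Lp ℂ 2 π →L[ℂ] Lp ℂ 2 π) (v : Lp ℂ 2 π) (k : ℕ) :
    rootSum T v (k + 1) = rootSum T v k + (1 / √((k + 1 : ℕ) : ℝ)) • (T ^ (k + 1)) v :=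
  Finset.sum_Icc_succ_top (by omega) _

/-- The power `2j + 1` is given the weight of `2j`. The unpaired first power and the weight
corrections form `pairingError`. -/
theorem rootSum_odd (T : Lp ℂ 2 π →L[ℂ] Lp ℂ 2 π) (v : Lp ℂ 2 π) (m : ℕ) :
    rootSum T v (2 * m + 1) =
      evenSum T (fun j => 1 / √(2 * j : ℝ)) v m + pairingError T v m := by
  induction m with
  | zero => simp [rootSum, evenSum, pairingError]
  | succ m ih =>
    have h1 : evenSum T (fun j => 1 / √(2 * j : ℝ)) v (m + 1) =
        evenSum T (fun j => 1 / √(2 * j : ℝ)) v m +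
          (1 / √(2 * m + 2 : ℝ)) • ((T ^ (2 * m + 2)) v + (T ^ (2 * m + 3)) v) := by
      rw [evenSum, Finset.sum_Icc_succ_top (by omega), ← evenSum, ← pow_mul, map_add,
        ← mul_apply_eq_comp (T ^ (2 * (m + 1))) T, ← pow_succ]
      simp only [show 2 * (((m + 1 : ℕ) : ℝ)) = 2 * m + 2 by push_cast; ring,
        show 2 * (m + 1) = 2 * m + 2 by ring, add_assoc, Nat.reduceAdd]
    have h2 : pairingError T v (m + 1) = pairingError T v m +
        (1 / √(2 * m + 3 : ℝ) - 1 / √(2 * m + 2 : ℝ)) • (T ^ (2 * m + 3)) v := by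
      rw [pairingError, Finset.sum_range_succ, ← add_assoc, ← pairingError]
    have c1 : ((2 * m + 1 + 1 : ℕ) : ℝ) = 2 * m + 2 := by push_cast; ring
    have c2 : ((2 * m + 1 + 1 + 1 : ℕ) : ℝ) = 2 * m + 3 := by push_cast; ring
    rw [show 2 * (m + 1) + 1 = 2 * m + 1 + 1 + 1 by ring, rootSum_succ, rootSum_succ, ih, h1, h2,
      c1, c2, sub_smul, smul_add]
    abel

theorem rootSum_even (T : Lp ℂ 2 π →L[ℂ] Lp ℂ 2 π) (v : Lp ℂ 2 π) (m : ℕ) :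
    rootSum T v (2 * m + 2) =
      evenSum T (fun j => 1 / √(2 * j : ℝ)) v (m + 1) + pairingError T v (m + 1) -
        oddTerm T v (m + 1) := by
  rw [← rootSum_odd, show 2 * (m + 1) + 1 = 2 * m + 2 + 1 by ring,
    rootSum_succ T v (2 * m + 2), oddTerm,
    show 2 * (((m + 1 : ℕ) : ℝ)) + 1 = ((2 * m + 2 + 1 : ℕ) : ℝ) by push_cast; ring,
    show 2 * (m + 1) + 1 = 2 * m + 2 + 1 by ring, add_sub_cancel_right]

theorem maxSq_pairingError_lt_top {T : Lp ℂ 2 π →L[ℂ] Lp ℂ 2 π} (hT : ‖T‖ ≤ 1)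
    (v : Lp ℂ 2 π) : maxSq (pairingError T v) < ∞ := by
  refine maxSq_lt_top_of_sum_norm_sub_le
    (C := 1 / √(2 * (0 : ℕ) + 2 : ℝ) * ‖v‖) fun n => ?_
  have hstep : ∀ m, ‖pairingError T v (m + 1) - pairingError T v m‖ ≤
      (1 / √(2 * m + 2 : ℝ) - 1 / √(2 * (m + 1 : ℕ) + 2 : ℝ)) * ‖v‖ := by
    intro m
    rw [pairingError, Finset.sum_range_succ, ← add_assoc, ← pairingError, add_sub_cancel_left,
      norm_smul]
    -- Interleaving `2m + 2`, `2m + 3`, `2m + 4` majorizes the corrections by a telescoping series.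
    have h1 : 1 / √(2 * m + 3 : ℝ) ≤ 1 / √(2 * m + 2 : ℝ) :=
      inv_sqrt_anti (by positivity) (by linarith)
    have h2 : 1 / √(2 * (m + 1 : ℕ) + 2 : ℝ) ≤ 1 / √(2 * m + 3 : ℝ) :=
      inv_sqrt_anti (by positivity) (by push_cast; linarith)
    refine mul_le_mul ?_ (norm_pow_apply_le hT _ v) (norm_nonneg _) (by linarith)
    rw [Real.norm_eq_abs, abs_sub_comm, abs_of_nonneg (by linarith)]
    linarith
  refine (Finset.sum_le_sum fun m _ => hstep m).trans ?_
  rw [← Finset.sum_mul]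
  gcongr
  exact sum_sub_succ_le (c := fun m : ℕ => 1 / √(2 * m + 2 : ℝ)) (fun m => by positivity) n

/-- The change of weight telescopes directly, and the change of power is at most three times the
same difference; hence the factor `4`. -/
theorem maxSq_oddTerm_lt_top {T : Lp ℂ 2 π →L[ℂ] Lp ℂ 2 π} (hsa : IsSelfAdjoint T)
    (hT : ‖T‖ ≤ 1) (v : Lp ℂ 2 π) : maxSq (oddTerm T v) < ∞ := by
  refine maxSq_lt_top_of_sum_norm_sub_le
    (C := 1 / √(2 * (0 : ℕ) + 1 : ℝ) * (4 * ‖v‖)) fun n => ?_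
  have hstep : ∀ m : ℕ, ‖oddTerm T v (m + 1) - oddTerm T v m‖ ≤
      (1 / √(2 * m + 1 : ℝ) - 1 / √(2 * (m + 1 : ℕ) + 1 : ℝ)) * (4 * ‖v‖) := by
    intro m
    have e : (2 * (m + 1 : ℕ) + 1 : ℝ) = 2 * m + 3 := by push_cast; ring
    rw [oddTerm, oddTerm, e, show 2 * (m + 1) + 1 = 2 * m + 3 by ring]
    set x := 1 / √(2 * m + 1 : ℝ)
    set y := 1 / √(2 * m + 3 : ℝ)
    have hy : 0 ≤ y := by positivity
    have hxy : y ≤ x := inv_sqrt_anti (by positivity) (by linarith)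
    have h1 : y • (T ^ (2 * m + 3)) v - x • (T ^ (2 * m + 1)) v =
        y • ((T ^ (2 * m + 3)) v - (T ^ (2 * m + 1)) v) - (x - y) • (T ^ (2 * m + 1)) v := by
      rw [smul_sub, sub_smul]; abel
    have h2 := norm_pow_sub_pow_le hsa hT v m
    have h3 := inv_sqrt_div_le m
    have h4 := norm_pow_apply_le hT (2 * m + 1) v
    rw [h1]
    refine (norm_sub_le _ _).trans ?_
    rw [norm_smul, norm_smul, Real.norm_of_nonneg hy, Real.norm_of_nonneg (sub_nonneg.2 hxy)]
    calc y * ‖(T ^ (2 * m + 3)) v - (T ^ (2 * m + 1)) v‖ + (x - y) * ‖(T ^ (2 * m + 1)) v‖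
        ≤ y * (1 / ((m : ℝ) + 1) * ‖v‖) + (x - y) * ‖v‖ :=
          add_le_add (mul_le_mul_of_nonneg_left h2 hy)
            (mul_le_mul_of_nonneg_left h4 (sub_nonneg.2 hxy))
      _ = y * (1 / ((m : ℝ) + 1)) * ‖v‖ + (x - y) * ‖v‖ := by ring
      _ ≤ 3 * (x - y) * ‖v‖ + (x - y) * ‖v‖ := by gcongr
      _ = _ := by ring
  refine (Finset.sum_le_sum fun m _ => hstep m).trans ?_
  rw [← Finset.sum_mul]
  gcongr
  exact sum_sub_succ_le (c := fun m : ℕ => 1 / √(2 * m + 1 : ℝ)) (fun m => by positivity) n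

theorem maxSq_rootSum_lt_top (h : Q.Invariant π)
    (hrev : (π ⊗ₘ Q).map Prod.swap = π ⊗ₘ Q) (v : Lp ℂ 2 π)
    (hI : ∫⁻ t in Set.Icc (-1 : ℝ) 1, (ENNReal.ofReal (1 - t))⁻¹
      ∂(spectralMeasure (transitionL2 h) v) < ∞) :
    maxSq (rootSum (transitionL2 h) v) < ∞ := by
  have hsa := isSelfAdjoint_transitionL2 h hrev
  have hT := norm_transitionL2_le h
  have hmain := maxSq_evenSum_lt_top h hrev (b := fun j => 1 / √(2 * j : ℝ))
    (fun j => by positivity) (fun j => by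
      -- At `j = 0` both sides are `1 / √0 = 0` by convention.
      rcases Nat.eq_zero_or_pos j with rfl | hj
      · simp
      · exact inv_sqrt_anti (by exact_mod_cast hj) (by linarith [j.cast_nonneg (α := ℝ)])) v hI
  set T := transitionL2 h
  set u : ℕ → Lp ℂ 2 π := fun m =>
    evenSum T (fun j => 1 / √(2 * j : ℝ)) v m + pairingError T v m with hu
  have hu_lt : maxSq u < ∞ := (maxSq_add_le _ _).trans_lt (ENNReal.add_lt_top.2
    ⟨ENNReal.mul_lt_top (by simp) hmain,
      ENNReal.mul_lt_top (by simp) (maxSq_pairingError_lt_top hT v)⟩)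
  refine lt_of_le_of_lt (maxSq_le_two_mul_add (u := u) (w := oddTerm T v) ?_)
    (ENNReal.add_lt_top.2 ⟨ENNReal.mul_lt_top (by simp) hu_lt,
      ENNReal.mul_lt_top (by simp) (maxSq_oddTerm_lt_top hsa hT v)⟩)
  filter_upwards [ae_all_iff.2 fun m => Lp.coeFn_sub (u m) (oddTerm T v m),
    Lp.coeFn_zero ℂ 2 π] with x hx h0 k
  rcases Nat.even_or_odd' k with ⟨m, rfl | rfl⟩
  · rcases m with _ | m
    · refine ⟨0, 0, ?_⟩
      have : rootSum T v (2 * 0) = 0 := by simp [rootSum]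
      rw [this, h0]
      simp
    · refine ⟨m + 1, m + 1, ?_⟩
      have : rootSum T v (2 * (m + 1)) = u (m + 1) - oddTerm T v (m + 1) := rootSum_even T v m
      rw [this, hx]
      exact enorm_sub_le
  · refine ⟨m, m, ?_⟩
    rw [rootSum_odd]
    exact le_self_add

theorem maximalSecondMoment_le_maxSq (h : Q.Invariant π) {f : S → ℝ} (hf : MemLp f 2 π) :
    maximalSecondMoment Q π f ≤ maxSq (rootSum (transitionL2 h) (toL2 f hf)) := by
  refine lintegral_mono_ae ?_
  have hcoe : ∀ j, ((transitionL2 h ^ j) (toL2 f hf) : S → ℂ) =ᵐ[π]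
      fun x => ((transitionPow Q j f x : ℝ) : ℂ) := fun j => by
    rw [← toL2_transitionPow h j hf]
    exact coeFn_toL2 _
  filter_upwards [ae_all_iff.2 hcoe, ae_all_iff.2 fun k : ℕ => ae_coeFn_sum (Finset.Icc 1 k)
    fun j => (1 / √(j : ℝ)) • (transitionL2 h ^ j) (toL2 f hf), ae_all_iff.2 fun j : ℕ =>
    Lp.coeFn_smul (1 / √(j : ℝ)) ((transitionL2 h ^ j) (toL2 f hf))] with x h1 h2 h3
  refine iSup₂_le fun k _ => le_iSup_of_le k (le_of_eq ?_)
  have h4 : rootSum (transitionL2 h) (toL2 f hf) k x = ((∑ j ∈ Finset.Icc 1 k,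
      (j : ℝ) ^ (-(1 / 2) : ℝ) * transitionPow Q j f x : ℝ) : ℂ) := by
    refine (h2 k).trans ?_
    rw [Complex.ofReal_sum]
    refine Finset.sum_congr rfl fun j _ => ?_
    rw [h3 j, Pi.smul_apply, h1 j, Real.rpow_neg j.cast_nonneg, ← Real.sqrt_eq_rpow, one_div]
    simp
  rw [h4, ENNReal.ofReal_pow (abs_nonneg _), ← Real.norm_eq_abs, ← Complex.norm_real, ofReal_norm]

end Final

end ReversibleChain

open ReversibleChain in
theorem corollary4p3 {S Ω : Type*} [MeasurableSpace S] [MeasurableSpace Ω]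
    (Q : Kernel S S) [IsMarkovKernel Q] (π : Measure S)
    (P : Measure Ω) [IsProbabilityMeasure P] (ξ : ℤ → Ω → S)
    (hξ : IsStationaryReversibleMarkovChain Q π P ξ)
    (f : S → ℝ) (hf : MemLp f 2 π) (hmean : ∫ x, f x ∂π = 0) :
    List.TFAE
      [CovarianceSumsBounded Q π f,
       VarianceLinearlyBounded P ξ f,
       VarianceConverges P ξ f,
       SpectralIntegralFinite hξ.invariant f hf,
       InRangeSqrt hξ.invariant f hf] ∧
    (CovarianceSumsBounded Q π f ∨
       VarianceLinearlyBounded P ξ f ∨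
       VarianceConverges P ξ f ∨
       SpectralIntegralFinite hξ.invariant f hf ∨
       InRangeSqrt hξ.invariant f hf →
      maximalSecondMoment Q π f < ∞) := by
  have htfae := hξ.tfae hf
  refine ⟨htfae, fun hor => ?_⟩
  have hπ := hξ.isProbabilityMeasure
  have hI : SpectralIntegralFinite hξ.invariant f hf := by
    rcases hor with h | h | h | h | h
    · exact (htfae.out 0 3).1 h
    · exact (htfae.out 1 3).1 h
    · exact (htfae.out 2 3).1 h
    · exact h
    · exact (htfae.out 4 3).1 h
  exact (maximalSecondMoment_le_maxSq hξ.invariant hf).trans_lt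
    (maxSq_rootSum_lt_top hξ.invariant hξ.map_swap_compProd (toL2 f hf) hI)
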